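/- Let $0<k\le l$, $L_0>0$, $M_c>0$, $M>0$. For $x,v\in\mathbb R^3$ put $L=|x\times v|^2=|x|^2|v|^2-(x\cdot v)^2$. For a nonnegative function $f=f(x,v)$ on $\mathbb R^6$ put $$\rho_f(x)=\int f(x,v)\,dv,\quad m_f(r)=\int_{|x|\le r}\rho_f\,dx,\quad \nabla U_f(x)=\frac{m_f(r)}{r^2}\frac{x}{r},\quad U_f(r)=-\int_r^\infty \frac{m_f(s)}{s^2}\,ds\qquad(r=|x|),$$ $$E_{\rm kin}(f)=\tfrac12\iint |v|^2 f\,dv\,dx,\qquad E_{\rm pot}(f)=-\frac1{8\pi}\int|\nabla U_f|^2dx-\int\frac{M_c}{|x|}\rho_f\,dx,$$ $$\mathcal C(f)=\iint f^{1+1/k}(L-L_0)_+^{-l/k}\,dv\,dx,\qquad \|g\|_{k,l}=\Big(\iint |g|^{1+1/k}(L-L_0)_+^{-l/k}\,dv\,dx\Big)^{k/(k+1)},$$ where $g$ may be any real measurable function, the weight is $+\infty$ for $L\le L_0$, and $0\cdot\infty=0$. Let $\mathcal F_M$ be the set of all $f\in L^1(\mathbb R^6)$ with $f\ge0$ which are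 spherically symmetric ($f(Ax,Av)=f(x,v)$ for all $A\in O(3)$), satisfy $\iint f=M$ and $E_{\rm kin}(f)+\mathcal C(f)<\infty$, and vanish a.e. on $\{L<L_0\}$ (all conditions up to null sets). Assume that $f_0\in\mathcal F_M$ is the unique (up to null sets) minimizer of $\mathcal H_C=E_{\rm kin}+E_{\rm pot}+\mathcal C$ over $\mathcal F_M$. Let $E=\frac12|v|^2+U_{f_0}(x)-\frac{M_c}{|x|}$, let $E_0\in\mathbb R$ (for instance the cut-off energy of $f_0$; the value of $d$ below does not depend on $E_0$, since $f$ and $f_0$ have the same mass), and for $f\in\mathcal F_M$ let $$d(f,f_0)=\iint\Big[\big(f^{1+1/k}-f_0^{1+1/k}\big)(L-L_0)_+^{-l/k}+(E-E_0)(f-f_0)\Big]dv\,dx .$$ Then for every $\varepsilon>0$ there is $\delta>0$ such that the following holds. Let $(f,U)$ be a classical solution on $[0,\infty)$ of the Vlasov--Poisson system with a point mass $M_c$ fixed at the origin, $$\partial_t f+v\cdot\nabla_x f-\nabla_x\Big(U-\frac{M_c}{|x|}\Big)\cdot\nabla_v f=0\ \ (x\ne0),\qquad \Delta U=4\pi\rho_{f(t)},\qquad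 \lim_{|x|\to\infty}U(t,x)=0,$$ that is, $f\in C^1([0,\infty)\times\mathbb R^6)$, $f\ge0$, the support of $f(t)$ is compact, uniformly for $t$ in bounded intervals, and $U(t)\in C^2(\mathbb R^3)$. If $f(0)\in C^1_c(\mathbb R^6)\cap\mathcal F_M$, $\|f(0)\|_{k,l}=\|f_0\|_{k,l}$ and $$d(f(0),f_0)+\frac1{8\pi}\int|\nabla U_{f(0)}-\nabla U_{f_0}|^2dx<\delta,$$ then $$\|f(t)-f_0\|_{k,l}<\varepsilon\qquad\text{for all } t\ge0 .$$ -/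

import Mathlib

open MeasureTheory Filter Topology Set
open scoped ENNReal

namespace VlasovPoisson

noncomputable section

/-- Position space and velocity space `ℝ³` with the Euclidean norm; phase space is the product
`Space × Space`, with points `z = (x, v)` and Lebesgue measure `volume`. -/
abbrev Space : Type := EuclideanSpace ℝ (Fin 3)

/-- The squared modulus of angular momentum, `L = |x × v|² = |x|²|v|² - (x·v)²`. -/
def angMomSq (z : Space × Space) : ℝ :=
  ‖z.1‖ ^ 2 * ‖z.2‖ ^ 2 - (inner ℝ z.1 z.2) ^ 2

/-- The spatial density `ρ_f(x) = ∫ f(x, v) dv`. -/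
def density (f : Space × Space → ℝ) (x : Space) : ℝ := ∫ v, f (x, v)

/-- The mass in a ball, `m_ρ(r) = ∫_{|x| ≤ r} ρ(x) dx`. -/
def massIn (ρ : Space → ℝ) (r : ℝ) : ℝ := ∫ x in Metric.closedBall (0 : Space) r, ρ x

/-- The field `∇U_ρ(x) = (m_ρ(r) / r²) (x / r)`, `r = |x|`. -/
def gradPot (ρ : Space → ℝ) (x : Space) : Space :=
  (massIn ρ ‖x‖ / ‖x‖ ^ 2) • (‖x‖⁻¹ • x)

/-- The potential `U_ρ(r) = - ∫_r^∞ m_ρ(s) / s² ds`, `r = |x|`. -/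
def pot (ρ : Space → ℝ) (x : Space) : ℝ := - ∫ s in Ioi ‖x‖, massIn ρ s / s ^ 2

/-- The kinetic energy `½ ∬ |v|² f` of a nonnegative `f`, as an extended nonnegative number. -/
def kinEnergy (f : Space × Space → ℝ) : ℝ≥0∞ :=
  ∫⁻ z, ENNReal.ofReal (1 / 2 * ‖z.2‖ ^ 2 * f z)

/-- The potential energy `-(1/8π) ∫ |∇U_f|² dx - ∫ (M_c / |x|) ρ_f dx`. -/
def potEnergy (Mc : ℝ) (f : Space × Space → ℝ) : ℝ :=
  - (1 / (8 * Real.pi)) * (∫ x, ‖gradPot (density f) x‖ ^ 2) - ∫ x, Mc / ‖x‖ * density f x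

/-- The integral `∬ |f|^{1+1/k} (L - L₀)_+^{-l/k} dx dv` in `[0, ∞]`. The weight is `∞` where
`L ≤ L₀`, with the convention `0 · ∞ = 0`; so for `k, l > 0` a finite value forces `f = 0` almost
everywhere on `{L ≤ L₀}`. For nonnegative `f` this is the Casimir functional. -/
def casimir (k l L₀ : ℝ) (f : Space × Space → ℝ) : ℝ≥0∞ :=
  ∫⁻ z, ‖f z‖ₑ ^ (1 + 1 / k) * ENNReal.ofReal (angMomSq z - L₀) ^ (-(l / k))

/-- The norm `‖f‖_{k,l} = (∬ |f|^{1+1/k} (L - L₀)_+^{-l/k} dx dv)^{k/(k+1)}` in `[0, ∞]`. -/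
def klNorm (k l L₀ : ℝ) (f : Space × Space → ℝ) : ℝ≥0∞ :=
  casimir k l L₀ f ^ (k / (k + 1))

/-- The set of admissible states of mass `M`. As for all elements of `L¹`, membership depends only
on the class of `f` modulo equality almost everywhere. The linear isometries of `Space` are the
elements of `O(3)`. -/
structure Admissible (k l L₀ M : ℝ) (f : Space × Space → ℝ) : Prop where
  integrable : Integrable f
  nonneg : ∀ᵐ z, 0 ≤ f z
  symmetric : ∀ A : Space ≃ₗᵢ[ℝ] Space, ∀ᵐ z : Space × Space, f (A z.1, A z.2) = f z
  mass : ∫ z, f z = M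
  finite : kinEnergy f + casimir k l L₀ f < ∞
  vanish : ∀ᵐ z, angMomSq z < L₀ → f z = 0

/-- The energy-Casimir functional `E_kin + E_pot + C` (used on admissible states, where
`E_kin + C` is finite). -/
def energyCasimir (k l L₀ Mc : ℝ) (f : Space × Space → ℝ) : ℝ :=
  (kinEnergy f).toReal + potEnergy Mc f + (casimir k l L₀ f).toReal

/-- `f` minimizes the energy-Casimir functional over the admissible states of mass `M`. -/
def IsMinimizer (k l L₀ Mc M : ℝ) (f : Space × Space → ℝ) : Prop :=
  Admissible k l L₀ M f ∧
    ∀ g, Admissible k l L₀ M g → energyCasimir k l L₀ Mc f ≤ energyCasimir k l L₀ Mc g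

/-- The particle energy `E = ½|v|² + U_{f₀}(x) - M_c / |x|` in the potential of `f₀`. -/
def particleEnergy (Mc : ℝ) (f₀ : Space × Space → ℝ) (z : Space × Space) : ℝ :=
  1 / 2 * ‖z.2‖ ^ 2 + pot (density f₀) z.1 - Mc / ‖z.1‖

/-- The distance functional
`d(f, f₀) = ∬ [(f^{1+1/k} - f₀^{1+1/k}) (L - L₀)_+^{-l/k} + (E - E₀)(f - f₀)] dv dx`.
It is used for admissible `f`, `f₀`, both of which vanish almost everywhere on `{L ≤ L₀}`, so the
value that the real power `0 ^ (-(l/k))` takes there is immaterial. -/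
def dist₀ (k l L₀ Mc E₀ : ℝ) (f f₀ : Space × Space → ℝ) : ℝ :=
  ∫ z, ((f z ^ (1 + 1 / k) - f₀ z ^ (1 + 1 / k)) * max (angMomSq z - L₀) 0 ^ (-(l / k))
    + (particleEnergy Mc f₀ z - E₀) * (f z - f₀ z))

/-- The quantity `(1/8π) ∫ |∇U_f - ∇U_g|² dx`. -/
def fieldDist (f g : Space × Space → ℝ) : ℝ :=
  1 / (8 * Real.pi) * ∫ x, ‖gradPot (density f) x - gradPot (density g) x‖ ^ 2

/-- `(f, U)` is a global classical solution, on `t ≥ 0`, of the Vlasov-Poisson system with a point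
mass `Mc` fixed at the origin:
`∂_t f + v · ∇_x f - ∇_x (U - M_c / |x|) · ∇_v f = 0`, `ΔU = 4πρ_f`, `U(t, x) → 0` as `|x| → ∞`,
with `f ≥ 0` continuously differentiable up to `t = 0`, and of compact support in `(x, v)`,
uniformly on bounded time intervals. No symmetry of `f(t)` or `U(t)` is required. Values at
negative times are irrelevant. -/
structure IsSolution (Mc : ℝ) (f : ℝ → Space × Space → ℝ) (U : ℝ → Space → ℝ) : Prop where
  nonneg : ∀ t, 0 ≤ t → ∀ z, 0 ≤ f t z
  contDiff : ContDiffOn ℝ 1 (fun p : ℝ × (Space × Space) => f p.1 p.2) (Ici 0 ×ˢ univ)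
  support : ∀ T : ℝ, ∃ R : ℝ, ∀ t ∈ Icc 0 T, ∀ x v : Space,
    R ≤ ‖x‖ ∨ R ≤ ‖v‖ → f t (x, v) = 0
  contDiff_pot : ∀ t, 0 ≤ t → ContDiff ℝ 2 (U t)
  poisson : ∀ t, 0 ≤ t → ∀ x, Laplacian.laplacian (U t) x = 4 * Real.pi * density (f t) x
  pot_tendsto : ∀ t, 0 ≤ t → Tendsto (U t) (cocompact Space) (𝓝 0)
  vlasov : ∀ t, 0 < t → ∀ x v : Space, x ≠ 0 →
    deriv (fun s => f s (x, v)) t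
      + inner ℝ v (gradient (fun y => f t (y, v)) x)
      - inner ℝ (gradient (fun y => U t y - Mc / ‖y‖) x) (gradient (fun w => f t (x, w)) v) = 0

end

end VlasovPoisson

open VlasovPoisson

/-!
The idea is that the minimizer of a conserved functional is stable once minimizing sequences are
known to converge to it in the norm of the theorem.

*The distance is an energy difference.* By Gauss' law the first variation of the energy is the
particle energy, and the remainder is minus the field distance (`FiniteEnergy.mechEnergy_sub`). Hence
`d(f, f₀)` is `H_C(f) - H_C(f₀)` plus the field distance (`dist₀_eq`), and the smallness assumption
bounds `H_C(f(0)) - H_C(f₀)`.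

*Minimizing sequences converge* (`exists_delta_klNorm_lt`). As `L > L₀` on the states considered,
`∬ f / |x|²` is bounded by the kinetic energy, which makes `H_C` coercive (`exists_kin_le`). The mass
functions of a minimizing sequence are monotone, so by Helly's theorem the fields converge in `L²`
along a subsequence (`exists_subseq_fieldDist_tendsto`). All terms of the energy other than the field
energy are affine. Comparing two members of the sequence with their midpoint, the uniform convexity of
the Casimir functional therefore gives a Cauchy sequence in the weighted norm (`casimir_sub_le`,
`tendsto_klNorm_sub`). The energy of the limit is at most the infimum
(`energyCasimir_le_of_tendsto`). It has the full mass `M`: missing mass placed at distance `s²`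
with velocities of order `s⁻¹` would gain an energy of order `s⁻²` and would cost less
than that in the Casimir functional because `k ≤ l` (`exists_admissible_lt`). So the limit is a
minimizer, which is `f₀` by uniqueness.

*The functional is conserved* (`IsSolution.admissible_and_energyCasimir_eq`). Symmetry of the solution
at later times is not assumed; it follows from uniqueness for the initial value problem
(`IsSolution.eq_of_init_eq`), applied to the solution and its rotations. Uniqueness is an `L²` estimate
of Gronwall type, with cut-offs at the singular point (`Evolution.eq_zero_of_transportDeriv_le`), in
which the difference of the fields is controlled by that of the densities (`exists_gradient_bound`).
Once the solution is symmetric, `L` is conserved along the flow (`fderiv_angMomSq_eq_zero`), the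
support stays away from the origin (`exists_eq_zero_near_origin`), and `U` is the potential given by
the mass function (`pot_eq_of_laplacian`). The Casimir functional is conserved because its integrand
is a function of `f` and `L`, with smooth approximations of the weight (`casimir_eq`). The energy is
conserved because its first variation at time `s`, the particle energy at time `s`, is constant along
the flow frozen at time `s`, while the remainder is quadratic in the time difference
(`mechEnergy_eq`).
-/

namespace VlasovPoisson

noncomputable section

/-! ### Radial potentials of integrable densities -/

/-- A density, not necessarily nonnegative or radial, such that `ρ` and `ρ / |x|²` are integrable.
For such densities the mass in the ball of radius `r` is `O(min(1, r²))`, which makes the radial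
field square integrable. -/
structure RadialSource (ρ : Space → ℝ) : Prop where
  integrable : Integrable ρ
  div_sq : Integrable (fun x => ρ x / ‖x‖ ^ 2)

namespace RadialSource

variable {ρ σ : Space → ℝ}

lemma abs (h : RadialSource ρ) : RadialSource (fun x => |ρ x|) :=
  ⟨h.integrable.abs, by simpa only [abs_div, abs_pow, abs_norm] using h.div_sq.abs⟩

end RadialSource

lemma ae_ne_zero : ∀ᵐ x : Space, x ≠ 0 := by
  simp [ae_iff, measure_singleton]

lemma massIn_abs_nonneg (ρ : Space → ℝ) (r : ℝ) : 0 ≤ massIn (fun x => |ρ x|) r :=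
  integral_nonneg fun _ => abs_nonneg _

lemma abs_massIn_le_abs (ρ : Space → ℝ) (r : ℝ) :
    |massIn ρ r| ≤ massIn (fun x => |ρ x|) r := abs_integral_le_integral_abs

lemma massIn_abs_le {ρ : Space → ℝ} (h : Integrable ρ) (r : ℝ) :
    massIn (fun x => |ρ x|) r ≤ ∫ x, |ρ x| :=
  setIntegral_le_integral h.abs (ae_of_all _ fun _ => abs_nonneg _)

lemma massIn_abs_le_sq {ρ : Space → ℝ} (h : RadialSource ρ) (r : ℝ) :
    massIn (fun x => |ρ x|) r ≤ r ^ 2 * ∫ x, |ρ x| / ‖x‖ ^ 2 := by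
  have h1 : massIn (fun x => |ρ x|) r
      ≤ ∫ x in Metric.closedBall (0 : Space) r, r ^ 2 * (|ρ x| / ‖x‖ ^ 2) := by
    refine setIntegral_mono_on_ae h.integrable.abs.integrableOn
      (h.abs.div_sq.const_mul _).integrableOn Metric.isClosed_closedBall.measurableSet ?_
    filter_upwards [ae_ne_zero] with x hx hxr
    have hx' : 0 < ‖x‖ := norm_pos_iff.2 hx
    rw [mem_closedBall_zero_iff] at hxr
    rw [mul_div_assoc', le_div_iff₀ (by positivity), mul_comm]
    gcongr
  refine h1.trans ?_
  rw [integral_const_mul]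
  exact mul_le_mul_of_nonneg_left
    (setIntegral_le_integral h.abs.div_sq (ae_of_all _ fun _ => by positivity)) (sq_nonneg r)

lemma abs_massIn_le {ρ : Space → ℝ} (h : Integrable ρ) (r : ℝ) : |massIn ρ r| ≤ ∫ x, |ρ x| :=
  (abs_massIn_le_abs ρ r).trans (massIn_abs_le h r)

lemma abs_massIn_le_sq {ρ : Space → ℝ} (h : RadialSource ρ) (r : ℝ) :
    |massIn ρ r| ≤ r ^ 2 * ∫ x, |ρ x| / ‖x‖ ^ 2 :=
  (abs_massIn_le_abs ρ r).trans (massIn_abs_le_sq h r)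

lemma massIn_const_mul (c : ℝ) (ρ : Space → ℝ) (r : ℝ) :
    massIn (fun x => c * ρ x) r = c * massIn ρ r := integral_const_mul _ _

lemma massIn_add {ρ σ : Space → ℝ} (h : Integrable ρ) (h' : Integrable σ) (r : ℝ) :
    massIn (fun x => ρ x + σ x) r = massIn ρ r + massIn σ r :=
  integral_add h.integrableOn h'.integrableOn

lemma massIn_sub {ρ σ : Space → ℝ} (h : Integrable ρ) (h' : Integrable σ) (r : ℝ) :
    massIn (fun x => ρ x - σ x) r = massIn ρ r - massIn σ r :=
  integral_sub h.integrableOn h'.integrableOn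

lemma massIn_congr {ρ σ : Space → ℝ} (h : ρ =ᵐ[volume] σ) : massIn ρ = massIn σ := by
  funext r
  exact integral_congr_ae (ae_restrict_of_ae h)

lemma massIn_mono {ρ : Space → ℝ} (h : Integrable ρ) (h0 : ∀ᵐ x, 0 ≤ ρ x) :
    Monotone (massIn ρ) := fun _ _ hrs =>
  setIntegral_mono_set h.integrableOn (ae_restrict_of_ae h0)
    (Metric.closedBall_subset_closedBall hrs).eventuallyLE

lemma massIn_nonneg {ρ : Space → ℝ} (h0 : ∀ᵐ x, 0 ≤ ρ x) (r : ℝ) : 0 ≤ massIn ρ r :=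
  integral_nonneg_of_ae (ae_restrict_of_ae h0)

lemma measurable_massIn {ρ : Space → ℝ} (h : Integrable ρ) : Measurable (massIn ρ) := by
  have hm := h.aestronglyMeasurable
  rw [massIn_congr hm.ae_eq_mk]
  have : massIn (hm.mk ρ) = fun r => ∫ x, {p : ℝ × Space | ‖p.2‖ ≤ p.1}.indicator
      (fun p => hm.mk ρ p.2) (r, x) := by
    funext r
    rw [massIn, ← integral_indicator Metric.isClosed_closedBall.measurableSet]
    refine integral_congr_ae (ae_of_all _ fun x => ?_)
    simp [indicator]
  rw [this]
  refine (StronglyMeasurable.integral_prod_right (f := fun r x =>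
    {p : ℝ × Space | ‖p.2‖ ≤ p.1}.indicator (fun p => hm.mk ρ p.2) (r, x)) ?_).measurable
  refine StronglyMeasurable.indicator ?_ (measurableSet_le (by fun_prop) (by fun_prop))
  exact hm.stronglyMeasurable_mk.comp_measurable measurable_snd

lemma norm_gradPot (ρ : Space → ℝ) (x : Space) : ‖gradPot ρ x‖ = |massIn ρ ‖x‖| / ‖x‖ ^ 2 := by
  rw [gradPot, norm_smul, norm_smul]
  rcases eq_or_ne x 0 with rfl | hx
  · simp
  have : ‖x‖ ≠ 0 := norm_ne_zero_iff.2 hx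
  simp [this]

lemma norm_gradPot_sq (ρ : Space → ℝ) (x : Space) :
    ‖gradPot ρ x‖ ^ 2 = massIn ρ ‖x‖ ^ 2 / ‖x‖ ^ 4 := by
  rw [norm_gradPot, div_pow, sq_abs, ← pow_mul]

lemma inner_gradPot (ρ σ : Space → ℝ) (x : Space) :
    inner ℝ (gradPot ρ x) (gradPot σ x) = massIn ρ ‖x‖ * massIn σ ‖x‖ / ‖x‖ ^ 4 := by
  simp only [gradPot, real_inner_smul_left, real_inner_smul_right, real_inner_self_eq_norm_sq]
  rcases eq_or_ne x 0 with rfl | hx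
  · simp
  have : ‖x‖ ≠ 0 := norm_ne_zero_iff.2 hx
  field_simp

lemma gradPot_const_mul (c : ℝ) (ρ : Space → ℝ) (x : Space) :
    gradPot (fun y => c * ρ y) x = c • gradPot ρ x := by
  simp only [gradPot, massIn_const_mul, smul_smul]
  ring_nf

lemma gradPot_sub {ρ σ : Space → ℝ} (h : Integrable ρ) (h' : Integrable σ) (x : Space) :
    gradPot (fun y => ρ y - σ y) x = gradPot ρ x - gradPot σ x := by
  simp only [gradPot, massIn_sub h h', sub_div, sub_smul]

lemma gradPot_congr {ρ σ : Space → ℝ} (h : ρ =ᵐ[volume] σ) : gradPot ρ = gradPot σ := by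
  funext x
  simp only [gradPot, massIn_congr h]

lemma measurable_gradPot {ρ : Space → ℝ} (h : Integrable ρ) : Measurable (gradPot ρ) := by
  have := (measurable_massIn h).comp (measurable_norm (α := Space))
  unfold gradPot
  exact (this.div (by fun_prop)).smul (by fun_prop)

lemma integrable_inv_one_add_norm_pow_four : Integrable (fun x : Space => ((1 + ‖x‖) ^ 4)⁻¹) := by
  have := integrable_one_add_norm (E := Space) (μ := volume) (r := 4) (by simp; norm_num)
  refine this.congr (ae_of_all _ fun x => ?_)
  simp only
  rw [Real.rpow_neg (by positivity)]
  norm_cast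

/-- A function bounded by `min(A / r, B r)`, squared and divided by `r²`: the domination used for
all square integrals of radial fields. -/
lemma sq_div_pow_four_le {m A B r : ℝ} (hr : 0 ≤ r) (hA : |m| ≤ A) (hB : |m| ≤ r ^ 2 * B) :
    m ^ 2 / r ^ 4 ≤ (16 * (A ^ 2 + B ^ 2)) * ((1 + r) ^ 4)⁻¹ := by
  have hA2 : m ^ 2 ≤ A ^ 2 := by rw [← sq_abs m]; gcongr
  have hB2 : m ^ 2 ≤ r ^ 4 * B ^ 2 := by
    have : m ^ 2 ≤ (r ^ 2 * B) ^ 2 := by rw [← sq_abs m]; gcongr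
    calc m ^ 2 ≤ _ := this
      _ = _ := by ring
  rcases hr.eq_or_lt with rfl | hr'
  · simp; positivity
  rw [div_le_iff₀ (by positivity), ← div_eq_mul_inv, div_mul_eq_mul_div,
    le_div_iff₀ (by positivity)]
  rcases le_total r 1 with h1 | h1
  · have h2 : (1 + r) ^ 4 ≤ 16 := by
      calc (1 + r) ^ 4 ≤ (1 + 1) ^ 4 := by gcongr
        _ = 16 := by norm_num
    calc m ^ 2 * (1 + r) ^ 4 ≤ (r ^ 4 * B ^ 2) * 16 := by gcongr
      _ ≤ _ := by nlinarith [mul_nonneg (sq_nonneg A) (pow_nonneg hr 4)]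
  · have h2 : (1 + r) ^ 4 ≤ 16 * r ^ 4 := by
      calc (1 + r) ^ 4 ≤ (r + r) ^ 4 := by gcongr
        _ = 16 * r ^ 4 := by ring
    calc m ^ 2 * (1 + r) ^ 4 ≤ A ^ 2 * (16 * r ^ 4) := by gcongr
      _ ≤ _ := by nlinarith [mul_nonneg (sq_nonneg B) (pow_nonneg hr 4)]

lemma RadialSource.integrable_sq {ρ : Space → ℝ} (h : RadialSource ρ) :
    Integrable (fun x => ‖gradPot ρ x‖ ^ 2) := by
  refine (integrable_inv_one_add_norm_pow_four.const_mul
    (16 * ((∫ x, |ρ x|) ^ 2 + (∫ x, |ρ x| / ‖x‖ ^ 2) ^ 2))).mono'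
    ((measurable_gradPot h.integrable).norm.pow_const 2).aestronglyMeasurable
    (ae_of_all _ fun x => ?_)
  rw [Real.norm_of_nonneg (by positivity), norm_gradPot_sq]
  exact sq_div_pow_four_le (norm_nonneg x) (abs_massIn_le h.integrable _) (abs_massIn_le_sq h _)

lemma RadialSource.integrable_inner {ρ σ : Space → ℝ} (h : RadialSource ρ) (h' : RadialSource σ) :
    Integrable (fun x => inner ℝ (gradPot ρ x) (gradPot σ x)) := by
  refine (h.integrable_sq.add h'.integrable_sq).mono
    ((measurable_gradPot h.integrable).aestronglyMeasurable.inner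
      (measurable_gradPot h'.integrable).aestronglyMeasurable) (ae_of_all _ fun x => ?_)
  refine (norm_inner_le_norm _ _).trans ?_
  simp only [Pi.add_apply]
  rw [Real.norm_of_nonneg (by positivity)]
  nlinarith [sq_nonneg (‖gradPot ρ x‖ - ‖gradPot σ x‖), norm_nonneg (gradPot ρ x),
    norm_nonneg (gradPot σ x), sq_nonneg ‖gradPot ρ x‖, sq_nonneg ‖gradPot σ x‖]

/-- Integration of a radial function in polar coordinates of `ℝ³`. -/
lemma integral_radial (g : ℝ → ℝ) :
    ∫ x : Space, g ‖x‖ = 4 * Real.pi * ∫ r in Ioi (0 : ℝ), r ^ 2 * g r := by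
  rw [integral_fun_norm_addHaar volume g]
  have : (volume : Measure Space).real (Metric.ball 0 1) = Real.pi * 4 / 3 := by
    rw [Measure.real, EuclideanSpace.volume_ball_fin_three]
    simp
    positivity
  simp [this]
  ring

/-- The potential at `y` as a volume integral over the region outside of the sphere of `y`. -/
lemma integral_outside_eq_pot (σ : Space → ℝ) {y : Space} :
    ∫ x : Space, (if ‖y‖ ≤ ‖x‖ then massIn σ ‖x‖ / ‖x‖ ^ 4 else 0) = -(4 * Real.pi) * pot σ y := by
  rw [integral_radial (fun r => if ‖y‖ ≤ r then massIn σ r / r ^ 4 else 0), pot]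
  have h1 : ∫ r in Ioi (0 : ℝ), r ^ 2 * (if ‖y‖ ≤ r then massIn σ r / r ^ 4 else 0)
      = ∫ r in Ioi (0 : ℝ), (Ioi ‖y‖).indicator (fun r => massIn σ r / r ^ 2) r := by
    refine integral_congr_ae ?_
    have : ∀ᵐ r : ℝ, r ≠ ‖y‖ := by simp [ae_iff, measure_singleton]
    filter_upwards [ae_restrict_of_ae this, ae_restrict_mem measurableSet_Ioi] with r hr hr0
    have hr0' : r ≠ 0 := ne_of_gt hr0
    by_cases h : ‖y‖ ≤ r
    · have h' : ‖y‖ < r := lt_of_le_of_ne h hr.symm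
      simp only [h, if_true, indicator, mem_Ioi, h']
      field_simp
    · have h' : ¬ ‖y‖ < r := fun h' => h h'.le
      simp [indicator, h, h']
  rw [h1, setIntegral_indicator measurableSet_Ioi, inter_eq_right.2 (Ioi_subset_Ioi (norm_nonneg y))]
  ring

/-- Gauss' law in integrated form: both sides are the double integral of `ρ(y) m_σ(|x|) / |x|⁴`
over `|y| ≤ |x|`. -/
lemma integral_inner_gradPot {ρ σ : Space → ℝ} (h : RadialSource ρ) (h' : RadialSource σ) :
    Integrable (fun x => ρ x * pot σ x) ∧
    ∫ x, inner ℝ (gradPot ρ x) (gradPot σ x) = -(4 * Real.pi) * ∫ x, ρ x * pot σ x := by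
  -- integrating `F` over `y` gives the left side, integrating over `x` the right side
  let F : Space → Space → ℝ := fun y x =>
    ρ y * (if ‖y‖ ≤ ‖x‖ then massIn σ ‖x‖ / ‖x‖ ^ 4 else 0)
  have hms : Measurable fun x : Space => massIn σ ‖x‖ / ‖x‖ ^ 4 :=
    ((measurable_massIn h'.integrable).comp measurable_norm).div (by fun_prop)
  have hset : ∀ x : Space, MeasurableSet {y : Space | ‖y‖ ≤ ‖x‖} := fun x =>
    measurableSet_le (by fun_prop) (by fun_prop)
  have hinner : ∀ (τ : Space → ℝ) (x : Space),
      ∫ y, τ y * (if ‖y‖ ≤ ‖x‖ then massIn σ ‖x‖ / ‖x‖ ^ 4 else 0)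
        = massIn τ ‖x‖ * massIn σ ‖x‖ / ‖x‖ ^ 4 := by
    intro τ x
    have : ∀ y, τ y * (if ‖y‖ ≤ ‖x‖ then massIn σ ‖x‖ / ‖x‖ ^ 4 else 0)
        = (Metric.closedBall (0 : Space) ‖x‖).indicator τ y * (massIn σ ‖x‖ / ‖x‖ ^ 4) := by
      intro y
      by_cases hy : ‖y‖ ≤ ‖x‖ <;> simp [indicator, hy]
    simp_rw [this]
    rw [integral_mul_const, integral_indicator Metric.isClosed_closedBall.measurableSet,
      mul_div_assoc]
    rfl
  have hF : Integrable (Function.uncurry F) ((volume : Measure Space).prod volume) := by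
    have hmeas : AEStronglyMeasurable (Function.uncurry F)
        ((volume : Measure Space).prod volume) := by
      refine (h.integrable.aestronglyMeasurable.comp_fst).mul ?_
      refine Measurable.aestronglyMeasurable ?_
      refine Measurable.ite (measurableSet_le (by fun_prop) (by fun_prop)) ?_ measurable_const
      exact hms.comp measurable_snd
    rw [integrable_prod_iff' hmeas]
    constructor
    · refine ae_of_all _ fun x => ?_
      have : (fun y => Function.uncurry F (y, x)) = fun y =>
          {y : Space | ‖y‖ ≤ ‖x‖}.indicator ρ y * (massIn σ ‖x‖ / ‖x‖ ^ 4) := by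
        funext y
        by_cases hy : ‖y‖ ≤ ‖x‖ <;> simp [F, indicator, hy]
      rw [this]
      exact (h.integrable.indicator (hset x)).mul_const _
    · have := (h.abs.integrable_inner h').norm
      refine this.congr (ae_of_all _ fun x => ?_)
      simp only [Function.uncurry, F, norm_mul, Real.norm_eq_abs, inner_gradPot]
      have h2 : ∀ y, |ρ y| * |if ‖y‖ ≤ ‖x‖ then massIn σ ‖x‖ / ‖x‖ ^ 4 else 0|
          = |(|ρ y| * if ‖y‖ ≤ ‖x‖ then massIn σ ‖x‖ / ‖x‖ ^ 4 else 0)| := by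
        intro y; rw [abs_mul, abs_abs]
      have h3 : ∀ y, |ρ y| * |if ‖y‖ ≤ ‖x‖ then massIn σ ‖x‖ / ‖x‖ ^ 4 else 0|
          = (Metric.closedBall (0 : Space) ‖x‖).indicator (fun y => |ρ y|) y
            * |massIn σ ‖x‖ / ‖x‖ ^ 4| := by
        intro y
        by_cases hy : ‖y‖ ≤ ‖x‖ <;> simp [indicator, hy]
      simp_rw [h3]
      rw [integral_mul_const, integral_indicator Metric.isClosed_closedBall.measurableSet,
        mul_div_assoc, abs_mul]
      congr 1
      exact abs_of_nonneg (massIn_abs_nonneg ρ _)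
  have hpot : ∀ y, ∫ x, F y x = -(4 * Real.pi) * (ρ y * pot σ y) := by
    intro y
    simp only [F]
    rw [integral_const_mul, integral_outside_eq_pot]
    ring
  constructor
  · have := hF.integral_prod_left
    simp only [Function.uncurry_apply_pair, hpot] at this
    have h4 := this.const_mul (-(4 * Real.pi))⁻¹
    refine h4.congr (ae_of_all _ fun x => ?_)
    have : Real.pi ≠ 0 := Real.pi_ne_zero
    field_simp
  · rw [← integral_const_mul]
    simp_rw [← hpot]
    rw [integral_integral_swap hF]
    refine integral_congr_ae (ae_of_all _ fun x => ?_)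
    simp only [inner_gradPot, F, hinner]

lemma abs_pot_le {ρ : Space → ℝ} (h : Integrable ρ) {x : Space} (hx : x ≠ 0) :
    |pot ρ x| ≤ (∫ y, |ρ y|) / ‖x‖ := by
  have hx' : 0 < ‖x‖ := norm_pos_iff.2 hx
  have hint : IntegrableOn (fun s : ℝ => (∫ y, |ρ y|) * s ^ (-2 : ℝ)) (Ioi ‖x‖) :=
    (integrableOn_Ioi_rpow_of_lt (by norm_num) hx').const_mul _
  rw [pot, abs_neg]
  calc |∫ s in Ioi ‖x‖, massIn ρ s / s ^ 2|
      ≤ ∫ s in Ioi ‖x‖, (∫ y, |ρ y|) * s ^ (-2 : ℝ) := by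
        rw [← Real.norm_eq_abs]
        refine norm_integral_le_of_norm_le hint ?_
        filter_upwards [ae_restrict_mem measurableSet_Ioi] with s hs
        have hs' : 0 < s := hx'.trans hs
        rw [Real.rpow_neg hs'.le, norm_div, ← div_eq_mul_inv]
        norm_cast
        rw [Real.norm_of_nonneg (sq_nonneg s)]
        gcongr
        exact abs_massIn_le h s
    _ = (∫ y, |ρ y|) / ‖x‖ := by
        rw [integral_const_mul, integral_Ioi_rpow_of_lt (by norm_num) hx', div_eq_mul_inv]
        congr 1
        norm_num
        rw [Real.rpow_neg_one]

lemma integrable_fun_sub {α : Type*} [MeasurableSpace α] {μ : Measure α} {f g : α → ℝ}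
    (hf : Integrable f μ) (hg : Integrable g μ) : Integrable (fun x => f x - g x) μ := hf.sub hg

/-! ### States of finite energy and the energy identity -/

/-- A phase-space function, not necessarily nonnegative, for which mass, kinetic energy and the
moment `∬ |f| / |x|²` are finite. -/
structure FiniteEnergy (f : Space × Space → ℝ) : Prop where
  integrable : Integrable f
  div_sq : Integrable (fun z => f z / ‖z.1‖ ^ 2)
  kin : Integrable (fun z => ‖z.2‖ ^ 2 * f z)

/-- Kinetic plus potential energy of a state of finite energy. -/
def mechEnergy (Mc : ℝ) (f : Space × Space → ℝ) : ℝ :=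
  1 / 2 * (∫ z, ‖z.2‖ ^ 2 * f z) + potEnergy Mc f

lemma integrable_mul_density {f : Space × Space → ℝ} {h : Space → ℝ}
    (hf : Integrable (fun z => h z.1 * f z)) : Integrable (fun x => h x * density f x) := by
  have := Integrable.integral_prod_left (μ := (volume : Measure Space)) (ν := volume) hf
  simp only [integral_const_mul] at this
  exact this

lemma integral_mul_density {f : Space × Space → ℝ} {h : Space → ℝ}
    (hf : Integrable (fun z => h z.1 * f z)) :
    ∫ x, h x * density f x = ∫ z, h z.1 * f z := by
  rw [Measure.volume_eq_prod, integral_prod _ hf]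
  simp only [integral_const_mul, density]

lemma integrable_density {f : Space × Space → ℝ} (hf : Integrable f) : Integrable (density f) := by
  simpa using integrable_mul_density (f := f) (h := fun _ => 1) (by simpa using hf)

lemma integral_density {f : Space × Space → ℝ} (hf : Integrable f) :
    ∫ x, density f x = ∫ z, f z := by
  simpa using integral_mul_density (f := f) (h := fun _ => 1) (by simpa using hf)

lemma density_sub_ae {f g : Space × Space → ℝ} (hf : Integrable f) (hg : Integrable g) :
    density (fun z => f z - g z) =ᵐ[volume] fun x => density f x - density g x := by
  filter_upwards [Integrable.prod_right_ae (μ := (volume : Measure Space)) (ν := volume) hf,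
    Integrable.prod_right_ae (μ := (volume : Measure Space)) (ν := volume) hg] with x h1 h2
  exact integral_sub h1 h2

lemma density_add_ae {f g : Space × Space → ℝ} (hf : Integrable f) (hg : Integrable g) :
    density (fun z => f z + g z) =ᵐ[volume] fun x => density f x + density g x := by
  filter_upwards [Integrable.prod_right_ae (μ := (volume : Measure Space)) (ν := volume) hf,
    Integrable.prod_right_ae (μ := (volume : Measure Space)) (ν := volume) hg] with x h1 h2
  exact integral_add h1 h2

lemma density_const_mul (c : ℝ) (f : Space × Space → ℝ) :
    density (fun z => c * f z) = fun x => c * density f x := by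
  funext x
  exact integral_const_mul _ _

lemma density_nonneg_ae {f : Space × Space → ℝ} (h : ∀ᵐ z, 0 ≤ f z) :
    ∀ᵐ x, 0 ≤ density f x := by
  have := Measure.ae_ae_of_ae_prod (μ := (volume : Measure Space)) (ν := (volume : Measure Space)) h
  filter_upwards [this] with x hx using integral_nonneg_of_ae hx

/-- The mass of `f` over the cylinder `|x| ≤ r`. -/
lemma massIn_density {f : Space × Space → ℝ} (hf : Integrable f) (r : ℝ) :
    massIn (density f) r = ∫ z in {z : Space × Space | ‖z.1‖ ≤ r}, f z := by
  have hs : MeasurableSet {z : Space × Space | ‖z.1‖ ≤ r} :=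
    measurableSet_le (by fun_prop) (by fun_prop)
  rw [massIn, ← integral_indicator Metric.isClosed_closedBall.measurableSet,
    ← integral_indicator hs]
  have h1 : ∀ z : Space × Space, {z : Space × Space | ‖z.1‖ ≤ r}.indicator f z
      = (Metric.closedBall (0 : Space) r).indicator (fun _ => (1 : ℝ)) z.1 * f z := by
    intro z
    by_cases hz : ‖z.1‖ ≤ r <;> simp [indicator, hz]
  have h2 : ∀ x : Space, (Metric.closedBall (0 : Space) r).indicator (density f) x
      = (Metric.closedBall (0 : Space) r).indicator (fun _ => (1 : ℝ)) x * density f x := by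
    intro x
    by_cases hz : ‖x‖ ≤ r <;> simp [indicator, hz]
  simp_rw [h2]
  rw [integral_mul_density]
  · simp_rw [h1]
  · simp_rw [← h1]
    exact hf.indicator hs

namespace FiniteEnergy

variable {f g : Space × Space → ℝ}

lemma sub (hf : FiniteEnergy f) (hg : FiniteEnergy g) : FiniteEnergy (fun z => f z - g z) where
  integrable := hf.integrable.sub hg.integrable
  div_sq := by simp only [sub_div]; exact hf.div_sq.sub hg.div_sq
  kin := by simp only [mul_sub]; exact hf.kin.sub hg.kin

lemma add (hf : FiniteEnergy f) (hg : FiniteEnergy g) : FiniteEnergy (fun z => f z + g z) where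
  integrable := hf.integrable.add hg.integrable
  div_sq := by simp only [add_div]; exact hf.div_sq.add hg.div_sq
  kin := by simp only [mul_add]; exact hf.kin.add hg.kin

lemma const_mul (hf : FiniteEnergy f) (c : ℝ) : FiniteEnergy (fun z => c * f z) where
  integrable := hf.integrable.const_mul c
  div_sq := by simpa only [mul_div_assoc] using hf.div_sq.const_mul c
  kin := by simpa only [mul_left_comm] using hf.kin.const_mul c

lemma radialSource (hf : FiniteEnergy f) : RadialSource (density f) := by
  refine ⟨integrable_density hf.integrable, ?_⟩
  have := integrable_mul_density (f := f) (h := fun x => (‖x‖ ^ 2)⁻¹)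
    (by simpa only [div_eq_inv_mul] using hf.div_sq)
  simpa only [div_eq_inv_mul] using this

lemma div_norm (hf : FiniteEnergy f) : Integrable (fun z => f z / ‖z.1‖) := by
  refine (hf.integrable.abs.add hf.div_sq.abs).mono
    (hf.integrable.aestronglyMeasurable.div₀ (by fun_prop)) (ae_of_all _ fun z => ?_)
  simp only [Pi.add_apply, Real.norm_eq_abs, abs_div, abs_norm, abs_pow]
  rw [abs_of_nonneg (by positivity : 0 ≤ |f z| + |f z| / ‖z.1‖ ^ 2)]
  rcases eq_or_ne ‖z.1‖ 0 with h0 | h0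
  · simp [h0]
  -- `1 / r ≤ 1 + 1 / r ^ 2`
  have : |f z| + |f z| / ‖z.1‖ ^ 2 - |f z| / ‖z.1‖
      = |f z| * ((1 - 1 / (2 * ‖z.1‖)) ^ 2 + 3 / (4 * ‖z.1‖ ^ 2)) := by field_simp; ring
  have h2 : 0 ≤ |f z| * ((1 - 1 / (2 * ‖z.1‖)) ^ 2 + 3 / (4 * ‖z.1‖ ^ 2)) := by positivity
  linarith

lemma pot_mul (hf : FiniteEnergy f) (hg : FiniteEnergy g) :
    Integrable (fun z : Space × Space => pot (density g) z.1 * f z) := by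
  have hmeas : AEStronglyMeasurable (fun z : Space × Space => pot (density g) z.1) := by
    have h2 : Measurable (pot (density g)) := by
      have : pot (density g) = fun y => -(4 * Real.pi)⁻¹ * ∫ x : Space,
          (if ‖y‖ ≤ ‖x‖ then massIn (density g) ‖x‖ / ‖x‖ ^ 4 else 0) := by
        funext y
        rw [integral_outside_eq_pot]
        have := Real.pi_ne_zero
        field_simp
      rw [this]
      refine Measurable.const_mul (StronglyMeasurable.integral_prod_right
        (f := fun (y : Space) (x : Space) =>
          (if ‖y‖ ≤ ‖x‖ then massIn (density g) ‖x‖ / ‖x‖ ^ 4 else 0)) ?_).measurable _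
      refine Measurable.stronglyMeasurable ?_
      refine Measurable.ite (measurableSet_le (by fun_prop) (by fun_prop)) ?_ measurable_const
      have hmm : Measurable fun x : Space => massIn (density g) ‖x‖ / ‖x‖ ^ 4 :=
        ((measurable_massIn hg.radialSource.integrable).comp measurable_norm).div (by fun_prop)
      exact hmm.comp measurable_snd
    exact (h2.comp measurable_fst).aestronglyMeasurable
  refine (hf.div_norm.abs.const_mul (∫ y, |density g y|)).mono'
    (hmeas.mul hf.integrable.aestronglyMeasurable) ?_
  have h0 : ∀ᵐ z : Space × Space, z.1 ≠ 0 :=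
    Measure.quasiMeasurePreserving_fst.ae ae_ne_zero
  filter_upwards [h0] with z hz
  rw [norm_mul, Real.norm_eq_abs, Real.norm_eq_abs, abs_div, abs_norm]
  calc |pot (density g) z.1| * |f z| ≤ (∫ y, |density g y|) / ‖z.1‖ * |f z| := by
        gcongr; exact abs_pot_le hg.radialSource.integrable hz
    _ = _ := by ring

lemma integrable_particleEnergy_mul (Mc : ℝ) (hg : FiniteEnergy g) (hf : FiniteEnergy f) :
    Integrable (fun z => particleEnergy Mc g z * f z) := by
  have h := ((hf.kin.const_mul (1 / 2)).add (hf.pot_mul hg)).sub (hf.div_norm.const_mul Mc)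
  refine h.congr (ae_of_all _ fun z => ?_)
  simp only [Pi.add_apply, Pi.sub_apply, particleEnergy]
  ring

lemma integral_particleEnergy_mul (Mc : ℝ) (hg : FiniteEnergy g) (hf : FiniteEnergy f) :
    ∫ z, particleEnergy Mc g z * f z = 1 / 2 * (∫ z, ‖z.2‖ ^ 2 * f z)
      + (∫ z, pot (density g) z.1 * f z) - Mc * ∫ z, f z / ‖z.1‖ := by
  rw [← integral_const_mul, ← integral_const_mul, ← integral_add (hf.kin.const_mul _)
    (hf.pot_mul hg), ← integral_sub ((hf.kin.const_mul _).fun_add (hf.pot_mul hg))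
    (hf.div_norm.const_mul Mc)]
  refine integral_congr_ae (ae_of_all _ fun z => ?_)
  simp only [particleEnergy]
  ring

lemma potEnergy_eq (Mc : ℝ) (hf : FiniteEnergy f) :
    potEnergy Mc f = - (1 / (8 * Real.pi)) * (∫ x, ‖gradPot (density f) x‖ ^ 2)
      - Mc * ∫ z, f z / ‖z.1‖ := by
  rw [potEnergy]
  congr 1
  rw [integral_mul_density (f := f) (h := fun x => Mc / ‖x‖), ← integral_const_mul]
  · refine integral_congr_ae (ae_of_all _ fun z => ?_)
    simp only
    ring
  · refine (hf.div_norm.const_mul Mc).congr (ae_of_all _ fun z => ?_)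
    simp only
    ring

lemma gradPot_density_sub (hf : FiniteEnergy f) (hg : FiniteEnergy g) (x : Space) :
    gradPot (density fun z => f z - g z) x = gradPot (density f) x - gradPot (density g) x := by
  rw [gradPot_congr (density_sub_ae hf.integrable hg.integrable),
    gradPot_sub hf.radialSource.integrable hg.radialSource.integrable]

lemma fieldDist_eq (hf : FiniteEnergy f) (hg : FiniteEnergy g) :
    fieldDist f g = 1 / (8 * Real.pi) * ∫ x, ‖gradPot (density fun z => f z - g z) x‖ ^ 2 := by
  simp only [fieldDist, hf.gradPot_density_sub hg]

/-- The first variation of the energy is the particle energy, and the remainder is exactly the field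
distance, because only the field energy is not affine. -/
lemma mechEnergy_sub (Mc : ℝ) (hf : FiniteEnergy f) (hg : FiniteEnergy g) :
    mechEnergy Mc f - mechEnergy Mc g
      = (∫ z, particleEnergy Mc g z * (f z - g z)) - fieldDist f g := by
  have hpi := Real.pi_ne_zero
  have hd := hf.sub hg
  rw [integral_particleEnergy_mul Mc hg hd, mechEnergy, mechEnergy, potEnergy_eq Mc hf,
    potEnergy_eq Mc hg, fieldDist_eq hf hg]
  have e1 : ∫ z, ‖z.2‖ ^ 2 * (f z - g z) = (∫ z, ‖z.2‖ ^ 2 * f z) - ∫ z, ‖z.2‖ ^ 2 * g z := by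
    simp only [mul_sub]; exact integral_sub hf.kin hg.kin
  have e2 : ∫ z, (f z - g z) / ‖z.1‖ = (∫ z, f z / ‖z.1‖) - ∫ z, g z / ‖z.1‖ := by
    simp only [sub_div]; exact integral_sub hf.div_norm hg.div_norm
  -- the linear term of the field energy, by Gauss' law
  have e3 : ∫ z, pot (density g) z.1 * (f z - g z)
      = -(1 / (4 * Real.pi)) * ∫ x, inner ℝ (gradPot (density fun z => f z - g z) x)
        (gradPot (density g) x) := by
    rw [(integral_inner_gradPot hd.radialSource hg.radialSource).2,
      ← integral_mul_density (f := fun z => f z - g z) (h := pot (density g)) (hd.pot_mul hg)]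
    simp only [mul_comm (density _ _)]
    field_simp
  have e4 : ∫ x, ‖gradPot (density f) x‖ ^ 2
      = (∫ x, ‖gradPot (density fun z => f z - g z) x‖ ^ 2)
        + 2 * (∫ x, inner ℝ (gradPot (density fun z => f z - g z) x) (gradPot (density g) x))
        + ∫ x, ‖gradPot (density g) x‖ ^ 2 := by
    rw [← integral_const_mul, ← integral_add hd.radialSource.integrable_sq
      ((hd.radialSource.integrable_inner hg.radialSource).const_mul 2), ← integral_add
      (hd.radialSource.integrable_sq.fun_add
      ((hd.radialSource.integrable_inner hg.radialSource).const_mul 2))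
      hg.radialSource.integrable_sq]
    refine integral_congr_ae (ae_of_all _ fun x => ?_)
    simp only
    rw [hf.gradPot_density_sub hg, ← norm_add_sq_real, sub_add_cancel]
  rw [e1, e2, e3, e4]
  field_simp
  ring

/-- The field energy is bounded by the mass times the moment `∬ |f| / |x|`. -/
lemma field_le (hf : FiniteEnergy f) :
    1 / (8 * Real.pi) * (∫ x, ‖gradPot (density f) x‖ ^ 2)
      ≤ 1 / 2 * (∫ z, |f z|) * ∫ z, |f z| / ‖z.1‖ := by
  have hpi := Real.pi_pos
  have h1 : ∫ x, ‖gradPot (density f) x‖ ^ 2 = -(4 * Real.pi) * ∫ z, pot (density f) z.1 * f z := by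
    rw [← integral_mul_density (f := f) (h := pot (density f)) (hf.pot_mul hf)]
    simp only [mul_comm (pot _ _)]
    rw [← (integral_inner_gradPot hf.radialSource hf.radialSource).2]
    simp only [real_inner_self_eq_norm_sq]
  have hmass : ∫ x, |density f x| ≤ ∫ z, |f z| := by
    rw [← integral_density hf.integrable.abs]
    exact integral_mono_ae (integrable_density hf.integrable).abs
      (integrable_density hf.integrable.abs) (ae_of_all _ fun x => abs_integral_le_integral_abs)
  have h2 : -∫ z, pot (density f) z.1 * f z ≤ (∫ z, |f z|) * ∫ z, |f z| / ‖z.1‖ := by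
    rw [← integral_const_mul, ← integral_neg]
    refine integral_mono_ae (hf.pot_mul hf).neg ?_ ?_
    · have := hf.div_norm.abs.const_mul (∫ z, |f z|)
      simpa only [abs_div, abs_norm] using this
    · have h0 : ∀ᵐ z : Space × Space, z.1 ≠ 0 :=
        Measure.quasiMeasurePreserving_fst.ae ae_ne_zero
      filter_upwards [h0] with z hz
      calc -(pot (density f) z.1 * f z) ≤ |pot (density f) z.1 * f z| := neg_le_abs _
        _ = |pot (density f) z.1| * |f z| := abs_mul _ _
        _ ≤ (∫ z, |f z|) / ‖z.1‖ * |f z| := by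
          gcongr
          refine (abs_pot_le hf.radialSource.integrable hz).trans ?_
          gcongr
        _ = _ := by ring
  rw [h1]
  calc 1 / (8 * Real.pi) * (-(4 * Real.pi) * ∫ z, pot (density f) z.1 * f z)
      = 1 / 2 * (-∫ z, pot (density f) z.1 * f z) := by field_simp; ring
    _ ≤ 1 / 2 * ((∫ z, |f z|) * ∫ z, |f z| / ‖z.1‖) := by gcongr
    _ = _ := by ring

end FiniteEnergy

lemma fieldDist_nonneg (f g : Space × Space → ℝ) : 0 ≤ fieldDist f g := by
  unfold fieldDist
  have := Real.pi_pos
  have : 0 ≤ ∫ x, ‖gradPot (density f) x - gradPot (density g) x‖ ^ 2 :=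
    integral_nonneg fun _ => sq_nonneg _
  positivity

/-! ### Admissible states -/

lemma measurable_angMomSq : Measurable angMomSq := by
  unfold angMomSq
  fun_prop

lemma continuous_angMomSq : Continuous angMomSq := by
  unfold angMomSq
  fun_prop

lemma angMomSq_le (z : Space × Space) : angMomSq z ≤ ‖z.1‖ ^ 2 * ‖z.2‖ ^ 2 := by
  unfold angMomSq
  have := sq_nonneg (inner ℝ z.1 z.2)
  linarith

/-- The weight `(L - L₀)_+^{-l/k}` with values in `[0, ∞]`. -/
def weight (k l L₀ : ℝ) (z : Space × Space) : ℝ≥0∞ :=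
  ENNReal.ofReal (angMomSq z - L₀) ^ (-(l / k))

lemma measurable_weight (k l L₀ : ℝ) : Measurable (weight k l L₀) := by
  unfold weight
  exact ((measurable_angMomSq.sub_const L₀).ennreal_ofReal).pow_const _

/-- A finite Casimir integral forces the state to vanish where the weight is infinite. -/
lemma ae_eq_zero_of_casimir_lt_top {k l L₀ : ℝ} (hk : 0 < k) (hl : 0 < l)
    {f : Space × Space → ℝ} (hf : AEMeasurable f) (h : casimir k l L₀ f < ∞) :
    ∀ᵐ z, angMomSq z ≤ L₀ → f z = 0 := by
  have hm : AEMeasurable (fun z => ‖f z‖ₑ ^ (1 + 1 / k)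
      * ENNReal.ofReal (angMomSq z - L₀) ^ (-(l / k))) :=
    (hf.enorm.pow_const _).mul (measurable_weight k l L₀).aemeasurable
  filter_upwards [ae_lt_top' hm h.ne] with z hz hL
  by_contra hne
  rw [ENNReal.ofReal_of_nonpos (by linarith), ENNReal.zero_rpow_of_neg
    (by have : 0 < l / k := by positivity
        linarith), ENNReal.mul_top] at hz
  · exact lt_irrefl _ hz
  · have : (0:ℝ) < 1 + 1 / k := by positivity
    rw [ENNReal.rpow_eq_zero_iff_of_pos this |>.ne]
    simpa using hne

lemma casimir_eq_lintegral_ofReal {k l L₀ : ℝ} (hk : 0 < k) {f : Space × Space → ℝ}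
    (h : ∀ᵐ z, angMomSq z ≤ L₀ → f z = 0) :
    casimir k l L₀ f
      = ∫⁻ z, ENNReal.ofReal (|f z| ^ (1 + 1 / k) * max (angMomSq z - L₀) 0 ^ (-(l / k))) := by
  have hp : (0:ℝ) < 1 + 1 / k := by positivity
  refine lintegral_congr_ae ?_
  filter_upwards [h] with z hv
  rcases le_or_gt (angMomSq z) L₀ with hL | hL
  · rw [hv hL, abs_zero, Real.zero_rpow hp.ne', enorm_zero, ENNReal.zero_rpow_of_pos hp]
    simp
  · rw [ENNReal.ofReal_mul (by positivity), max_eq_left (by linarith),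
      ← ENNReal.ofReal_rpow_of_pos (p := -(l / k)) (sub_pos.2 hL),
      ← ENNReal.ofReal_rpow_of_nonneg (abs_nonneg _) hp.le, Real.enorm_eq_ofReal_abs]

/-- The same requirements as in `Admissible`, except that the mass is not prescribed. -/
structure Confined (k l L₀ : ℝ) (f : Space × Space → ℝ) : Prop where
  integrable : Integrable f
  nonneg : ∀ᵐ z, 0 ≤ f z
  symmetric : ∀ A : Space ≃ₗᵢ[ℝ] Space, ∀ᵐ z : Space × Space, f (A z.1, A z.2) = f z
  kin_lt_top : kinEnergy f < ∞
  casimir_lt_top : casimir k l L₀ f < ∞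

lemma Admissible.confined {k l L₀ M : ℝ} {f : Space × Space → ℝ} (h : Admissible k l L₀ M f) :
    Confined k l L₀ f :=
  ⟨h.integrable, h.nonneg, h.symmetric, lt_of_le_of_lt le_self_add h.finite,
    lt_of_le_of_lt le_add_self h.finite⟩

section Confined

variable {k l L₀ M Mc : ℝ} {f g : Space × Space → ℝ}

namespace Confined

lemma vanish (hk : 0 < k) (hl : 0 < l) (h : Confined k l L₀ f) :
    ∀ᵐ z, angMomSq z ≤ L₀ → f z = 0 :=
  ae_eq_zero_of_casimir_lt_top hk hl h.integrable.aemeasurable h.casimir_lt_top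

lemma admissible (hk : 0 < k) (hl : 0 < l) (h : Confined k l L₀ f) :
    Admissible k l L₀ (∫ z, f z) f where
  integrable := h.integrable
  nonneg := h.nonneg
  symmetric := h.symmetric
  mass := rfl
  finite := ENNReal.add_lt_top.2 ⟨h.kin_lt_top, h.casimir_lt_top⟩
  vanish := by
    filter_upwards [h.vanish hk hl] with z hz hL using hz hL.le

lemma integrable_kin (h : Confined k l L₀ f) : Integrable (fun z => ‖z.2‖ ^ 2 * f z) := by
  have hm : AEStronglyMeasurable (fun z : Space × Space => 1 / 2 * ‖z.2‖ ^ 2 * f z) :=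
    AEStronglyMeasurable.mul (by fun_prop) h.integrable.aestronglyMeasurable
  have h0 : 0 ≤ᵐ[volume] fun z : Space × Space => 1 / 2 * ‖z.2‖ ^ 2 * f z := by
    filter_upwards [h.nonneg] with z hz
    simp only [Pi.zero_apply]; positivity
  have : Integrable (fun z : Space × Space => 1 / 2 * ‖z.2‖ ^ 2 * f z) :=
    (lintegral_ofReal_ne_top_iff_integrable hm h0).1 h.kin_lt_top.ne
  refine (this.const_mul 2).congr (ae_of_all _ fun z => ?_)
  simp only
  ring

lemma kin_toReal (h : Confined k l L₀ f) :
    (kinEnergy f).toReal = 1 / 2 * ∫ z, ‖z.2‖ ^ 2 * f z := by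
  have h0 : 0 ≤ᵐ[volume] fun z : Space × Space => 1 / 2 * ‖z.2‖ ^ 2 * f z := by
    filter_upwards [h.nonneg] with z hz
    simp only [Pi.zero_apply]; positivity
  rw [kinEnergy, ← integral_eq_lintegral_of_nonneg_ae h0, ← integral_const_mul]
  · simp only [mul_assoc]
  · exact AEStronglyMeasurable.mul (by fun_prop) h.integrable.aestronglyMeasurable

/-- On the support of a confined state `L₀ ≤ L ≤ |x|²|v|²`, so the kinetic energy controls the
singular moment. -/
lemma div_sq_le (hk : 0 < k) (hl : 0 < l) (hL₀ : 0 < L₀) (h : Confined k l L₀ f) :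
    ∀ᵐ z, f z / ‖z.1‖ ^ 2 ≤ 1 / L₀ * (‖z.2‖ ^ 2 * f z) := by
  filter_upwards [h.vanish hk hl, h.nonneg] with z hz h0
  rcases eq_or_ne (f z) 0 with hf | hf
  · simp [hf]
  have hL : L₀ < angMomSq z := by
    by_contra hcon
    exact hf (hz (not_lt.1 hcon))
  have h1 := angMomSq_le z
  have hx : 0 < ‖z.1‖ ^ 2 := by
    rcases eq_or_ne ‖z.1‖ 0 with hx | hx
    · rw [hx] at h1
      linarith
    · positivity
  rw [div_le_iff₀ hx]
  have : f z * L₀ ≤ f z * (‖z.1‖ ^ 2 * ‖z.2‖ ^ 2) := by gcongr; linarith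
  calc f z = 1 / L₀ * (f z * L₀) := by field_simp
    _ ≤ 1 / L₀ * (f z * (‖z.1‖ ^ 2 * ‖z.2‖ ^ 2)) := by gcongr
    _ = _ := by ring

lemma finiteEnergy (hk : 0 < k) (hl : 0 < l) (hL₀ : 0 < L₀) (h : Confined k l L₀ f) :
    FiniteEnergy f where
  integrable := h.integrable
  kin := h.integrable_kin
  div_sq := by
    refine (h.integrable_kin.const_mul (1 / L₀)).mono'
      (h.integrable.aestronglyMeasurable.div₀ (by fun_prop)) ?_
    filter_upwards [h.div_sq_le hk hl hL₀, h.nonneg] with z hz h0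
    rwa [Real.norm_of_nonneg (by positivity)]

lemma energyCasimir_eq (h : Confined k l L₀ f) :
    energyCasimir k l L₀ Mc f = mechEnergy Mc f + (casimir k l L₀ f).toReal := by
  rw [energyCasimir, mechEnergy, h.kin_toReal]

/-- The Casimir functional as a real integral. -/
lemma casimir_toReal (hk : 0 < k) (hl : 0 < l) (h : Confined k l L₀ f) :
    Integrable (fun z => f z ^ (1 + 1 / k) * max (angMomSq z - L₀) 0 ^ (-(l / k))) ∧
    (casimir k l L₀ f).toReal
      = ∫ z, f z ^ (1 + 1 / k) * max (angMomSq z - L₀) 0 ^ (-(l / k)) := by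
  have hp : (0:ℝ) < 1 + 1 / k := by positivity
  have hq : 0 < l / k := by positivity
  have hm : AEStronglyMeasurable
      (fun z => f z ^ (1 + 1 / k) * max (angMomSq z - L₀) 0 ^ (-(l / k))) := by
    refine AEMeasurable.aestronglyMeasurable ?_
    refine (h.integrable.aemeasurable.pow_const _).mul ?_
    exact (((measurable_angMomSq.sub_const L₀).max measurable_const).pow_const _).aemeasurable
  have h0 : 0 ≤ᵐ[volume] fun z =>
      f z ^ (1 + 1 / k) * max (angMomSq z - L₀) 0 ^ (-(l / k)) := by
    filter_upwards [h.nonneg] with z hz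
    simp only [Pi.zero_apply]; positivity
  have heq : casimir k l L₀ f
      = ∫⁻ z, ENNReal.ofReal (f z ^ (1 + 1 / k) * max (angMomSq z - L₀) 0 ^ (-(l / k))) := by
    rw [casimir_eq_lintegral_ofReal hk (h.vanish hk hl)]
    refine lintegral_congr_ae ?_
    filter_upwards [h.nonneg] with z hz
    rw [abs_of_nonneg hz]
  have hfin := h.casimir_lt_top.ne
  rw [heq] at hfin ⊢
  exact ⟨(lintegral_ofReal_ne_top_iff_integrable hm h0).1 hfin,
    (integral_eq_lintegral_of_nonneg_ae h0 hm).symm⟩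

end Confined

/-- The distance functional is the excess energy plus the field distance. -/
lemma dist₀_eq (hk : 0 < k) (hl : 0 < l) (hL₀ : 0 < L₀) (E₀ : ℝ)
    (hf : Admissible k l L₀ M f) (hg : Admissible k l L₀ M g) :
    dist₀ k l L₀ Mc E₀ f g
      = energyCasimir k l L₀ Mc f - energyCasimir k l L₀ Mc g + fieldDist f g := by
  have ef := hf.confined.finiteEnergy hk hl hL₀
  have eg := hg.confined.finiteEnergy hk hl hL₀
  have cf := hf.confined.casimir_toReal hk hl
  have cg := hg.confined.casimir_toReal hk hl
  have hE := ef.mechEnergy_sub Mc eg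
  have hi := eg.integrable_particleEnergy_mul Mc (ef.sub eg)
  have hm : ∫ z, (f z - g z) = 0 := by
    rw [integral_sub hf.integrable hg.integrable, hf.mass, hg.mass, sub_self]
  rw [hf.confined.energyCasimir_eq, hg.confined.energyCasimir_eq, cf.2, cg.2]
  have : dist₀ k l L₀ Mc E₀ f g
      = (∫ z, f z ^ (1 + 1 / k) * max (angMomSq z - L₀) 0 ^ (-(l / k)))
        - (∫ z, g z ^ (1 + 1 / k) * max (angMomSq z - L₀) 0 ^ (-(l / k)))
        + ((∫ z, particleEnergy Mc g z * (f z - g z)) - E₀ * ∫ z, (f z - g z)) := by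
    rw [dist₀, ← integral_const_mul, ← integral_sub cf.1 cg.1, ← integral_sub hi
      ((ef.sub eg).integrable.const_mul E₀), ← integral_add (integrable_fun_sub cf.1 cg.1)
      (integrable_fun_sub hi ((ef.sub eg).integrable.const_mul E₀))]
    refine integral_congr_ae (ae_of_all _ fun z => ?_)
    simp only
    ring
  rw [this, hm]
  linarith

/-- Coercivity: the potential energy is controlled by half of the kinetic energy, up to a constant
depending only on the mass. -/
lemma exists_kin_le (hk : 0 < k) (hl : 0 < l) (hL₀ : 0 < L₀) (hMc : 0 ≤ Mc) (hM : 0 ≤ M) :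
    ∃ C : ℝ, ∀ f, Confined k l L₀ f → ∫ z, f z ≤ M →
      (kinEnergy f).toReal + 2 * (casimir k l L₀ f).toReal ≤ 2 * energyCasimir k l L₀ Mc f + C := by
  let K := M / 2 + Mc
  have hK : 0 ≤ K := by positivity
  -- `1 / |x| ≤ e / |x|² + 1 / (4 e)` with `e` so small that the first term is absorbed
  let e := L₀ / (4 * (K + 1))
  have he : 0 < e := by positivity
  refine ⟨2 * (K * (M / (4 * e))), fun f hf hM' => ?_⟩
  have ef := hf.finiteEnergy hk hl hL₀
  have habs : ∀ᵐ z, |f z| = f z := by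
    filter_upwards [hf.nonneg] with z hz using abs_of_nonneg hz
  have h1 := ef.field_le
  have i1 : ∫ z, |f z| = ∫ z, f z := integral_congr_ae habs
  have i2 : ∫ z, |f z| / ‖z.1‖ = ∫ z, f z / ‖z.1‖ := by
    refine integral_congr_ae ?_
    filter_upwards [habs] with z hz
    rw [hz]
  have hJ0 : 0 ≤ ∫ z, f z / ‖z.1‖ := by
    refine integral_nonneg_of_ae ?_
    filter_upwards [hf.nonneg] with z hz
    simp only [Pi.zero_apply]; positivity
  have hJ : ∫ z, f z / ‖z.1‖ ≤ e / L₀ * (∫ z, ‖z.2‖ ^ 2 * f z) + M / (4 * e) := by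
    calc ∫ z, f z / ‖z.1‖
        ≤ ∫ z, (e / L₀ * (‖z.2‖ ^ 2 * f z) + 1 / (4 * e) * f z) := by
          refine integral_mono_ae ef.div_norm
            ((ef.kin.const_mul _).add (ef.integrable.const_mul _)) ?_
          filter_upwards [hf.div_sq_le hk hl hL₀, hf.nonneg] with z hz h0
          have : f z / ‖z.1‖ ≤ e * (f z / ‖z.1‖ ^ 2) + 1 / (4 * e) * f z := by
            rcases eq_or_ne ‖z.1‖ 0 with hx | hx
            · simp [hx]; positivity
            have h3 : e * (f z / ‖z.1‖ ^ 2) + 1 / (4 * e) * f z - f z / ‖z.1‖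
                = f z * e * (1 / ‖z.1‖ - 1 / (2 * e)) ^ 2 := by field_simp; ring
            have h4 : 0 ≤ f z * e * (1 / ‖z.1‖ - 1 / (2 * e)) ^ 2 := by positivity
            linarith
          calc f z / ‖z.1‖ ≤ e * (f z / ‖z.1‖ ^ 2) + 1 / (4 * e) * f z := this
            _ ≤ e * (1 / L₀ * (‖z.2‖ ^ 2 * f z)) + 1 / (4 * e) * f z := by gcongr
            _ = _ := by ring
      _ = e / L₀ * (∫ z, ‖z.2‖ ^ 2 * f z) + 1 / (4 * e) * ∫ z, f z := by
          rw [integral_add (ef.kin.const_mul _) (ef.integrable.const_mul _), integral_const_mul,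
            integral_const_mul]
      _ ≤ e / L₀ * (∫ z, ‖z.2‖ ^ 2 * f z) + 1 / (4 * e) * M := by gcongr
      _ = _ := by ring
  have hP : -(K * ∫ z, f z / ‖z.1‖) ≤ potEnergy Mc f := by
    rw [ef.potEnergy_eq]
    rw [i1, i2] at h1
    have : 1 / 2 * (∫ z, f z) * (∫ z, f z / ‖z.1‖) ≤ 1 / 2 * M * ∫ z, f z / ‖z.1‖ := by gcongr
    simp only [K]
    linarith
  have hKJ : K * (∫ z, f z / ‖z.1‖) ≤ 1 / 2 * (kinEnergy f).toReal + K * (M / (4 * e)) := by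
    have hT : 0 ≤ (kinEnergy f).toReal := ENNReal.toReal_nonneg
    calc K * (∫ z, f z / ‖z.1‖)
        ≤ K * (e / L₀ * (2 * (kinEnergy f).toReal) + M / (4 * e)) := by
          gcongr
          rw [hf.kin_toReal]
          linarith
      _ = (K / (K + 1)) * (1 / 2 * (kinEnergy f).toReal) + K * (M / (4 * e)) := by
          have : K + 1 ≠ 0 := by positivity
          simp only [e]
          field_simp
          ring
      _ ≤ 1 * (1 / 2 * (kinEnergy f).toReal) + K * (M / (4 * e)) := by
          gcongr
          rw [div_le_one (by positivity)]
          linarith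
      _ = _ := by ring
  rw [energyCasimir]
  linarith

end Confined

/-! ### Convexity, selection of monotone functions, and the weighted Lebesgue space -/

/-- A quantitative form of the strict convexity of `t ↦ t ^ p`, obtained from compactness of `[0, 1]`
and homogeneity. -/
lemma exists_convexity_bound {p η : ℝ} (hp : 1 < p) (hη : 0 < η) :
    ∃ K : ℝ, 0 ≤ K ∧ ∀ a b : ℝ, 0 ≤ a → 0 ≤ b →
      |a - b| ^ p ≤ η * (a ^ p + b ^ p) + K * ((a ^ p + b ^ p) / 2 - ((a + b) / 2) ^ p) := by
  have hp0 : 0 < p := by linarith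
  have cp : Continuous fun t : ℝ => t ^ p := Real.continuous_rpow_const hp0.le
  have hconv : ∀ a b : ℝ, 0 ≤ a → 0 ≤ b → ((a + b) / 2) ^ p ≤ (a ^ p + b ^ p) / 2 := by
    intro a b ha hb
    have := (convexOn_rpow hp.le).2 (mem_Ici.2 ha) (mem_Ici.2 hb)
      (by norm_num : (0:ℝ) ≤ 1 / 2) (by norm_num : (0:ℝ) ≤ 1 / 2) (by norm_num)
    simp only [smul_eq_mul] at this
    calc ((a + b) / 2) ^ p = (1 / 2 * a + 1 / 2 * b) ^ p := by ring_nf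
      _ ≤ _ := this
      _ = _ := by ring
  -- By homogeneity `a + b = 1`. On the compact set `S` where the bound fails with `K = 0`, the
  -- convexity defect `G` is positive, as `S` avoids `t = 1 / 2`.
  let G : ℝ → ℝ := fun t => (t ^ p + (1 - t) ^ p) / 2 - (1 / 2) ^ p
  let S : Set ℝ := Icc 0 1 ∩ {t | η * (t ^ p + (1 - t) ^ p) ≤ |2 * t - 1| ^ p}
  have hS : IsCompact S := by
    refine isCompact_Icc.inter_right (isClosed_le ?_ ?_)
    · exact continuous_const.mul (cp.add (cp.comp (by fun_prop)))
    · exact cp.comp (by fun_prop)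
  have hG : Continuous G := ((cp.add (cp.comp (by fun_prop))).div_const _).sub continuous_const
  have hGpos : ∀ t ∈ S, 0 < G t := by
    rintro t ⟨⟨h0, h1⟩, ht⟩
    have hne : t ≠ 1 - t := by
      intro heq
      have h2 : t = 1 / 2 := by linarith
      rw [mem_ofPred_eq, h2] at ht
      norm_num at ht
      rw [Real.zero_rpow hp0.ne'] at ht
      have : 0 < η * ((1 / 2 : ℝ) ^ p + (1 / 2) ^ p) := by positivity
      linarith
    have := (strictConvexOn_rpow hp).2 (mem_Ici.2 h0) (mem_Ici.2 (sub_nonneg.2 h1)) hne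
      (by norm_num : (0:ℝ) < 1 / 2) (by norm_num : (0:ℝ) < 1 / 2) (by norm_num)
    simp only [smul_eq_mul] at this
    have e : (1 / 2 * t + 1 / 2 * (1 - t) : ℝ) = 1 / 2 := by ring
    rw [e] at this
    simp only [G]
    linarith
  obtain ⟨K, hK0, hK⟩ : ∃ K : ℝ, 0 ≤ K ∧ ∀ t ∈ Icc (0:ℝ) 1,
      |2 * t - 1| ^ p ≤ η * (t ^ p + (1 - t) ^ p) + K * G t := by
    have hG0 : ∀ t ∈ Icc (0:ℝ) 1, 0 ≤ G t := by
      rintro t ⟨h0, h1⟩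
      have := hconv t (1 - t) h0 (by linarith)
      simp only [G]
      have e : (t + (1 - t)) / 2 = 1 / 2 := by ring
      rw [e] at this
      linarith
    rcases S.eq_empty_or_nonempty with hE | hne
    · refine ⟨0, le_rfl, fun t ht => ?_⟩
      by_contra hcon
      have : t ∈ S := ⟨ht, by simp only [mem_ofPred_eq]; linarith⟩
      rw [hE] at this
      exact this
    · obtain ⟨t₀, ht₀, hmin⟩ := hS.exists_isMinOn hne hG.continuousOn
      have hc := hGpos t₀ ht₀
      refine ⟨(G t₀)⁻¹, by positivity, fun t ht => ?_⟩
      by_cases hts : t ∈ S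
      · have h1 : G t₀ ≤ G t := hmin hts
        have h2 : |2 * t - 1| ^ p ≤ 1 := by
          refine Real.rpow_le_one (abs_nonneg _) ?_ hp0.le
          rw [abs_le]; constructor <;> linarith [ht.1, ht.2]
        have h3 : 1 ≤ (G t₀)⁻¹ * G t := by
          rw [← div_eq_inv_mul, le_div_iff₀ hc]; linarith
        have h4 : 0 ≤ t ^ p := Real.rpow_nonneg ht.1 _
        have h5 : 0 ≤ (1 - t) ^ p := Real.rpow_nonneg (by linarith [ht.2]) _
        have : 0 ≤ η * (t ^ p + (1 - t) ^ p) := by positivity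
        linarith
      · have h1 : |2 * t - 1| ^ p < η * (t ^ p + (1 - t) ^ p) := by
          by_contra hcon
          exact hts ⟨ht, not_lt.1 hcon⟩
        have : 0 ≤ (G t₀)⁻¹ * G t := mul_nonneg (by positivity) (hG0 t ht)
        linarith
  refine ⟨K, hK0, fun a b ha hb => ?_⟩
  rcases (add_nonneg ha hb).eq_or_lt with hs | hs
  · have ha0 : a = 0 := by linarith
    have hb0 : b = 0 := by linarith
    simp [ha0, hb0, Real.zero_rpow hp0.ne']
  · set s := a + b with hsdef
    have hsp : 0 < s ^ p := Real.rpow_pos_of_pos hs p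
    have h := hK (a / s) ⟨by positivity, by rw [div_le_one hs]; linarith⟩
    have e1 : 1 - a / s = b / s := by rw [eq_div_iff hs.ne']; field_simp; linarith
    have e2 : 2 * (a / s) - 1 = (a - b) / s := by
      rw [eq_div_iff hs.ne']; field_simp; linarith
    simp only [G, e1, e2, abs_div, abs_of_pos hs] at h
    rw [Real.div_rpow (abs_nonneg _) hs.le, Real.div_rpow ha hs.le, Real.div_rpow hb hs.le] at h
    rw [Real.div_rpow hs.le (by norm_num : (0:ℝ) ≤ 2)]
    rw [Real.div_rpow (by norm_num : (0:ℝ) ≤ 1) (by norm_num : (0:ℝ) ≤ 2), Real.one_rpow] at h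
    have := mul_le_mul_of_nonneg_right h hsp.le
    calc |a - b| ^ p = |a - b| ^ p / s ^ p * s ^ p := by field_simp
      _ ≤ _ := this
      _ = _ := by field_simp

/-- Helly's selection theorem, with exceptional set countable. -/
lemma exists_subseq_tendsto_of_monotone {m : ℕ → ℝ → ℝ} {M : ℝ} (hmono : ∀ n, Monotone (m n))
    (hbd : ∀ n r, |m n r| ≤ M) :
    ∃ φ : ℕ → ℕ, StrictMono φ ∧ ∃ (g : ℝ → ℝ) (N : Set ℝ), N.Countable ∧
      ∀ r ∉ N, Tendsto (fun n => m (φ n) r) atTop (𝓝 (g r)) := by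
  -- a limit exists along a subsequence at all rationals; it determines the limit at every point of
  -- continuity of the monotone function `G`
  have hcpt : IsCompact (Set.pi univ fun _ : ℚ => Icc (-M) M) :=
    isCompact_univ_pi fun _ => isCompact_Icc
  obtain ⟨a, -, φ, hφ, ha⟩ := hcpt.tendsto_subseq (x := fun n (q : ℚ) => m n q)
    (fun n q _ => abs_le.1 (hbd n q))
  have ha' : ∀ q : ℚ, Tendsto (fun n => m (φ n) q) atTop (𝓝 (a q)) := fun q =>
    (tendsto_pi_nhds.1 ha) q
  have habd : ∀ q, a q ≤ M := fun q =>
    le_of_tendsto' (ha' q) fun n => (abs_le.1 (hbd _ _)).2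
  let G : ℝ → ℝ := fun r => sSup (a '' {q : ℚ | (q : ℝ) < r})
  have hbdd : ∀ r, BddAbove (a '' {q : ℚ | (q : ℝ) < r}) := fun r =>
    ⟨M, by rintro _ ⟨q, -, rfl⟩; exact habd q⟩
  have hne : ∀ r : ℝ, (a '' {q : ℚ | (q : ℝ) < r}).Nonempty := fun r => by
    obtain ⟨q, hq⟩ := exists_rat_lt r
    exact ⟨a q, q, hq, rfl⟩
  have hG : Monotone G := fun r s hrs =>
    csSup_le_csSup (hbdd s) (hne r) (image_mono fun q hq => lt_of_lt_of_le hq hrs)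
  refine ⟨φ, hφ, G, _, hG.countable_not_continuousAt, fun r hr => ?_⟩
  have hc : ContinuousAt G r := by simpa using hr
  rw [tendsto_order]
  constructor
  · intro c hcG
    obtain ⟨_, ⟨q, hq, rfl⟩, hcq⟩ := exists_lt_of_lt_csSup (hne r) hcG
    filter_upwards [(ha' q).eventually (lt_mem_nhds hcq)] with n hn
    exact hn.trans_le (hmono _ (le_of_lt hq))
  · intro c hcG
    have h1 : ∀ᶠ s in 𝓝[>] r, G s < c :=
      (hc.tendsto.eventually (gt_mem_nhds hcG)).filter_mono nhdsWithin_le_nhds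
    obtain ⟨s, hs, hrs⟩ := (h1.and self_mem_nhdsWithin).exists
    obtain ⟨q, hrq, hqs⟩ := exists_rat_btwn hrs
    have h2 : a q ≤ G s := le_csSup (hbdd s) ⟨q, hqs, rfl⟩
    filter_upwards [(ha' q).eventually (gt_mem_nhds (h2.trans_lt hs))] with n hn
    exact (hmono _ hrq.le).trans_lt hn

lemma ae_norm_notMem_of_countable {N : Set ℝ} (hN : N.Countable) : ∀ᵐ x : Space, ‖x‖ ∉ N := by
  have : ∀ᵐ x : Space, ∀ r ∈ N, ‖x‖ ≠ r := by
    rw [ae_ball_iff hN]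
    intro r _
    have := Measure.addHaar_sphere (volume : Measure Space) 0 r
    rw [ae_iff]
    convert this using 2
    ext x
    simp
  filter_upwards [this] with x hx hxN using hx _ hxN rfl

/-- The measure `(L - L₀)_+^{-l/k} dx dv`; it is infinite on subsets of positive measure of
`{L ≤ L₀}`. -/
def weightedMeasure (k l L₀ : ℝ) : Measure (Space × Space) :=
  volume.withDensity (weight k l L₀)

lemma weight_ne_zero {k l L₀ : ℝ} (hk : 0 < k) (hl : 0 < l) (z : Space × Space) :
    weight k l L₀ z ≠ 0 := by
  unfold weight
  have : 0 < l / k := by positivity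
  simp [ENNReal.rpow_eq_zero_iff, this, not_lt.2 this.le]

lemma ae_weightedMeasure_iff {k l L₀ : ℝ} (hk : 0 < k) (hl : 0 < l) {P : Space × Space → Prop} :
    (∀ᵐ z ∂weightedMeasure k l L₀, P z) ↔ ∀ᵐ z, P z := by
  rw [weightedMeasure, ae_withDensity_iff (measurable_weight k l L₀)]
  simp [weight_ne_zero hk hl]

lemma weightedMeasure_ac {k l L₀ : ℝ} : weightedMeasure k l L₀ ≪ volume :=
  withDensity_absolutelyContinuous _ _

lemma volume_ac_weightedMeasure {k l L₀ : ℝ} (hk : 0 < k) (hl : 0 < l) :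
    (volume : Measure (Space × Space)) ≪ weightedMeasure k l L₀ := by
  refine Measure.AbsolutelyContinuous.mk fun s _ hs => ?_
  have h : ∀ᵐ z ∂weightedMeasure k l L₀, z ∉ s := measure_eq_zero_iff_ae_notMem.1 hs
  rw [ae_weightedMeasure_iff hk hl] at h
  exact measure_eq_zero_iff_ae_notMem.2 h

/-- The exponent `1 + 1/k`, as an extended nonnegative number. -/
def kExp (k : ℝ) : ℝ≥0∞ := ENNReal.ofReal (1 + 1 / k)

lemma kExp_toReal {k : ℝ} (hk : 0 < k) : (kExp k).toReal = 1 + 1 / k :=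
  ENNReal.toReal_ofReal (by positivity)

lemma kExp_ne_zero {k : ℝ} (hk : 0 < k) : kExp k ≠ 0 := by
  have : (0:ℝ) < 1 + 1 / k := by positivity
  simp only [kExp, ne_eq, ENNReal.ofReal_eq_zero, not_le]
  exact this

lemma one_le_kExp {k : ℝ} (hk : 0 < k) : 1 ≤ kExp k := by
  rw [kExp, ENNReal.one_le_ofReal]
  have : 0 < 1 / k := by positivity
  linarith

lemma casimir_eq_lintegral_weightedMeasure {k l L₀ : ℝ} {f : Space × Space → ℝ}
    (hf : AEMeasurable f) :
    casimir k l L₀ f = ∫⁻ z, ‖f z‖ₑ ^ (1 + 1 / k) ∂weightedMeasure k l L₀ := by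
  rw [weightedMeasure, lintegral_withDensity_eq_lintegral_mul₀
    (measurable_weight k l L₀).aemeasurable (hf.enorm.pow_const _)]
  simp only [casimir, weight, Pi.mul_apply, mul_comm]

lemma klNorm_eq_eLpNorm {k l L₀ : ℝ} (hk : 0 < k) {f : Space × Space → ℝ} (hf : AEMeasurable f) :
    klNorm k l L₀ f = eLpNorm f (kExp k) (weightedMeasure k l L₀) := by
  rw [eLpNorm_eq_lintegral_rpow_enorm_toReal (kExp_ne_zero hk) ENNReal.ofReal_ne_top,
    kExp_toReal hk, klNorm, casimir_eq_lintegral_weightedMeasure hf]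
  congr 1
  field_simp

lemma klNorm_congr {k l L₀ : ℝ} {f g : Space × Space → ℝ} (h : f =ᵐ[volume] g) :
    klNorm k l L₀ f = klNorm k l L₀ g := by
  unfold klNorm casimir
  congr 1
  refine lintegral_congr_ae ?_
  filter_upwards [h] with z hz
  rw [hz]

lemma casimir_eq_klNorm_rpow {k l L₀ : ℝ} (hk : 0 < k) (f : Space × Space → ℝ) :
    casimir k l L₀ f = klNorm k l L₀ f ^ (1 + 1 / k) := by
  rw [klNorm, ← ENNReal.rpow_mul]
  have : k / (k + 1) * (1 + 1 / k) = 1 := by field_simp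
  rw [this, ENNReal.rpow_one]

lemma klNorm_add_le {k l L₀ : ℝ} (hk : 0 < k) {f g : Space × Space → ℝ} (hf : AEMeasurable f)
    (hg : AEMeasurable g) :
    klNorm k l L₀ (fun z => f z + g z) ≤ klNorm k l L₀ f + klNorm k l L₀ g := by
  rw [klNorm_eq_eLpNorm hk hf, klNorm_eq_eLpNorm hk hg, klNorm_eq_eLpNorm hk (hf.fun_add hg)]
  exact eLpNorm_add_le (hf.aestronglyMeasurable.mono_ac weightedMeasure_ac)
    (hg.aestronglyMeasurable.mono_ac weightedMeasure_ac) (one_le_kExp hk)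

/-! ### Adding mass far away lowers the energy -/

section

variable {k l L₀ M Mc : ℝ} {f g : Space × Space → ℝ}

lemma klNorm_lt_top_iff (hk : 0 < k) : klNorm k l L₀ f < ∞ ↔ casimir k l L₀ f < ∞ := by
  have h1 : 0 < k / (k + 1) := by positivity
  rw [klNorm, ENNReal.rpow_lt_top_iff_of_pos h1]

lemma measurePreserving_symm (A : Space ≃ₗᵢ[ℝ] Space) :
    MeasurePreserving (fun z : Space × Space => (A z.1, A z.2)) volume volume :=
  (A.measurePreserving).prod (A.measurePreserving)

lemma angMomSq_map (A : Space ≃ₗᵢ[ℝ] Space) (z : Space × Space) :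
    angMomSq (A z.1, A z.2) = angMomSq z := by
  simp [angMomSq]

namespace Confined

lemma add (hk : 0 < k) (hf : Confined k l L₀ f) (hg : Confined k l L₀ g) :
    Confined k l L₀ (fun z => f z + g z) where
  integrable := hf.integrable.add hg.integrable
  nonneg := by
    filter_upwards [hf.nonneg, hg.nonneg] with z h1 h2 using add_nonneg h1 h2
  symmetric A := by
    filter_upwards [hf.symmetric A, hg.symmetric A] with z h1 h2
    rw [h1, h2]
  kin_lt_top := by
    have h0 : kinEnergy (fun z => f z + g z) ≤ kinEnergy f + kinEnergy g := by
      have hm : AEMeasurable (fun z : Space × Space => ENNReal.ofReal (1 / 2 * ‖z.2‖ ^ 2 * f z)) :=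
        (AEMeasurable.mul (by fun_prop) hf.integrable.aemeasurable).ennreal_ofReal
      rw [kinEnergy, kinEnergy, kinEnergy, ← lintegral_add_left' hm]
      refine lintegral_mono fun z => ?_
      simp only
      rw [mul_add]
      exact ENNReal.ofReal_add_le
    exact h0.trans_lt (ENNReal.add_lt_top.2 ⟨hf.kin_lt_top, hg.kin_lt_top⟩)
  casimir_lt_top := by
    rw [← klNorm_lt_top_iff hk]
    exact (klNorm_add_le hk hf.integrable.aemeasurable hg.integrable.aemeasurable).trans_lt
      (ENNReal.add_lt_top.2 ⟨(klNorm_lt_top_iff hk).2 hf.casimir_lt_top,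
        (klNorm_lt_top_iff hk).2 hg.casimir_lt_top⟩)

lemma const_mul (hk : 0 < k) {c : ℝ} (hc : 0 ≤ c) (hf : Confined k l L₀ f) :
    Confined k l L₀ (fun z => c * f z) where
  integrable := hf.integrable.const_mul c
  nonneg := by
    filter_upwards [hf.nonneg] with z h1 using mul_nonneg hc h1
  symmetric A := by
    filter_upwards [hf.symmetric A] with z h1
    rw [h1]
  kin_lt_top := by
    have : kinEnergy (fun z => c * f z) = ENNReal.ofReal c * kinEnergy f := by
      rw [kinEnergy, kinEnergy, ← lintegral_const_mul' _ _ ENNReal.ofReal_ne_top]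
      refine lintegral_congr fun z => ?_
      rw [← ENNReal.ofReal_mul hc]
      ring_nf
    rw [this]
    exact ENNReal.mul_lt_top ENNReal.ofReal_lt_top hf.kin_lt_top
  casimir_lt_top := by
    have hp : (0:ℝ) ≤ 1 + 1 / k := by positivity
    have : casimir k l L₀ (fun z => c * f z) = ‖c‖ₑ ^ (1 + 1 / k) * casimir k l L₀ f := by
      rw [casimir, casimir, ← lintegral_const_mul' _ _
        (ENNReal.rpow_ne_top_of_nonneg hp enorm_ne_top)]
      refine lintegral_congr fun z => ?_
      rw [enorm_mul, ENNReal.mul_rpow_of_nonneg _ _ hp, mul_assoc]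
    rw [this]
    exact ENNReal.mul_lt_top (ENNReal.rpow_lt_top_of_nonneg hp enorm_ne_top) hf.casimir_lt_top

lemma casimir_toReal_eq_rpow (hk : 0 < k) (f : Space × Space → ℝ) :
    (casimir k l L₀ f).toReal = (klNorm k l L₀ f).toReal ^ (1 + 1 / k) := by
  rw [casimir_eq_klNorm_rpow hk, ENNReal.toReal_rpow]

end Confined

/-- The part of phase space at distances between `1` and `2` on which a point mass `Mc` exerts a
dominating attraction and the angular momentum is bounded below. -/
def farShell (Mc : ℝ) : Set (Space × Space) :=
  {z | 1 ≤ ‖z.1‖ ∧ ‖z.1‖ ≤ 2 ∧ ‖z.2‖ ^ 2 ≤ Mc / 2 ∧ Mc / 4 ≤ angMomSq z}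

lemma measurableSet_farShell (Mc : ℝ) : MeasurableSet (farShell Mc) := by
  have : farShell Mc = {z : Space × Space | 1 ≤ ‖z.1‖} ∩ ({z | ‖z.1‖ ≤ 2} ∩
      ({z | ‖z.2‖ ^ 2 ≤ Mc / 2} ∩ {z | Mc / 4 ≤ angMomSq z})) := by
    ext z
    simp [farShell]
  rw [this]
  exact (measurableSet_le (by fun_prop) (by fun_prop)).inter
    ((measurableSet_le (by fun_prop) (by fun_prop)).inter
      ((measurableSet_le (by fun_prop) (by fun_prop)).inter
        (measurableSet_le (by fun_prop) measurable_angMomSq)))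

lemma volume_farShell_pos (hMc : 0 < Mc) : 0 < volume (farShell Mc) := by
  let O : Set (Space × Space) :=
    {z | 1 < ‖z.1‖} ∩ {z | ‖z.1‖ < 2} ∩ {z | ‖z.2‖ ^ 2 < Mc / 2} ∩ {z | Mc / 4 < angMomSq z}
  have hO : IsOpen O :=
    (((isOpen_lt (by fun_prop) (by fun_prop)).inter (isOpen_lt (by fun_prop) (by fun_prop))).inter
      (isOpen_lt (by fun_prop) (by fun_prop))).inter
      (isOpen_lt (by fun_prop) continuous_angMomSq)
  have hne : O.Nonempty := by
    refine ⟨((3 / 2 : ℝ) • EuclideanSpace.single 0 1,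
      (Real.sqrt Mc / 2) • EuclideanSpace.single 1 1), ?_⟩
    have h1 : ‖((3 / 2 : ℝ) • EuclideanSpace.single 0 1 : Space)‖ = 3 / 2 := by
      rw [norm_smul]; simp
    have h2 : ‖((Real.sqrt Mc / 2) • EuclideanSpace.single 1 1 : Space)‖ ^ 2 = Mc / 4 := by
      rw [norm_smul, mul_pow]
      simp only [Real.norm_eq_abs, sq_abs, div_pow, Real.sq_sqrt hMc.le]
      simp
      norm_num
    have h3 : inner ℝ ((3 / 2 : ℝ) • EuclideanSpace.single 0 1 : Space)
        ((Real.sqrt Mc / 2) • EuclideanSpace.single 1 1) = 0 := by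
      simp only [real_inner_smul_left, real_inner_smul_right]
      simp [EuclideanSpace.inner_single_left]
    refine ⟨⟨⟨?_, ?_⟩, ?_⟩, ?_⟩
    · simp only [mem_ofPred_eq, h1]; norm_num
    · simp only [mem_ofPred_eq, h1]; norm_num
    · simp only [mem_ofPred_eq, h2]; linarith
    · simp only [mem_ofPred_eq, angMomSq, h1, h2, h3]; norm_num; linarith
  refine lt_of_lt_of_le (hO.measure_pos volume hne) (measure_mono ?_)
  rintro z ⟨⟨⟨h1, h2⟩, h3⟩, h4⟩
  exact ⟨le_of_lt h1, le_of_lt h2, le_of_lt h3, le_of_lt h4⟩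

lemma volume_farShell_lt_top (Mc : ℝ) : volume (farShell Mc) < ∞ := by
  have hsub : farShell Mc ⊆ Metric.closedBall (0 : Space) 2 ×ˢ
      Metric.closedBall (0 : Space) (Real.sqrt (Mc / 2)) := by
    rintro z ⟨-, h2, h3, -⟩
    exact ⟨by simpa using h2, by simpa using Real.le_sqrt_of_sq_le h3⟩
  refine (measure_mono hsub).trans_lt ?_
  rw [Measure.volume_eq_prod, Measure.prod_prod]
  exact ENNReal.mul_lt_top measure_closedBall_lt_top measure_closedBall_lt_top

/-- The shell rescaled to radius `s²`, with velocities of the order `1 / s` of circular orbits. -/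
def scaledShell (Mc s : ℝ) : Set (Space × Space) :=
  (fun z : Space × Space => ((s ^ 2)⁻¹ • z.1, s • z.2)) ⁻¹' farShell Mc

lemma measurableSet_scaledShell (Mc s : ℝ) : MeasurableSet (scaledShell Mc s) :=
  (measurableSet_farShell Mc).preimage (by fun_prop)

lemma volume_scaledShell {s : ℝ} (hs : 0 < s) :
    volume (scaledShell Mc s) = ENNReal.ofReal (s ^ 3) * volume (farShell Mc) := by
  have h2 : (s ^ 2)⁻¹ ≠ 0 := by positivity
  have h := Measure.map_prod_map (volume : Measure Space) (volume : Measure Space)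
    (f := fun x : Space => (s ^ 2)⁻¹ • x) (g := fun v : Space => s • v) (by fun_prop) (by fun_prop)
  rw [Measure.map_addHaar_smul volume h2, Measure.map_addHaar_smul volume hs.ne'] at h
  have h3 : volume (scaledShell Mc s) = (Measure.map (Prod.map (fun x : Space => (s ^ 2)⁻¹ • x)
      (fun v : Space => s • v)) ((volume : Measure Space).prod volume)) (farShell Mc) := by
    rw [Measure.map_apply (by fun_prop) (measurableSet_farShell Mc)]
    rfl
  rw [h3, ← h, Measure.prod_smul_left, Measure.prod_smul_right]
  simp only [Measure.smul_apply, smul_eq_mul, ← mul_assoc, finrank_euclideanSpace_fin]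
  congr 1
  rw [← ENNReal.ofReal_mul (abs_nonneg _)]
  congr 1
  rw [abs_of_pos (by positivity), abs_of_pos (by positivity)]
  field_simp

lemma mem_scaledShell {s : ℝ} (hs : 0 < s) {z : Space × Space} (hz : z ∈ scaledShell Mc s) :
    s ^ 2 ≤ ‖z.1‖ ∧ ‖z.1‖ ≤ 2 * s ^ 2 ∧ ‖z.2‖ ^ 2 ≤ Mc / (2 * s ^ 2) ∧
      Mc / 4 * s ^ 2 ≤ angMomSq z := by
  obtain ⟨h1, h2, h3, h4⟩ := hz
  have hs2 : 0 < s ^ 2 := by positivity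
  simp only [norm_smul, norm_inv, norm_pow, Real.norm_of_nonneg hs.le] at h1 h2 h3
  simp only [angMomSq, norm_smul, norm_inv, norm_pow, Real.norm_of_nonneg hs.le,
    real_inner_smul_left, real_inner_smul_right] at h4
  rw [← div_eq_inv_mul, le_div_iff₀ hs2] at h1
  rw [← div_eq_inv_mul, div_le_iff₀ hs2] at h2
  refine ⟨by linarith, h2, ?_, ?_⟩
  · rw [le_div_iff₀ (by positivity)]
    nlinarith
  · have e : ((s ^ 2)⁻¹ * ‖z.1‖) ^ 2 * (s * ‖z.2‖) ^ 2 - (s * ((s ^ 2)⁻¹ * inner ℝ z.1 z.2)) ^ 2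
        = angMomSq z / s ^ 2 := by
      unfold angMomSq
      field_simp
    have h5 : Mc / 4 ≤ angMomSq z / s ^ 2 := by
      rw [← e]
      convert h4 using 3
    rwa [le_div_iff₀ hs2] at h5

/-- A uniform distribution of mass `m` on the rescaled shell. -/
def blob (Mc m s : ℝ) : Space × Space → ℝ :=
  (scaledShell Mc s).indicator fun _ => m / (volume (scaledShell Mc s)).toReal

lemma scaledShell_pos_lt_top (hMc : 0 < Mc) {s : ℝ} (hs : 0 < s) :
    volume (scaledShell Mc s) ≠ 0 ∧ volume (scaledShell Mc s) ≠ ∞ := by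
  rw [volume_scaledShell hs]
  refine ⟨mul_ne_zero ?_ (volume_farShell_pos hMc).ne', ENNReal.mul_ne_top ENNReal.ofReal_ne_top
    (volume_farShell_lt_top Mc).ne⟩
  simp only [ne_eq, ENNReal.ofReal_eq_zero, not_le]
  positivity

lemma integrable_blob (hMc : 0 < Mc) (m : ℝ) {s : ℝ} (hs : 0 < s) : Integrable (blob Mc m s) :=
  (integrable_indicator_iff (measurableSet_scaledShell Mc s)).2
    (integrableOn_const (scaledShell_pos_lt_top hMc hs).2)

lemma integral_blob (hMc : 0 < Mc) (m : ℝ) {s : ℝ} (hs : 0 < s) : ∫ z, blob Mc m s z = m := by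
  have h := scaledShell_pos_lt_top hMc hs
  rw [blob, integral_indicator (measurableSet_scaledShell Mc s), setIntegral_const, Measure.real,
    smul_eq_mul, mul_div_cancel₀ _ (ENNReal.toReal_ne_zero.2 h)]

lemma blob_nonneg {m : ℝ} (hm : 0 ≤ m) (s : ℝ) (z : Space × Space) : 0 ≤ blob Mc m s z :=
  indicator_nonneg (fun _ _ => by positivity) z

lemma casimir_blob_le (hk : 0 < k) (hl : 0 < l) (hMc : 0 < Mc) {m s : ℝ} (hm : 0 ≤ m) (hs : 0 < s)
    (hsL : L₀ ≤ Mc / 8 * s ^ 2) :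
    casimir k l L₀ (blob Mc m s) ≤ ENNReal.ofReal
      ((m / (volume (scaledShell Mc s)).toReal) ^ (1 + 1 / k) * (Mc / 8 * s ^ 2) ^ (-(l / k))
        * (volume (scaledShell Mc s)).toReal) := by
  have hp : (0:ℝ) < 1 + 1 / k := by positivity
  have hB := scaledShell_pos_lt_top hMc hs
  have hpos : 0 < Mc / 8 * s ^ 2 := by positivity
  set A := m / (volume (scaledShell Mc s)).toReal with hA
  have hA0 : 0 ≤ A := by positivity
  calc casimir k l L₀ (blob Mc m s)
      ≤ ∫⁻ z, (scaledShell Mc s).indicator (fun _ => ENNReal.ofReal (A ^ (1 + 1 / k)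
          * (Mc / 8 * s ^ 2) ^ (-(l / k)))) z := by
        refine lintegral_mono fun z => ?_
        by_cases hz : z ∈ scaledShell Mc s
        · simp only [blob, indicator_of_mem hz]
          rw [← hA, Real.enorm_of_nonneg hA0, ENNReal.ofReal_mul (by positivity),
            ENNReal.ofReal_rpow_of_nonneg hA0 hp.le]
          gcongr
          have hLz : Mc / 8 * s ^ 2 ≤ angMomSq z - L₀ := by
            have := (mem_scaledShell hs hz).2.2.2
            linarith
          rw [← ENNReal.ofReal_rpow_of_pos hpos, ENNReal.rpow_neg, ENNReal.rpow_neg]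
          gcongr
        · simp only [blob, indicator_of_notMem hz, enorm_zero]
          rw [ENNReal.zero_rpow_of_pos hp, zero_mul]
    _ = _ := by
        rw [lintegral_indicator (measurableSet_scaledShell Mc s), setLIntegral_const,
          ENNReal.ofReal_mul (p := A ^ (1 + 1 / k) * (Mc / 8 * s ^ 2) ^ (-(l / k)))
            (by positivity), ENNReal.ofReal_toReal hB.2]

lemma confined_blob (hk : 0 < k) (hl : 0 < l) (hMc : 0 < Mc) {m s : ℝ} (hm : 0 ≤ m) (hs : 0 < s)
    (hsL : L₀ ≤ Mc / 8 * s ^ 2) : Confined k l L₀ (blob Mc m s) where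
  integrable := integrable_blob hMc m hs
  nonneg := ae_of_all _ (blob_nonneg hm s)
  symmetric A := ae_of_all _ fun z => by
    have : (A z.1, A z.2) ∈ scaledShell Mc s ↔ z ∈ scaledShell Mc s := by
      have h := angMomSq_map A ((s ^ 2)⁻¹ • z.1, s • z.2)
      simp only [map_smul] at h
      simp only [scaledShell, farShell, mem_preimage, mem_ofPred_eq, norm_smul,
        LinearIsometryEquiv.norm_map, h]
    by_cases hz : z ∈ scaledShell Mc s
    · simp only [blob, indicator_of_mem hz, indicator_of_mem (this.2 hz)]
    · simp only [blob, indicator_of_notMem hz, indicator_of_notMem (fun h => hz (this.1 h))]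
  kin_lt_top := by
    have : kinEnergy (blob Mc m s)
        ≤ ∫⁻ z, ENNReal.ofReal (Mc / (4 * s ^ 2) * blob Mc m s z) := by
      refine lintegral_mono fun z => ENNReal.ofReal_le_ofReal ?_
      by_cases hz : z ∈ scaledShell Mc s
      · refine mul_le_mul_of_nonneg_right ?_ (blob_nonneg hm s z)
        have := (mem_scaledShell hs hz).2.2.1
        calc 1 / 2 * ‖z.2‖ ^ 2 ≤ 1 / 2 * (Mc / (2 * s ^ 2)) := by gcongr
          _ = _ := by field_simp; norm_num
      · simp [blob, hz]
    refine this.trans_lt ?_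
    exact ((integrable_blob hMc m hs).const_mul _).lintegral_lt_top
  casimir_lt_top := (casimir_blob_le hk hl hMc hm hs hsL).trans_lt ENNReal.ofReal_lt_top

/-- The norm of the blob decays faster than the energy gain `s⁻²`; this uses `k ≤ l`. -/
lemma exists_klNorm_blob_le (hk : 0 < k) (hkl : k ≤ l) (hMc : 0 < Mc) {m : ℝ} (hm : 0 ≤ m) :
    ∃ C a : ℝ, 0 ≤ C ∧ 2 < a ∧ ∀ s : ℝ, 0 < s → L₀ ≤ Mc / 8 * s ^ 2 →
      (klNorm k l L₀ (blob Mc m s)).toReal ≤ C * s ^ (-a) := by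
  have hl : 0 < l := hk.trans_le hkl
  have hq : 0 < k / (k + 1) := by positivity
  set V := (volume (farShell Mc)).toReal with hV
  have hV0 : 0 < V := ENNReal.toReal_pos (volume_farShell_pos hMc).ne' (volume_farShell_lt_top Mc).ne
  refine ⟨((m / V) ^ (1 + 1 / k) * (Mc / 8) ^ (-(l / k)) * V) ^ (k / (k + 1)),
    (3 + 2 * l) / (k + 1), by positivity, ?_, fun s hs hsL => ?_⟩
  -- the exponent exceeds `2` exactly when `2 * k < 1 + 2 * l`
  · rw [lt_div_iff₀ (by positivity)]
    linarith
  have hvol : (volume (scaledShell Mc s)).toReal = s ^ 3 * V := by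
    rw [volume_scaledShell hs, ENNReal.toReal_mul, ENNReal.toReal_ofReal (by positivity)]
  have h := casimir_blob_le hk hl hMc hm hs hsL
  rw [hvol] at h
  have hexp : (m / (s ^ 3 * V)) ^ (1 + 1 / k) * (Mc / 8 * s ^ 2) ^ (-(l / k)) * (s ^ 3 * V)
      = (m / V) ^ (1 + 1 / k) * (Mc / 8) ^ (-(l / k)) * V * s ^ (-((3 + 2 * l) / k)) := by
    have e1 : m / (s ^ 3 * V) = m / V * s ^ (-3 : ℝ) := by
      rw [Real.rpow_neg hs.le]; norm_cast; field_simp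
    have e2 : (s ^ 2 : ℝ) = s ^ (2 : ℝ) := by norm_cast
    have e3 : (s ^ 3 : ℝ) = s ^ (3 : ℝ) := by norm_cast
    rw [e1, e2, e3, Real.mul_rpow (by positivity) (by positivity),
      Real.mul_rpow (by positivity) (by positivity), ← Real.rpow_mul hs.le, ← Real.rpow_mul hs.le]
    have e4 : s ^ (-((3 + 2 * l) / k)) = s ^ (-3 * (1 + 1 / k)) * s ^ (2 * -(l / k)) * s ^ (3:ℝ) := by
      rw [← Real.rpow_add hs, ← Real.rpow_add hs]
      congr 1
      field_simp
      ring
    rw [e4]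
    ring
  rw [hexp] at h
  have h2 : klNorm k l L₀ (blob Mc m s) ≤ ENNReal.ofReal
      (((m / V) ^ (1 + 1 / k) * (Mc / 8) ^ (-(l / k)) * V * s ^ (-((3 + 2 * l) / k)))
        ^ (k / (k + 1))) := by
    rw [← ENNReal.ofReal_rpow_of_nonneg (by positivity) hq.le]
    exact ENNReal.rpow_le_rpow h hq.le
  refine (ENNReal.toReal_mono ENNReal.ofReal_ne_top h2).trans_eq ?_
  rw [ENNReal.toReal_ofReal (by positivity), Real.mul_rpow (by positivity) (by positivity),
    ← Real.rpow_mul hs.le]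
  congr 2
  field_simp

/-- A state of mass less than `M` can be completed to one of mass `M` with less energy: the missing
mass is placed at distance `s ^ 2` for a large `s`, where it gains an energy of order `s ^ (-2)` and
costs less in the Casimir functional. -/
lemma exists_admissible_lt (hk : 0 < k) (hkl : k ≤ l) (hL₀ : 0 < L₀) (hMc : 0 < Mc)
    (hf : Confined k l L₀ f) (hM : ∫ z, f z < M) :
    ∃ F, Admissible k l L₀ M F ∧ energyCasimir k l L₀ Mc F < energyCasimir k l L₀ Mc f := by
  have hl : 0 < l := hk.trans_le hkl
  have hp : (1:ℝ) ≤ 1 + 1 / k := by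
    have : 0 < 1 / k := by positivity
    linarith
  set m := M - ∫ z, f z with hm
  have hm0 : 0 < m := by linarith
  obtain ⟨C, a, hC, ha, hbound⟩ := exists_klNorm_blob_le (L₀ := L₀) hk hkl hMc hm0.le
  set N := (klNorm k l L₀ f).toReal with hN
  have hN0 : 0 ≤ N := ENNReal.toReal_nonneg
  -- the slope of `t ↦ t ^ (1 + 1 / k)` over `[N, N + 1]`, which bounds the growth of the Casimir
  -- functional by `D` times the norm of the blob
  set D := (N + 1) ^ (1 + 1 / k) - N ^ (1 + 1 / k) with hD
  have hD0 : 0 ≤ D := sub_nonneg.2 (Real.rpow_le_rpow hN0 (by linarith) (by linarith))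
  have t1 : Tendsto (fun s : ℝ => D * C * s ^ (-(a - 2))) atTop (𝓝 (D * C * 0)) :=
    (tendsto_rpow_neg_atTop (by linarith)).const_mul _
  have t2 : Tendsto (fun s : ℝ => C * s ^ (-a)) atTop (𝓝 (C * 0)) :=
    (tendsto_rpow_neg_atTop (by linarith)).const_mul _
  have t3 : Tendsto (fun s : ℝ => Mc / 8 * s ^ 2) atTop atTop :=
    (tendsto_pow_atTop two_ne_zero).const_mul_atTop (by positivity)
  rw [mul_zero] at t1 t2
  obtain ⟨s, hs1, hs2, hs3, hs⟩ := ((t1.eventually (gt_mem_nhds (by positivity : 0 < Mc * m / 4))).and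
    ((t2.eventually (gt_mem_nhds one_pos)).and ((t3.eventually_ge_atTop L₀).and
      (eventually_gt_atTop 0)))).exists
  have hg := confined_blob hk hl hMc hm0.le hs hs3
  set g := blob Mc m s with hgdef
  have hfg := hf.add hk hg
  have ef := hf.finiteEnergy hk hl hL₀
  have eg := hg.finiteEnergy hk hl hL₀
  have efg := hfg.finiteEnergy hk hl hL₀
  have hmass : ∫ z, (f z + g z) = M := by
    rw [integral_add hf.integrable hg.integrable, integral_blob hMc m hs]
    linarith
  refine ⟨fun z => f z + g z, hmass ▸ hfg.admissible hk hl, ?_⟩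
  -- the Casimir functional grows by less than the energy gain
  set b := (klNorm k l L₀ g).toReal with hb
  have hb0 : 0 ≤ b := ENNReal.toReal_nonneg
  have hbC : b ≤ C * s ^ (-a) := hbound s hs hs3
  have hb1 : b ≤ 1 := hbC.trans hs2.le
  have hcas : (casimir k l L₀ fun z => f z + g z).toReal ≤ (casimir k l L₀ f).toReal + b * D := by
    rw [Confined.casimir_toReal_eq_rpow hk, Confined.casimir_toReal_eq_rpow hk]
    have hfin1 := ((klNorm_lt_top_iff (l := l) (L₀ := L₀) hk).2 hf.casimir_lt_top).ne
    have hfin2 := ((klNorm_lt_top_iff (l := l) (L₀ := L₀) hk).2 hg.casimir_lt_top).ne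
    have h1 : (klNorm k l L₀ fun z => f z + g z).toReal ≤ N + b := by
      rw [hN, hb, ← ENNReal.toReal_add hfin1 hfin2]
      exact ENNReal.toReal_mono (ENNReal.add_ne_top.2 ⟨hfin1, hfin2⟩)
        (klNorm_add_le hk hf.integrable.aemeasurable hg.integrable.aemeasurable)
    have h2 : (N + b) ^ (1 + 1 / k) ≤ N ^ (1 + 1 / k) + b * D := by
      have := (convexOn_rpow hp).2 (mem_Ici.2 hN0) (mem_Ici.2 (by linarith : (0:ℝ) ≤ N + 1))
        (sub_nonneg.2 hb1) hb0 (by ring)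
      simp only [smul_eq_mul] at this
      calc (N + b) ^ (1 + 1 / k) = ((1 - b) * N + b * (N + 1)) ^ (1 + 1 / k) := by ring_nf
        _ ≤ _ := this
        _ = _ := by rw [hD]; ring
    exact (Real.rpow_le_rpow ENNReal.toReal_nonneg h1 (by linarith)).trans h2
  have hbD : b * D < Mc * m / (4 * s ^ 2) := by
    rw [lt_div_iff₀ (by positivity)]
    have e : s ^ (-(a - 2)) = s ^ (-a) * s ^ 2 := by
      rw [show -(a - 2) = -a + 2 by ring, Real.rpow_add hs]; norm_cast
    have h1 : b * D * s ^ 2 ≤ D * C * s ^ (-(a - 2)) := by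
      rw [e]
      calc b * D * s ^ 2 ≤ (C * s ^ (-a)) * D * s ^ 2 := by gcongr
        _ = _ := by ring
    linarith
  -- on the rescaled shell the attraction of the point mass is at least twice the kinetic energy
  have hkin : 1 / 2 * (∫ z, ‖z.2‖ ^ 2 * g z) - Mc * ∫ z, g z / ‖z.1‖ ≤ -(Mc * m / (4 * s ^ 2)) := by
    have h1 : ∫ z, (1 / 2 * (‖z.2‖ ^ 2 * g z) - Mc * (g z / ‖z.1‖))
        ≤ ∫ z, -(Mc / (4 * s ^ 2)) * g z := by
      refine integral_mono (integrable_fun_sub (eg.kin.const_mul _) (eg.div_norm.const_mul _))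
        (eg.integrable.const_mul _) fun z => ?_
      by_cases hz : z ∈ scaledShell Mc s
      · obtain ⟨h1, h2, h3, -⟩ := mem_scaledShell hs hz
        have hs2 : 0 < s ^ 2 := by positivity
        have hg0 : 0 ≤ g z := blob_nonneg hm0.le s z
        have hx : 0 < ‖z.1‖ := hs2.trans_le h1
        have h4 : Mc / (2 * s ^ 2) * g z ≤ Mc * (g z / ‖z.1‖) := by
          rw [mul_div_assoc', le_div_iff₀ hx]
          calc Mc / (2 * s ^ 2) * g z * ‖z.1‖ ≤ Mc / (2 * s ^ 2) * g z * (2 * s ^ 2) := by gcongr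
            _ = _ := by field_simp
        have h5 : 1 / 2 * (‖z.2‖ ^ 2 * g z) ≤ 1 / 2 * (Mc / (2 * s ^ 2) * g z) := by gcongr
        have h6 : -(Mc / (4 * s ^ 2)) * g z
            = 1 / 2 * (Mc / (2 * s ^ 2) * g z) - Mc / (2 * s ^ 2) * g z := by field_simp; ring
        simp only
        linarith
      · simp [hgdef, blob, hz]
    rw [integral_sub (eg.kin.const_mul _) (eg.div_norm.const_mul _), integral_const_mul,
      integral_const_mul, integral_const_mul, integral_blob hMc m hs] at h1
    refine h1.trans_eq ?_
    ring
  -- adding mass strengthens the field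
  have hfield : ∫ x, ‖gradPot (density f) x‖ ^ 2
      ≤ ∫ x, ‖gradPot (density fun z => f z + g z) x‖ ^ 2 := by
    refine integral_mono ef.radialSource.integrable_sq efg.radialSource.integrable_sq fun x => ?_
    have hd0 := density_nonneg_ae hf.nonneg
    have hd1 := density_nonneg_ae hg.nonneg
    simp only [norm_gradPot_sq]
    rw [massIn_congr (density_add_ae hf.integrable hg.integrable),
      massIn_add ef.radialSource.integrable eg.radialSource.integrable]
    have := massIn_nonneg hd0 ‖x‖
    have := massIn_nonneg hd1 ‖x‖
    gcongr
    linarith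
  have hpi := Real.pi_pos
  have hfield' : 1 / (8 * Real.pi) * (∫ x, ‖gradPot (density f) x‖ ^ 2)
      ≤ 1 / (8 * Real.pi) * ∫ x, ‖gradPot (density fun z => f z + g z) x‖ ^ 2 := by gcongr
  rw [hf.energyCasimir_eq, hfg.energyCasimir_eq, mechEnergy, mechEnergy, efg.potEnergy_eq,
    ef.potEnergy_eq]
  have e1 : ∫ z, ‖z.2‖ ^ 2 * (f z + g z) = (∫ z, ‖z.2‖ ^ 2 * f z) + ∫ z, ‖z.2‖ ^ 2 * g z := by
    simp only [mul_add]; exact integral_add ef.kin eg.kin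
  have e2 : ∫ z, (f z + g z) / ‖z.1‖ = (∫ z, f z / ‖z.1‖) + ∫ z, g z / ‖z.1‖ := by
    simp only [add_div]; exact integral_add ef.div_norm eg.div_norm
  rw [e1, e2]
  linarith

end

/-! ### Compactness of minimizing sequences -/

lemma tendsto_zero_of_forall_le_add {a : ℕ → ℝ} (ha : ∀ n, 0 ≤ a n)
    (h : ∀ ε > 0, ∃ b : ℕ → ℝ, Tendsto b atTop (𝓝 0) ∧ ∀ n, a n ≤ ε + b n) :
    Tendsto a atTop (𝓝 0) := by
  rw [Metric.tendsto_atTop]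
  intro ε hε
  obtain ⟨b, hb, hab⟩ := h (ε / 2) (by positivity)
  obtain ⟨N, hN⟩ := (Metric.tendsto_atTop.1 hb) (ε / 2) (by positivity)
  refine ⟨N, fun n hn => ?_⟩
  have h1 := hN n hn
  rw [Real.dist_0_eq_abs] at h1 ⊢
  rw [abs_of_nonneg (ha n)]
  have := hab n
  have := le_abs_self (b n)
  linarith

lemma lintegral_le_liminf_of_tendsto {α : Type*} [MeasurableSpace α] {μ : Measure α}
    {F : ℕ → α → ℝ≥0∞} {G : α → ℝ≥0∞} (hF : ∀ n, AEMeasurable (F n) μ)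
    (h : ∀ᵐ a ∂μ, Tendsto (fun n => F n a) atTop (𝓝 (G a))) :
    ∫⁻ a, G a ∂μ ≤ liminf (fun n => ∫⁻ a, F n a ∂μ) atTop := by
  refine le_trans (le_of_eq (lintegral_congr_ae ?_)) (lintegral_liminf_le' hF)
  filter_upwards [h] with a ha using ha.liminf_eq.symm

section

variable {k l L₀ M Mc : ℝ} {f g : Space × Space → ℝ}

namespace Confined

lemma abs_massIn_le (h : Confined k l L₀ f) (r : ℝ) : |massIn (density f) r| ≤ ∫ z, f z := by
  refine (VlasovPoisson.abs_massIn_le (integrable_density h.integrable) r).trans_eq ?_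
  rw [← integral_density h.integrable]
  refine integral_congr_ae ?_
  filter_upwards [density_nonneg_ae h.nonneg] with x hx using abs_of_nonneg hx

lemma integral_div_sq_le (hk : 0 < k) (hl : 0 < l) (hL₀ : 0 < L₀) (h : Confined k l L₀ f) :
    ∫ z, f z / ‖z.1‖ ^ 2 ≤ 1 / L₀ * ∫ z, ‖z.2‖ ^ 2 * f z := by
  rw [← integral_const_mul]
  exact integral_mono_ae (h.finiteEnergy hk hl hL₀).div_sq (h.integrable_kin.const_mul _)
    (h.div_sq_le hk hl hL₀)

lemma abs_massIn_le_sq (hk : 0 < k) (hl : 0 < l) (hL₀ : 0 < L₀) (h : Confined k l L₀ f) (r : ℝ) :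
    |massIn (density f) r| ≤ r ^ 2 * (1 / L₀ * ∫ z, ‖z.2‖ ^ 2 * f z) := by
  have e := h.finiteEnergy hk hl hL₀
  refine (VlasovPoisson.abs_massIn_le_sq e.radialSource r).trans ?_
  refine mul_le_mul_of_nonneg_left ?_ (sq_nonneg r)
  refine le_trans (le_of_eq ?_) (h.integral_div_sq_le hk hl hL₀)
  have h1 := integral_mul_density (f := f) (h := fun x => (‖x‖ ^ 2)⁻¹)
    (by simpa only [div_eq_inv_mul] using e.div_sq)
  simp only [div_eq_inv_mul]
  rw [← h1]
  refine integral_congr_ae ?_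
  filter_upwards [density_nonneg_ae h.nonneg] with x hx
  rw [abs_of_nonneg hx]

lemma aemeasurable (h : Confined k l L₀ f) : AEMeasurable f := h.integrable.aemeasurable

end Confined

/-- Bounded kinetic energy makes the fields of admissible states precompact: the mass functions are
monotone, and Helly's theorem together with dominated convergence applies. -/
lemma exists_subseq_fieldDist_tendsto (hk : 0 < k) (hl : 0 < l) (hL₀ : 0 < L₀)
    {f : ℕ → Space × Space → ℝ} (hf : ∀ n, Admissible k l L₀ M (f n)) {T : ℝ}
    (hT : ∀ n, ∫ z, ‖z.2‖ ^ 2 * f n z ≤ T) :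
    ∃ φ : ℕ → ℕ, StrictMono φ ∧
      Tendsto (fun q : ℕ × ℕ => fieldDist (f (φ q.1)) (f (φ q.2))) atTop (𝓝 0) := by
  set m : ℕ → ℝ → ℝ := fun n => massIn (density (f n)) with hm
  set B := 1 / L₀ * T with hB
  have hi : ∀ n, Integrable (density (f n)) := fun n => integrable_density (hf n).integrable
  have hmono : ∀ n, Monotone (m n) := fun n =>
    massIn_mono (hi n) (density_nonneg_ae (hf n).nonneg)
  have hbd : ∀ n r, |m n r| ≤ M := fun n r =>
    ((hf n).confined.abs_massIn_le r).trans_eq (hf n).mass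
  have hbd2 : ∀ n r, |m n r| ≤ r ^ 2 * B := fun n r => by
    refine ((hf n).confined.abs_massIn_le_sq hk hl hL₀ r).trans ?_
    rw [hB]
    gcongr
    exact hT n
  obtain ⟨φ, hφ, g, N, hN, hg⟩ := exists_subseq_tendsto_of_monotone hmono hbd
  refine ⟨φ, hφ, ?_⟩
  have hNae := ae_norm_notMem_of_countable hN
  have hgm : AEMeasurable (fun x : Space => g ‖x‖) :=
    aemeasurable_of_tendsto_metrizable_ae atTop
      (f := fun n (x : Space) => m (φ n) ‖x‖)
      (fun n => ((measurable_massIn (hi (φ n))).comp measurable_norm).aemeasurable)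
      (by filter_upwards [hNae] with x hx using hg _ hx)
  have hmm : ∀ n, Measurable fun x : Space => m n ‖x‖ := fun n =>
    (measurable_massIn (hi n)).comp measurable_norm
  let G : ℕ → Space → ℝ := fun n x => (m (φ n) ‖x‖ - g ‖x‖) ^ 2 / ‖x‖ ^ 4
  have hGm : ∀ n, AEStronglyMeasurable (G n) volume := fun n =>
    AEMeasurable.aestronglyMeasurable
      ((((hmm _).aemeasurable.sub hgm).pow_const 2).div (by fun_prop))
  have hdom : ∀ n, ∀ᵐ x : Space, ‖G n x‖
      ≤ (16 * ((2 * M) ^ 2 + (2 * B) ^ 2)) * ((1 + ‖x‖) ^ 4)⁻¹ := fun n => by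
    filter_upwards [hNae] with x hx
    have h1 : |g ‖x‖| ≤ M := le_of_tendsto' (hg _ hx).abs fun n => hbd _ _
    have h2 : |g ‖x‖| ≤ ‖x‖ ^ 2 * B := le_of_tendsto' (hg _ hx).abs fun n => hbd2 _ _
    rw [Real.norm_of_nonneg (by positivity)]
    refine sq_div_pow_four_le (norm_nonneg x) ?_ ?_
    · exact (abs_sub _ _).trans (by linarith [hbd (φ n) ‖x‖])
    · exact (abs_sub _ _).trans (by linarith [hbd2 (φ n) ‖x‖])
  have hGi : ∀ n, Integrable (G n) := fun n =>
    (integrable_inv_one_add_norm_pow_four.const_mul _).mono' (hGm n) (hdom n)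
  have hlim : Tendsto (fun n => ∫ x, G n x) atTop (𝓝 (∫ _ : Space, (0:ℝ))) := by
    refine tendsto_integral_of_dominated_convergence _ hGm
      (integrable_inv_one_add_norm_pow_four.const_mul _) hdom ?_
    filter_upwards [hNae] with x hx
    have h1 := (((hg _ hx).sub_const (g ‖x‖)).pow 2).div_const (‖x‖ ^ 4)
    simpa using h1
  rw [integral_zero] at hlim
  have hfst : Tendsto (fun q : ℕ × ℕ => ∫ x, G q.1 x) atTop (𝓝 0) := by
    rw [← prod_atTop_atTop_eq]; exact hlim.comp tendsto_fst
  have hsnd : Tendsto (fun q : ℕ × ℕ => ∫ x, G q.2 x) atTop (𝓝 0) := by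
    rw [← prod_atTop_atTop_eq]; exact hlim.comp tendsto_snd
  have hsum := ((hfst.add hsnd).const_mul 2).const_mul (1 / (8 * Real.pi))
  rw [add_zero, mul_zero, mul_zero] at hsum
  refine squeeze_zero (fun q => fieldDist_nonneg _ _) (fun q => ?_) hsum
  have e1 := (hf (φ q.1)).confined.finiteEnergy hk hl hL₀
  have e2 := (hf (φ q.2)).confined.finiteEnergy hk hl hL₀
  have hpi := Real.pi_pos
  rw [e1.fieldDist_eq e2]
  refine mul_le_mul_of_nonneg_left ?_ (by positivity : 0 ≤ 1 / (8 * Real.pi))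
  rw [← integral_add (hGi _) (hGi _), ← integral_const_mul]
  refine integral_mono (e1.sub e2).radialSource.integrable_sq
    (((hGi _).fun_add (hGi _)).const_mul 2) fun x => ?_
  simp only [norm_gradPot_sq, G]
  rw [massIn_congr (density_sub_ae e1.integrable e2.integrable), massIn_sub (hi _) (hi _),
    ← add_div, mul_div_assoc']
  refine div_le_div_of_nonneg_right ?_ (by positivity)
  nlinarith [sq_nonneg ((m (φ q.1) ‖x‖ - g ‖x‖) + (m (φ q.2) ‖x‖ - g ‖x‖))]

/-- The parallelogram law for the energy: only the field term is not affine. -/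
lemma FiniteEnergy.mechEnergy_midpoint (Mc : ℝ) (hf : FiniteEnergy f) (hg : FiniteEnergy g) :
    mechEnergy Mc (fun z => 1 / 2 * (f z + g z))
      = 1 / 2 * (mechEnergy Mc f + mechEnergy Mc g) + 1 / 4 * fieldDist f g := by
  have hm := (hf.add hg).const_mul (1 / 2)
  have h1 := hf.mechEnergy_sub Mc hm
  have h2 := hg.mechEnergy_sub Mc hm
  have e1 : ∀ z, f z - 1 / 2 * (f z + g z) = 1 / 2 * (f z - g z) := fun z => by ring
  have e2 : ∀ z, g z - 1 / 2 * (f z + g z) = -(1 / 2) * (f z - g z) := fun z => by ring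
  rw [hf.fieldDist_eq hm] at h1
  rw [hg.fieldDist_eq hm] at h2
  rw [hf.fieldDist_eq hg]
  simp only [e1] at h1
  simp only [e2] at h2
  simp only [density_const_mul (1 / 2), density_const_mul (-(1 / 2)), gradPot_const_mul, norm_smul,
    mul_pow, integral_const_mul, mul_left_comm _ (1 / 2 : ℝ), mul_left_comm _ (-(1 / 2) : ℝ)]
    at h1 h2
  norm_num at h1 h2
  have e3 : 1 / (8 * Real.pi) = Real.pi⁻¹ * (1 / 8) := by rw [one_div, mul_inv]; ring
  rw [e3]
  linarith

/-- If `h` bounds the energy of the midpoint from below, uniform convexity of the Casimir functional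
controls the distance of two almost minimizers with almost equal fields. -/
lemma casimir_sub_le (hk : 0 < k) (hl : 0 < l) (hL₀ : 0 < L₀) {h η K : ℝ} (hK0 : 0 ≤ K)
    (hK : ∀ a b : ℝ, 0 ≤ a → 0 ≤ b → |a - b| ^ (1 + 1 / k) ≤ η * (a ^ (1 + 1 / k) + b ^ (1 + 1 / k))
      + K * ((a ^ (1 + 1 / k) + b ^ (1 + 1 / k)) / 2 - ((a + b) / 2) ^ (1 + 1 / k)))
    (hf : Confined k l L₀ f) (hg : Confined k l L₀ g)
    (hmid : h ≤ energyCasimir k l L₀ Mc (fun z => 1 / 2 * (f z + g z))) :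
    casimir k l L₀ (fun z => f z - g z) ≤ ENNReal.ofReal
      (η * ((casimir k l L₀ f).toReal + (casimir k l L₀ g).toReal)
        + K * (1 / 2 * (energyCasimir k l L₀ Mc f + energyCasimir k l L₀ Mc g) - h
          + 1 / 4 * fieldDist f g)) := by
  have hm := (hf.add hk hg).const_mul hk (by norm_num : (0:ℝ) ≤ 1 / 2)
  have ef := hf.finiteEnergy hk hl hL₀
  have eg := hg.finiteEnergy hk hl hL₀
  obtain ⟨if1, if2⟩ := hf.casimir_toReal hk hl
  obtain ⟨ig1, ig2⟩ := hg.casimir_toReal hk hl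
  obtain ⟨im1, im2⟩ := hm.casimir_toReal hk hl
  set w : Space × Space → ℝ := fun z => max (angMomSq z - L₀) 0 ^ (-(l / k)) with hw
  have hw0 : ∀ z, 0 ≤ w z := fun z => Real.rpow_nonneg (le_max_right _ _) _
  have hv : ∀ᵐ z, angMomSq z ≤ L₀ → f z - g z = 0 := by
    filter_upwards [hf.vanish hk hl, hg.vanish hk hl] with z h1 h2 hL
    rw [h1 hL, h2 hL, sub_zero]
  rw [casimir_eq_lintegral_ofReal hk hv]
  have hsum := (if1.fun_add ig1).const_mul η
  have hdef := (integrable_fun_sub ((if1.fun_add ig1).const_mul (1 / 2)) im1).const_mul K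
  have hpt : ∀ᵐ z, |f z - g z| ^ (1 + 1 / k) * w z
      ≤ η * (f z ^ (1 + 1 / k) * w z + g z ^ (1 + 1 / k) * w z)
        + K * (1 / 2 * (f z ^ (1 + 1 / k) * w z + g z ^ (1 + 1 / k) * w z)
          - (1 / 2 * (f z + g z)) ^ (1 + 1 / k) * w z) := by
    filter_upwards [hf.nonneg, hg.nonneg] with z h1 h2
    have := mul_le_mul_of_nonneg_right (hK _ _ h1 h2) (hw0 z)
    refine this.trans_eq ?_
    rw [show (f z + g z) / 2 = 1 / 2 * (f z + g z) by ring]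
    ring
  have hint : ∫ z, (η * (f z ^ (1 + 1 / k) * w z + g z ^ (1 + 1 / k) * w z)
        + K * (1 / 2 * (f z ^ (1 + 1 / k) * w z + g z ^ (1 + 1 / k) * w z)
          - (1 / 2 * (f z + g z)) ^ (1 + 1 / k) * w z))
      ≤ η * ((casimir k l L₀ f).toReal + (casimir k l L₀ g).toReal)
        + K * (1 / 2 * (energyCasimir k l L₀ Mc f + energyCasimir k l L₀ Mc g) - h
          + 1 / 4 * fieldDist f g) := by
    rw [integral_add hsum hdef, integral_const_mul, integral_const_mul, integral_sub
      ((if1.fun_add ig1).const_mul (1 / 2)) im1, integral_const_mul, integral_add if1 ig1, ← if2,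
      ← ig2, ← im2]
    have hmech := ef.mechEnergy_midpoint Mc eg
    rw [hm.energyCasimir_eq, hmech] at hmid
    rw [hf.energyCasimir_eq, hg.energyCasimir_eq]
    gcongr
    linarith
  refine le_trans ?_ (ENNReal.ofReal_le_ofReal hint)
  rw [ofReal_integral_eq_lintegral_ofReal (hsum.fun_add hdef)]
  · refine lintegral_mono_ae ?_
    filter_upwards [hpt] with z hz using ENNReal.ofReal_le_ofReal hz
  · filter_upwards [hpt] with z hz
    exact le_trans (mul_nonneg (Real.rpow_nonneg (abs_nonneg _) _) (hw0 z)) hz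

lemma tendsto_klNorm_zero {ι : Type*} {u : Filter ι} (hk : 0 < k) {F : ι → Space × Space → ℝ}
    (h : Tendsto (fun i => casimir k l L₀ (F i)) u (𝓝 0)) :
    Tendsto (fun i => klNorm k l L₀ (F i)) u (𝓝 0) := by
  have hq : 0 < k / (k + 1) := by positivity
  have := (ENNReal.continuous_rpow_const (y := k / (k + 1))).tendsto 0
  rw [ENNReal.zero_rpow_of_pos hq] at this
  exact this.comp h

/-- A sequence of almost minimizers whose fields are Cauchy is Cauchy in the weighted norm. -/
lemma tendsto_klNorm_sub (hk : 0 < k) (hl : 0 < l) (hL₀ : 0 < L₀) {h C : ℝ}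
    (hmin : ∀ g, Admissible k l L₀ M g → h ≤ energyCasimir k l L₀ Mc g)
    {f : ℕ → Space × Space → ℝ} (hf : ∀ n, Admissible k l L₀ M (f n))
    (hC : ∀ n, (casimir k l L₀ (f n)).toReal ≤ C)
    (hH : Tendsto (fun n => energyCasimir k l L₀ Mc (f n)) atTop (𝓝 h))
    (hfd : Tendsto (fun q : ℕ × ℕ => fieldDist (f q.1) (f q.2)) atTop (𝓝 0)) :
    Tendsto (fun q : ℕ × ℕ => klNorm k l L₀ (fun z => f q.1 z - f q.2 z)) atTop (𝓝 0) := by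
  refine tendsto_klNorm_zero hk ?_
  have hC0 : 0 ≤ C := ENNReal.toReal_nonneg.trans (hC 0)
  have hp : 1 < 1 + 1 / k := by
    have : 0 < 1 / k := by positivity
    linarith
  rw [ENNReal.tendsto_nhds_zero]
  intro ε hε
  obtain ⟨e, he0, heε⟩ : ∃ e : ℝ, 0 < e ∧ ENNReal.ofReal e ≤ ε := by
    obtain ⟨e, -, he1, he2⟩ := ENNReal.lt_iff_exists_real_btwn.1 hε
    exact ⟨e, by simpa using he1, he2.le⟩
  set η := e / (2 * (2 * C + 1)) with hη
  have hη0 : 0 < η := by positivity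
  obtain ⟨K, hK0, hK⟩ := exists_convexity_bound hp hη0
  have hH1 : Tendsto (fun q : ℕ × ℕ => energyCasimir k l L₀ Mc (f q.1)) atTop (𝓝 h) := by
    rw [← prod_atTop_atTop_eq]; exact hH.comp tendsto_fst
  have hH2 : Tendsto (fun q : ℕ × ℕ => energyCasimir k l L₀ Mc (f q.2)) atTop (𝓝 h) := by
    rw [← prod_atTop_atTop_eq]; exact hH.comp tendsto_snd
  have hlim := (((((hH1.add hH2).const_mul (1 / 2)).sub_const h).add
    (hfd.const_mul (1 / 4))).const_mul K)
  have hz : K * (1 / 2 * (h + h) - h + 1 / 4 * 0) = 0 := by ring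
  rw [hz] at hlim
  filter_upwards [hlim.eventually (gt_mem_nhds (by positivity : 0 < e / 2))] with q hq
  have hmid : ∫ z, 1 / 2 * (f q.1 z + f q.2 z) = M := by
    rw [integral_const_mul, integral_add (hf _).integrable (hf _).integrable, (hf _).mass,
      (hf _).mass]
    ring
  have ha := ((((hf q.1).confined.add hk (hf q.2).confined).const_mul hk
    (by norm_num : (0:ℝ) ≤ 1 / 2)).admissible hk hl)
  rw [hmid] at ha
  refine (casimir_sub_le hk hl hL₀ hK0 hK (hf q.1).confined (hf q.2).confined
    (hmin _ ha)).trans (le_trans (ENNReal.ofReal_le_ofReal ?_) heε)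
  have h1 : η * ((casimir k l L₀ (f q.1)).toReal + (casimir k l L₀ (f q.2)).toReal) ≤ e / 2 := by
    calc η * ((casimir k l L₀ (f q.1)).toReal + (casimir k l L₀ (f q.2)).toReal)
        ≤ η * (2 * C + 1) := by
          have := hC q.1
          have := hC q.2
          exact mul_le_mul_of_nonneg_left (by linarith) hη0.le
      _ = e / 2 := by rw [hη]; field_simp
  linarith

end

/-! ### Limits of minimizing sequences -/

section

variable {k l L₀ M Mc : ℝ}

/-- Completeness of the weighted space. -/
lemma exists_limit_of_klNorm_cauchy (hk : 0 < k) (hl : 0 < l) {f : ℕ → Space × Space → ℝ}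
    (hf : ∀ n, Confined k l L₀ (f n))
    (hc : Tendsto (fun q : ℕ × ℕ => klNorm k l L₀ (fun z => f q.1 z - f q.2 z)) atTop (𝓝 0)) :
    ∃ F : Space × Space → ℝ, AEMeasurable F ∧
      Tendsto (fun n => klNorm k l L₀ (fun z => f n z - F z)) atTop (𝓝 0) ∧
      ∃ ψ : ℕ → ℕ, StrictMono ψ ∧ ∀ᵐ z, Tendsto (fun n => f (ψ n) z) atTop (𝓝 (F z)) := by
  have : Fact (1 ≤ kExp k) := ⟨one_le_kExp hk⟩
  set μ := weightedMeasure k l L₀ with hμ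
  have hm : ∀ n, MemLp (f n) (kExp k) μ := fun n =>
    ⟨(hf n).integrable.aestronglyMeasurable.mono_ac weightedMeasure_ac, by
      rw [← klNorm_eq_eLpNorm hk (hf n).aemeasurable, klNorm_lt_top_iff hk]
      exact (hf n).casimir_lt_top⟩
  have hcauchy : CauchySeq fun n => (hm n).toLp (f n) := by
    rw [Lp.cauchySeq_Lp_iff_cauchySeq_eLpNorm]
    refine hc.congr fun q => ?_
    rw [klNorm_eq_eLpNorm hk ((hf q.1).aemeasurable.fun_sub (hf q.2).aemeasurable)]
    refine eLpNorm_congr_ae ?_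
    filter_upwards [(hm q.1).coeFn_toLp, (hm q.2).coeFn_toLp] with z h1 h2
    rw [Pi.sub_apply, h1, h2]
  obtain ⟨F, hF⟩ := cauchySeq_tendsto_of_complete hcauchy
  have hFm : AEMeasurable F volume :=
    ((Lp.aestronglyMeasurable F).mono_ac (volume_ac_weightedMeasure hk hl)).aemeasurable
  have hlim : Tendsto (fun n => eLpNorm (f n - (F : Space × Space → ℝ)) (kExp k) μ) atTop (𝓝 0) := by
    have := (Lp.tendsto_Lp_iff_tendsto_eLpNorm' _ _).1 hF
    refine this.congr fun n => eLpNorm_congr_ae ?_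
    filter_upwards [(hm n).coeFn_toLp] with z h1
    rw [Pi.sub_apply, Pi.sub_apply, h1]
  refine ⟨F, hFm, ?_, ?_⟩
  · refine hlim.congr fun n => ?_
    rw [klNorm_eq_eLpNorm hk ((hf n).aemeasurable.fun_sub hFm)]
    rfl
  · obtain ⟨ψ, hψ, h⟩ := (tendstoInMeasure_of_tendsto_eLpNorm (kExp_ne_zero hk)
      (fun n => (hm n).1) (Lp.aestronglyMeasurable F) hlim).exists_seq_tendsto_ae
    exact ⟨ψ, hψ, (ae_weightedMeasure_iff hk hl).1 h⟩

/-- A pointwise limit of admissible states with bounded energies is confined, and its mass is at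
most `M`. -/
lemma confined_of_tendsto {f : ℕ → Space × Space → ℝ}
    {F : Space × Space → ℝ} (hf : ∀ n, Admissible k l L₀ M (f n)) {T C : ℝ}
    (hT : ∀ n, ∫ z, ‖z.2‖ ^ 2 * f n z ≤ T) (hC : ∀ n, (casimir k l L₀ (f n)).toReal ≤ C)
    (hFm : AEMeasurable F) (hF : ∀ᵐ z, Tendsto (fun n => f n z) atTop (𝓝 (F z))) :
    Confined k l L₀ F ∧ ∫ z, F z ≤ M := by
  have hnn : ∀ᵐ z, 0 ≤ F z := by
    filter_upwards [hF, ae_all_iff.2 fun n => (hf n).nonneg] with z h1 h2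
    exact ge_of_tendsto' h1 h2
  have hle : ∀ {G : ℕ → Space × Space → ℝ≥0∞} {H : Space × Space → ℝ≥0∞} {c : ℝ}
      {μ : Measure (Space × Space)}, (∀ n, AEMeasurable (G n) μ) →
      (∀ᵐ z ∂μ, Tendsto (fun n => G n z) atTop (𝓝 (H z))) →
      (∀ n, ∫⁻ z, G n z ∂μ ≤ ENNReal.ofReal c) → ∫⁻ z, H z ∂μ ≤ ENNReal.ofReal c := by
    intro G H c μ h1 h2 h3
    refine (lintegral_le_liminf_of_tendsto h1 h2).trans ?_
    exact (liminf_le_liminf (Eventually.of_forall h3)).trans_eq (by simp)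
  have hmass : ∫⁻ z, ENNReal.ofReal (F z) ≤ ENNReal.ofReal M := by
    refine hle (G := fun n z => ENNReal.ofReal (f n z))
      (fun n => (hf n).confined.aemeasurable.ennreal_ofReal) ?_ fun n => ?_
    · filter_upwards [hF] with z hz using (ENNReal.continuous_ofReal.tendsto _).comp hz
    · rw [← ofReal_integral_eq_lintegral_ofReal (hf n).integrable (hf n).nonneg, (hf n).mass]
  have hint : Integrable F := (lintegral_ofReal_ne_top_iff_integrable hFm.aestronglyMeasurable
    hnn).1 (hmass.trans_lt ENNReal.ofReal_lt_top).ne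
  have hM : 0 ≤ M := by
    rw [← (hf 0).mass]; exact integral_nonneg_of_ae (hf 0).nonneg
  refine ⟨⟨hint, hnn, fun A => ?_, ?_, ?_⟩, ?_⟩
  · filter_upwards [hF, (measurePreserving_symm A).quasiMeasurePreserving.ae hF,
      ae_all_iff.2 fun n => (hf n).symmetric A] with z h1 h2 h3
    exact tendsto_nhds_unique (h2.congr h3) h1
  · refine lt_of_le_of_lt (hle (G := fun n z => ENNReal.ofReal (1 / 2 * ‖z.2‖ ^ 2 * f n z))
      (c := 1 / 2 * T) (fun n => ?_) ?_ fun n => ?_) ENNReal.ofReal_lt_top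
    · exact (AEMeasurable.mul (by fun_prop) (hf n).confined.aemeasurable).ennreal_ofReal
    · filter_upwards [hF] with z hz
      exact (ENNReal.continuous_ofReal.tendsto _).comp (hz.const_mul _)
    · change kinEnergy (f n) ≤ _
      rw [← ENNReal.ofReal_toReal (hf n).confined.kin_lt_top.ne, (hf n).confined.kin_toReal]
      exact ENNReal.ofReal_le_ofReal (by have := hT n; gcongr)
  · rw [casimir_eq_lintegral_weightedMeasure hFm]
    refine lt_of_le_of_lt (hle (G := fun n z => ‖f n z‖ₑ ^ (1 + 1 / k)) (c := C)
      (fun n => ?_) ?_ fun n => ?_) ENNReal.ofReal_lt_top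
    · exact ((hf n).confined.aemeasurable.mono_ac weightedMeasure_ac).enorm.pow_const _
    · have := weightedMeasure_ac.ae_le (μ := weightedMeasure k l L₀) hF
      filter_upwards [this] with z hz
      exact (ENNReal.continuous_rpow_const.tendsto _).comp
        ((continuous_enorm.tendsto _).comp hz)
    · rw [← casimir_eq_lintegral_weightedMeasure (hf n).confined.aemeasurable,
        ← ENNReal.ofReal_toReal (hf n).confined.casimir_lt_top.ne]
      exact ENNReal.ofReal_le_ofReal (hC n)
  · rw [integral_eq_lintegral_of_nonneg_ae hnn hFm.aestronglyMeasurable]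
    exact ENNReal.toReal_le_of_le_ofReal hM hmass

/-- Convergence in the weighted norm with bounded kinetic energies implies convergence in mass over
bounded regions of position space: the weight is bounded below on bounded sets. -/
lemma tendsto_integral_cylinder (hk : 0 < k) (hl : 0 < l) (hL₀ : 0 < L₀)
    {f : ℕ → Space × Space → ℝ}
    {F : Space × Space → ℝ} (hf : ∀ n, Confined k l L₀ (f n)) (hF : Confined k l L₀ F) {T : ℝ}
    (hT : ∀ n, ∫ z, ‖z.2‖ ^ 2 * f n z ≤ T)
    (hlim : Tendsto (fun n => klNorm k l L₀ (fun z => f n z - F z)) atTop (𝓝 0)) (r : ℝ)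
    (hr : 0 < r) :
    Tendsto (fun n => ∫ z in {z : Space × Space | ‖z.1‖ ≤ r}, |f n z - F z|) atTop (𝓝 0) := by
  have hp : 0 < 1 + 1 / k := by positivity
  set T' := T + ∫ z, ‖z.2‖ ^ 2 * F z with hT'
  have hT0 : 0 ≤ T' := by
    have h1 : 0 ≤ ∫ z, ‖z.2‖ ^ 2 * f 0 z := integral_nonneg_of_ae (by
      filter_upwards [(hf 0).nonneg] with z hz; simp only [Pi.zero_apply]; positivity)
    have h2 : 0 ≤ ∫ z, ‖z.2‖ ^ 2 * F z := integral_nonneg_of_ae (by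
      filter_upwards [hF.nonneg] with z hz; simp only [Pi.zero_apply]; positivity)
    linarith [hT 0]
  have hcas : Tendsto (fun n => (casimir k l L₀ (fun z => f n z - F z)).toReal) atTop (𝓝 0) := by
    have h1 := (ENNReal.continuous_rpow_const (y := 1 + 1 / k)).tendsto 0
    rw [ENNReal.zero_rpow_of_pos hp] at h1
    have h2 := (ENNReal.tendsto_toReal ENNReal.zero_ne_top).comp (h1.comp hlim)
    simpa only [Function.comp_def, ← casimir_eq_klNorm_rpow hk, ENNReal.toReal_zero] using h2
  set S : Set (Space × Space) := {z | ‖z.1‖ ≤ r} with hS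
  have hSm : MeasurableSet S := measurableSet_le (by fun_prop) (by fun_prop)
  set w : Space × Space → ℝ := fun z => max (angMomSq z - L₀) 0 ^ (-(l / k)) with hw
  have hw0 : ∀ z, 0 ≤ w z := fun z => Real.rpow_nonneg (le_max_right _ _) _
  have hd : ∀ n, Integrable fun z => |f n z - F z| := fun n =>
    (hf n).integrable.sub hF.integrable |>.abs
  -- the Casimir integral of the difference as a real integral
  have hreal : ∀ n, casimir k l L₀ (fun z => f n z - F z) ≠ ∞ →
      Integrable (fun z => |f n z - F z| ^ (1 + 1 / k) * w z) ∧
      ∫ z, |f n z - F z| ^ (1 + 1 / k) * w z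
        = (casimir k l L₀ (fun z => f n z - F z)).toReal := by
    intro n hfin
    have hv : ∀ᵐ z, angMomSq z ≤ L₀ → f n z - F z = 0 := by
      filter_upwards [(hf n).vanish hk hl, hF.vanish hk hl] with z h1 h2 hL
      rw [h1 hL, h2 hL, sub_zero]
    rw [casimir_eq_lintegral_ofReal hk hv] at hfin ⊢
    have hm : AEStronglyMeasurable (fun z => |f n z - F z| ^ (1 + 1 / k) * w z) volume := by
      refine AEMeasurable.aestronglyMeasurable ?_
      refine ((hd n).aemeasurable.pow_const _).mul ?_
      exact (((measurable_angMomSq.sub_const L₀).max measurable_const).pow_const _).aemeasurable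
    have h0 : 0 ≤ᵐ[volume] fun z => |f n z - F z| ^ (1 + 1 / k) * w z :=
      ae_of_all _ fun z => mul_nonneg (Real.rpow_nonneg (abs_nonneg _) _) (hw0 z)
    exact ⟨(lintegral_ofReal_ne_top_iff_integrable hm h0).1 hfin,
      integral_eq_lintegral_of_nonneg_ae h0 hm⟩
  have hfin : ∀ n, casimir k l L₀ (fun z => f n z - F z) ≠ ∞ := fun n => by
    rw [← lt_top_iff_ne_top, ← klNorm_lt_top_iff hk,
      klNorm_eq_eLpNorm hk ((hf n).aemeasurable.fun_sub hF.aemeasurable)]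
    refine (eLpNorm_sub_le ((hf n).aemeasurable.aestronglyMeasurable.mono_ac weightedMeasure_ac)
      (hF.aemeasurable.aestronglyMeasurable.mono_ac weightedMeasure_ac)
      (one_le_kExp hk)).trans_lt (ENNReal.add_lt_top.2 ⟨?_, ?_⟩)
    · rw [← klNorm_eq_eLpNorm hk (hf n).aemeasurable, klNorm_lt_top_iff hk]
      exact (hf n).casimir_lt_top
    · rw [← klNorm_eq_eLpNorm hk hF.aemeasurable, klNorm_lt_top_iff hk]
      exact hF.casimir_lt_top
  refine tendsto_zero_of_forall_le_add (fun n => integral_nonneg fun z => abs_nonneg _) ?_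
  intro ε hε
  -- cut off large velocities with `V`, then small values of the difference with `lam`
  obtain ⟨V, hV0, hV⟩ : ∃ V : ℝ, 0 < V ∧ T' / V ^ 2 ≤ ε / 2 := by
    have h1 : Tendsto (fun V : ℝ => T' / V ^ 2) atTop (𝓝 0) :=
      tendsto_const_nhds.div_atTop (tendsto_pow_atTop two_ne_zero)
    obtain ⟨V, h2, h3⟩ := ((h1.eventually (gt_mem_nhds (by positivity : 0 < ε / 2))).and
      (eventually_gt_atTop 0)).exists
    exact ⟨V, h3, h2.le⟩
  set B : Set (Space × Space) :=
    Metric.closedBall (0 : Space) r ×ˢ Metric.closedBall (0 : Space) V with hB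
  have hBm : MeasurableSet B :=
    Metric.isClosed_closedBall.measurableSet.prod Metric.isClosed_closedBall.measurableSet
  have hBfin : volume B < ∞ := by
    rw [hB, Measure.volume_eq_prod, Measure.prod_prod]
    exact ENNReal.mul_lt_top measure_closedBall_lt_top measure_closedBall_lt_top
  set lam := ε / (2 * ((volume B).toReal + 1)) with hlam
  have hlam0 : 0 < lam := by positivity
  set c := lam ^ (-(1 / k)) * (r ^ 2 * V ^ 2) ^ (l / k) with hc
  -- three regimes: large velocities, where the kinetic energies bound the mass; small differences,
  -- on a set of finite volume; and the rest, where the Casimir density bounds the difference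
  have hpt : ∀ n, ∀ᵐ z ∂volume.restrict S, |f n z - F z| ≤ B.indicator (fun _ => lam) z
      + c * (|f n z - F z| ^ (1 + 1 / k) * w z)
      + 1 / V ^ 2 * (‖z.2‖ ^ 2 * f n z + ‖z.2‖ ^ 2 * F z) := by
    intro n
    filter_upwards [ae_restrict_mem hSm, ae_restrict_of_ae (hf n).nonneg,
      ae_restrict_of_ae hF.nonneg, ae_restrict_of_ae ((hf n).vanish hk hl),
      ae_restrict_of_ae (hF.vanish hk hl)] with z hzS h1 h2 h3 h4
    have hz : ‖z.1‖ ≤ r := hzS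
    have t1 : 0 ≤ B.indicator (fun _ => lam) z := indicator_nonneg (fun _ _ => hlam0.le) _
    have t2 : 0 ≤ c * (|f n z - F z| ^ (1 + 1 / k) * w z) :=
      mul_nonneg (by positivity) (mul_nonneg (by positivity) (hw0 z))
    have t3 : 0 ≤ 1 / V ^ 2 * (‖z.2‖ ^ 2 * f n z + ‖z.2‖ ^ 2 * F z) := by positivity
    rcases le_or_gt (angMomSq z) L₀ with hL | hL
    · rw [h3 hL, h4 hL] at *
      simp only [sub_zero, abs_zero] at *
      linarith
    rcases lt_or_ge V ‖z.2‖ with hv | hv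
    · have h5 : |f n z - F z| ≤ f n z + F z := by
        rw [abs_le]; constructor <;> linarith
      have h6 : f n z + F z ≤ 1 / V ^ 2 * (‖z.2‖ ^ 2 * f n z + ‖z.2‖ ^ 2 * F z) := by
        rw [← mul_add, ← mul_assoc]
        refine le_mul_of_one_le_left (by positivity) ?_
        rw [one_div, ← div_eq_inv_mul, one_le_div (by positivity)]
        gcongr
      linarith
    · have hzB : z ∈ B := ⟨by simpa using hz, by simpa using hv⟩
      rw [indicator_of_mem hzB] at t1 ⊢
      rcases le_or_gt |f n z - F z| lam with h5 | h5
      · linarith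
      · have hpos : 0 < |f n z - F z| := hlam0.trans h5
        have hLr : angMomSq z - L₀ ≤ r ^ 2 * V ^ 2 := by
          have h6 := angMomSq_le z
          have h7 : ‖z.1‖ ^ 2 * ‖z.2‖ ^ 2 ≤ r ^ 2 * V ^ 2 := by gcongr
          linarith
        have hLpos : 0 < angMomSq z - L₀ := by linarith
        have hwz : (r ^ 2 * V ^ 2) ^ (-(l / k)) ≤ w z := by
          rw [hw]
          simp only
          rw [max_eq_left hLpos.le]
          exact Real.rpow_le_rpow_of_nonpos hLpos hLr (by
            have : 0 < l / k := by positivity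
            linarith)
        have h8 : lam ^ (1 / k) ≤ |f n z - F z| ^ (1 / k) := by gcongr
        have h9 : |f n z - F z| ≤ c * (|f n z - F z| ^ (1 + 1 / k) * w z) := by
          calc |f n z - F z|
              = lam ^ (-(1 / k)) * lam ^ (1 / k) * |f n z - F z|
                * ((r ^ 2 * V ^ 2) ^ (l / k) * (r ^ 2 * V ^ 2) ^ (-(l / k))) := by
                rw [← Real.rpow_add hlam0, ← Real.rpow_add (by positivity)]
                simp
            _ ≤ lam ^ (-(1 / k)) * |f n z - F z| ^ (1 / k) * |f n z - F z|
                * ((r ^ 2 * V ^ 2) ^ (l / k) * w z) := by gcongr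
            _ = _ := by
                rw [hc, Real.rpow_add hpos, Real.rpow_one]
                ring
        linarith
  refine ⟨fun n => c * (casimir k l L₀ (fun z => f n z - F z)).toReal, ?_, fun n => ?_⟩
  · simpa using hcas.const_mul c
  obtain ⟨hi, hie⟩ := hreal n (hfin n)
  have i1 : Integrable (B.indicator fun _ => lam) :=
    (integrable_indicator_iff hBm).2 (integrableOn_const hBfin.ne)
  have i2 := hi.const_mul c
  have i3 := ((hf n).integrable_kin.fun_add hF.integrable_kin).const_mul (1 / V ^ 2)
  have n1 : ∀ z, 0 ≤ B.indicator (fun _ => lam) z := fun z => indicator_nonneg (fun _ _ => hlam0.le) _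
  have n2 : ∀ z, 0 ≤ c * (|f n z - F z| ^ (1 + 1 / k) * w z) := fun z =>
    mul_nonneg (by positivity) (mul_nonneg (by positivity) (hw0 z))
  calc ∫ z in S, |f n z - F z|
      ≤ ∫ z in S, (B.indicator (fun _ => lam) z + c * (|f n z - F z| ^ (1 + 1 / k) * w z)
          + 1 / V ^ 2 * (‖z.2‖ ^ 2 * f n z + ‖z.2‖ ^ 2 * F z)) :=
        integral_mono_ae (hd n).integrableOn ((i1.fun_add i2).fun_add i3).integrableOn (hpt n)
    _ ≤ ∫ z, (B.indicator (fun _ => lam) z + c * (|f n z - F z| ^ (1 + 1 / k) * w z)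
          + 1 / V ^ 2 * (‖z.2‖ ^ 2 * f n z + ‖z.2‖ ^ 2 * F z)) := by
        refine setIntegral_le_integral ((i1.fun_add i2).fun_add i3) ?_
        filter_upwards [(hf n).nonneg, hF.nonneg] with z h1 h2
        have := n1 z
        have := n2 z
        simp only [Pi.zero_apply]
        positivity
    _ = lam * (volume B).toReal + c * (casimir k l L₀ (fun z => f n z - F z)).toReal
          + 1 / V ^ 2 * ((∫ z, ‖z.2‖ ^ 2 * f n z) + ∫ z, ‖z.2‖ ^ 2 * F z) := by
        rw [integral_add (i1.fun_add i2) i3, integral_add i1 i2, integral_const_mul,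
          integral_const_mul, hie, integral_add (hf n).integrable_kin hF.integrable_kin,
          integral_indicator hBm, setIntegral_const, Measure.real, smul_eq_mul, mul_comm lam]
    _ ≤ ε / 2 + c * (casimir k l L₀ (fun z => f n z - F z)).toReal + ε / 2 := by
        gcongr
        · rw [hlam, div_mul_eq_mul_div, div_le_div_iff₀ (by positivity) (by positivity)]
          nlinarith [ENNReal.toReal_nonneg (a := volume B)]
        · refine le_trans ?_ hV
          rw [one_div, ← div_eq_inv_mul, hT']
          gcongr
          exact hT n
    _ = _ := by ring

/-- Weighted convergence with bounded kinetic energies and masses implies convergence of the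
potential energies. -/
lemma tendsto_potEnergy (hk : 0 < k) (hl : 0 < l) (hL₀ : 0 < L₀)
    {f : ℕ → Space × Space → ℝ}
    {F : Space × Space → ℝ} (hf : ∀ n, Admissible k l L₀ M (f n)) (hF : Confined k l L₀ F)
    (hFM : ∫ z, F z ≤ M) {T : ℝ} (hT : ∀ n, ∫ z, ‖z.2‖ ^ 2 * f n z ≤ T)
    (hlim : Tendsto (fun n => klNorm k l L₀ (fun z => f n z - F z)) atTop (𝓝 0)) :
    Tendsto (fun n => potEnergy Mc (f n)) atTop (𝓝 (potEnergy Mc F)) := by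
  have hc : ∀ n, Confined k l L₀ (f n) := fun n => (hf n).confined
  have ef : ∀ n, FiniteEnergy (f n) := fun n => (hc n).finiteEnergy hk hl hL₀
  have eF := hF.finiteEnergy hk hl hL₀
  have hD := tendsto_integral_cylinder hk hl hL₀ hc hF hT hlim
  set D : ℝ → ℕ → ℝ := fun r n => ∫ z in {z : Space × Space | ‖z.1‖ ≤ r}, |f n z - F z| with hDdef
  set B := 1 / L₀ * T with hB
  have hbd : ∀ n r, |massIn (density (f n)) r| ≤ M := fun n r =>
    ((hc n).abs_massIn_le r).trans_eq (hf n).mass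
  have hbd2 : ∀ n r, |massIn (density (f n)) r| ≤ r ^ 2 * B := fun n r => by
    refine ((hc n).abs_massIn_le_sq hk hl hL₀ r).trans ?_
    rw [hB]
    gcongr
    exact hT n
  have hmass : ∀ r, 0 < r →
      Tendsto (fun n => massIn (density (f n)) r) atTop (𝓝 (massIn (density F) r)) := by
    intro r hr
    rw [tendsto_iff_dist_tendsto_zero]
    refine squeeze_zero (fun n => dist_nonneg) (fun n => ?_) (hD r hr)
    rw [Real.dist_eq, massIn_density (hf n).integrable, massIn_density hF.integrable,
      ← integral_sub (hf n).integrable.integrableOn hF.integrable.integrableOn]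
    exact abs_integral_le_integral_abs
  have hfield : Tendsto (fun n => ∫ x, ‖gradPot (density (f n)) x‖ ^ 2) atTop
      (𝓝 (∫ x, ‖gradPot (density F) x‖ ^ 2)) := by
    refine tendsto_integral_of_dominated_convergence
      (fun x => (16 * (M ^ 2 + B ^ 2)) * ((1 + ‖x‖) ^ 4)⁻¹)
      (fun n => (ef n).radialSource.integrable_sq.aestronglyMeasurable)
      (integrable_inv_one_add_norm_pow_four.const_mul _)
      (fun n => ae_of_all _ fun x => ?_) ?_
    · rw [Real.norm_of_nonneg (by positivity), norm_gradPot_sq]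
      exact sq_div_pow_four_le (norm_nonneg x) (hbd n _) (hbd2 n _)
    · filter_upwards [ae_ne_zero] with x hx
      simp only [norm_gradPot_sq]
      exact ((hmass _ (norm_pos_iff.2 hx)).pow 2).div_const _
  have hdiv : Tendsto (fun n => ∫ z, f n z / ‖z.1‖) atTop (𝓝 (∫ z, F z / ‖z.1‖)) := by
    rw [tendsto_iff_dist_tendsto_zero]
    refine tendsto_zero_of_forall_le_add (fun n => dist_nonneg) fun ε hε => ?_
    set B' := B + ∫ z, F z / ‖z.1‖ ^ 2 with hB'
    have hnn : ∀ z, 0 ≤ ‖(z : Space × Space).1‖ := fun z => norm_nonneg _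
    have hB0 : 0 ≤ B' := by
      have h1 : 0 ≤ ∫ z, F z / ‖z.1‖ ^ 2 := integral_nonneg_of_ae (by
        filter_upwards [hF.nonneg] with z hz; simp only [Pi.zero_apply]; positivity)
      have h2 : 0 ≤ B := by
        have := (abs_nonneg _).trans (hbd2 0 1)
        linarith
      linarith
    have hM0 : 0 ≤ M := by rw [← (hf 0).mass]; exact integral_nonneg_of_ae (hf 0).nonneg
    set s := ε / (2 * (B' + 1)) with hs
    have hs0 : 0 < s := by positivity
    set R := 2 * (2 * M + 1) / ε with hR
    have hR0 : 0 < R := by positivity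
    refine ⟨fun n => 1 / s * D R n, by simpa using (hD R hR0).const_mul (1 / s), fun n => ?_⟩
    have hSm : MeasurableSet {z : Space × Space | ‖z.1‖ ≤ R} :=
      measurableSet_le (by fun_prop) (by fun_prop)
    have j1 := ((ef n).div_sq.fun_add eF.div_sq).const_mul s
    have j2 := ((integrable_fun_sub (hf n).integrable hF.integrable).abs.indicator hSm).const_mul
      (1 / s)
    have j3 := ((hf n).integrable.fun_add hF.integrable).const_mul (1 / R)
    -- near the origin the moment `∬ f / |x| ^ 2` is used, far from it the mass, and in between the
    -- convergence in mass
    have hpt : ∀ᵐ z : Space × Space, |f n z / ‖z.1‖ - F z / ‖z.1‖| ≤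
        s * (f n z / ‖z.1‖ ^ 2 + F z / ‖z.1‖ ^ 2)
        + 1 / s * {z : Space × Space | ‖z.1‖ ≤ R}.indicator (fun z => |f n z - F z|) z
        + 1 / R * (f n z + F z) := by
      filter_upwards [(hf n).nonneg, hF.nonneg] with z h1 h2
      rw [← sub_div, abs_div, abs_norm]
      have h5 : |f n z - F z| ≤ f n z + F z := by
        rw [abs_le]; constructor <;> linarith
      have t1 : 0 ≤ s * (f n z / ‖z.1‖ ^ 2 + F z / ‖z.1‖ ^ 2) := by positivity
      have t2 : 0 ≤ 1 / s * {z : Space × Space | ‖z.1‖ ≤ R}.indicator (fun z => |f n z - F z|) z :=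
        mul_nonneg (by positivity) (indicator_nonneg (fun _ _ => abs_nonneg _) _)
      have t3 : 0 ≤ 1 / R * (f n z + F z) := by positivity
      rcases eq_or_ne ‖z.1‖ 0 with h0 | h0
      · have h6 : |f n z - F z| / ‖z.1‖ = 0 := by rw [h0, div_zero]
        rw [h6]
        linarith
      have hx : 0 < ‖z.1‖ := lt_of_le_of_ne (norm_nonneg _) (Ne.symm h0)
      rcases le_or_gt ‖z.1‖ s with h3 | h3
      · have : |f n z - F z| / ‖z.1‖ ≤ s * (f n z / ‖z.1‖ ^ 2 + F z / ‖z.1‖ ^ 2) := by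
          rw [← add_div, mul_div_assoc', div_le_div_iff₀ hx (by positivity)]
          calc |f n z - F z| * ‖z.1‖ ^ 2 = ‖z.1‖ * |f n z - F z| * ‖z.1‖ := by ring
            _ ≤ s * (f n z + F z) * ‖z.1‖ := by gcongr
        linarith
      rcases le_or_gt ‖z.1‖ R with h4 | h4
      · have hmem : z ∈ {z : Space × Space | ‖z.1‖ ≤ R} := h4
        rw [indicator_of_mem hmem] at t2 ⊢
        have : |f n z - F z| / ‖z.1‖ ≤ 1 / s * |f n z - F z| := by
          rw [one_div, ← div_eq_inv_mul]
          gcongr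
        linarith
      · have : |f n z - F z| / ‖z.1‖ ≤ 1 / R * (f n z + F z) := by
          rw [one_div, ← div_eq_inv_mul]
          gcongr
        linarith
    rw [Real.dist_eq, ← integral_sub (ef n).div_norm eF.div_norm]
    calc |∫ z, (f n z / ‖z.1‖ - F z / ‖z.1‖)| ≤ ∫ z, |f n z / ‖z.1‖ - F z / ‖z.1‖| :=
          abs_integral_le_integral_abs
      _ ≤ ∫ z, (s * (f n z / ‖z.1‖ ^ 2 + F z / ‖z.1‖ ^ 2)
          + 1 / s * {z : Space × Space | ‖z.1‖ ≤ R}.indicator (fun z => |f n z - F z|) z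
          + 1 / R * (f n z + F z)) :=
          integral_mono_ae ((ef n).div_norm.sub eF.div_norm).abs ((j1.fun_add j2).fun_add j3) hpt
      _ = s * ((∫ z, f n z / ‖z.1‖ ^ 2) + ∫ z, F z / ‖z.1‖ ^ 2) + 1 / s * D R n
          + 1 / R * ((∫ z, f n z) + ∫ z, F z) := by
          rw [integral_add (j1.fun_add j2) j3, integral_add j1 j2, integral_const_mul,
            integral_const_mul, integral_const_mul,
            integral_add (ef n).div_sq eF.div_sq, integral_add (hf n).integrable hF.integrable,
            integral_indicator hSm]
      _ ≤ s * B' + 1 / s * D R n + 1 / R * (2 * M) := by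
          have hdsq : ∫ z, f n z / ‖z.1‖ ^ 2 ≤ B := by
            refine ((hc n).integral_div_sq_le hk hl hL₀).trans ?_
            rw [hB]
            gcongr
            exact hT n
          have := (hf n).mass
          gcongr
          · linarith
          · linarith
      _ ≤ ε / 2 + 1 / s * D R n + ε / 2 := by
          gcongr
          · rw [hs, div_mul_eq_mul_div, div_le_div_iff₀ (by positivity) (by positivity)]
            nlinarith
          · rw [hR, one_div_div, div_mul_eq_mul_div, div_le_div_iff₀ (by positivity) (by positivity)]
            nlinarith
      _ = _ := by ring
  have := (hfield.const_mul (-(1 / (8 * Real.pi)))).sub (hdiv.const_mul Mc)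
  rw [eF.potEnergy_eq]
  exact this.congr fun n => ((ef n).potEnergy_eq Mc).symm

/-- Along a sequence converging in the weighted norm and almost everywhere, the potential energies
and the Casimir functionals converge, and the kinetic energy is lower semicontinuous by Fatou's
lemma. -/
lemma energyCasimir_le_of_tendsto (hk : 0 < k) (hl : 0 < l) (hL₀ : 0 < L₀)
    {f : ℕ → Space × Space → ℝ}
    {F : Space × Space → ℝ} (hf : ∀ n, Admissible k l L₀ M (f n)) (hF : Confined k l L₀ F)
    (hFM : ∫ z, F z ≤ M) {T h : ℝ} (hT : ∀ n, ∫ z, ‖z.2‖ ^ 2 * f n z ≤ T)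
    (hlim : Tendsto (fun n => klNorm k l L₀ (fun z => f n z - F z)) atTop (𝓝 0))
    (hae : ∀ᵐ z, Tendsto (fun n => f n z) atTop (𝓝 (F z)))
    (hH : Tendsto (fun n => energyCasimir k l L₀ Mc (f n)) atTop (𝓝 h)) :
    energyCasimir k l L₀ Mc F ≤ h := by
  have hpot := tendsto_potEnergy (Mc := Mc) hk hl hL₀ hf hF hFM hT hlim
  have hcas : Tendsto (fun n => (casimir k l L₀ (f n)).toReal) atTop
      (𝓝 (casimir k l L₀ F).toReal) := by
    have hnorm : Tendsto (fun n => (klNorm k l L₀ (f n)).toReal) atTop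
        (𝓝 (klNorm k l L₀ F).toReal) := by
      rw [tendsto_iff_dist_tendsto_zero]
      have h0 := (ENNReal.tendsto_toReal ENNReal.zero_ne_top).comp hlim
      rw [ENNReal.toReal_zero] at h0
      refine squeeze_zero' (Eventually.of_forall fun n => dist_nonneg) ?_ h0
      filter_upwards [hlim.eventually (gt_mem_nhds (ENNReal.zero_lt_top))] with n hn
      have hFin := ((klNorm_lt_top_iff (l := l) (L₀ := L₀) hk).2 hF.casimir_lt_top).ne
      have hfin := ((klNorm_lt_top_iff (l := l) (L₀ := L₀) hk).2 (hf n).confined.casimir_lt_top).ne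
      have hm1 := (hf n).confined.aemeasurable
      have h1 : klNorm k l L₀ (f n) ≤ klNorm k l L₀ (fun z => f n z - F z) + klNorm k l L₀ F := by
        refine le_trans (le_of_eq ?_) (klNorm_add_le hk (hm1.fun_sub hF.aemeasurable)
          hF.aemeasurable)
        simp
      have h2 : klNorm k l L₀ F ≤ klNorm k l L₀ (fun z => f n z - F z) + klNorm k l L₀ (f n) := by
        have h3 : klNorm k l L₀ (fun z => F z - f n z) = klNorm k l L₀ (fun z => f n z - F z) := by
          simp only [klNorm, casimir, Real.enorm_eq_ofReal_abs, abs_sub_comm]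
        rw [← h3]
        refine le_trans (le_of_eq ?_) (klNorm_add_le hk (hF.aemeasurable.fun_sub hm1) hm1)
        simp
      have h1' := ENNReal.toReal_mono (ENNReal.add_ne_top.2 ⟨hn.ne, hFin⟩) h1
      have h2' := ENNReal.toReal_mono (ENNReal.add_ne_top.2 ⟨hn.ne, hfin⟩) h2
      rw [ENNReal.toReal_add hn.ne hFin] at h1'
      rw [ENNReal.toReal_add hn.ne hfin] at h2'
      rw [Real.dist_eq, abs_le, Function.comp_apply]
      constructor <;> linarith
    have hp : (0:ℝ) ≤ 1 + 1 / k := by positivity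
    simp only [Confined.casimir_toReal_eq_rpow hk]
    exact ((Real.continuous_rpow_const hp).tendsto _).comp hnorm
  have hkin : Tendsto (fun n => (kinEnergy (f n)).toReal) atTop
      (𝓝 (h - potEnergy Mc F - (casimir k l L₀ F).toReal)) := by
    refine ((hH.sub hpot).sub hcas).congr fun n => ?_
    rw [energyCasimir]
    ring
  have hκ : 0 ≤ h - potEnergy Mc F - (casimir k l L₀ F).toReal :=
    ge_of_tendsto' hkin fun n => ENNReal.toReal_nonneg
  have hkinF : kinEnergy F ≤ ENNReal.ofReal (h - potEnergy Mc F - (casimir k l L₀ F).toReal) := by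
    refine (lintegral_le_liminf_of_tendsto
      (F := fun n z => ENNReal.ofReal (1 / 2 * ‖z.2‖ ^ 2 * f n z)) (fun n => ?_) ?_).trans ?_
    · exact (AEMeasurable.mul (by fun_prop) (hf n).confined.aemeasurable).ennreal_ofReal
    · filter_upwards [hae] with z hz
      exact (ENNReal.continuous_ofReal.tendsto _).comp (hz.const_mul _)
    · refine le_of_eq (Tendsto.liminf_eq ?_)
      refine ((ENNReal.continuous_ofReal.tendsto _).comp hkin).congr fun n => ?_
      simp only [Function.comp_apply, ENNReal.ofReal_toReal (hf n).confined.kin_lt_top.ne]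
      rfl
  have := ENNReal.toReal_le_of_le_ofReal hκ hkinF
  rw [energyCasimir]
  linarith

/-- Every minimizing sequence has a subsequence converging to the unique minimizer. -/
lemma exists_subseq_tendsto_minimizer (hk : 0 < k) (hkl : k ≤ l) (hL₀ : 0 < L₀) (hMc : 0 < Mc)
    {f₀ : Space × Space → ℝ} (hmin : IsMinimizer k l L₀ Mc M f₀)
    (huniq : ∀ g, IsMinimizer k l L₀ Mc M g → g =ᵐ[volume] f₀)
    {f : ℕ → Space × Space → ℝ} (hf : ∀ n, Admissible k l L₀ M (f n))
    (hH : Tendsto (fun n => energyCasimir k l L₀ Mc (f n)) atTop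
      (𝓝 (energyCasimir k l L₀ Mc f₀))) :
    ∃ φ : ℕ → ℕ, StrictMono φ ∧
      Tendsto (fun n => klNorm k l L₀ (fun z => f (φ n) z - f₀ z)) atTop (𝓝 0) := by
  have hl : 0 < l := hk.trans_le hkl
  have hM0 : 0 ≤ M := by rw [← (hf 0).mass]; exact integral_nonneg_of_ae (hf 0).nonneg
  obtain ⟨Hb, hHb⟩ := hH.bddAbove_range
  have hHb' : ∀ n, energyCasimir k l L₀ Mc (f n) ≤ Hb := fun n => hHb ⟨n, rfl⟩
  obtain ⟨C, hC⟩ := exists_kin_le (k := k) (l := l) (L₀ := L₀) (Mc := Mc) (M := M) hk hl hL₀ hMc.le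
    hM0
  have hb : ∀ n, (kinEnergy (f n)).toReal ≤ 2 * Hb + C ∧
      (casimir k l L₀ (f n)).toReal ≤ (2 * Hb + C) := fun n => by
    have h1 := hC (f n) (hf n).confined (hf n).mass.le
    have h2 := hHb' n
    have h3 : 0 ≤ (kinEnergy (f n)).toReal := ENNReal.toReal_nonneg
    have h4 : 0 ≤ (casimir k l L₀ (f n)).toReal := ENNReal.toReal_nonneg
    constructor <;> linarith
  have hT : ∀ n, ∫ z, ‖z.2‖ ^ 2 * f n z ≤ 2 * (2 * Hb + C) := fun n => by
    have h1 := (hb n).1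
    rw [(hf n).confined.kin_toReal] at h1
    linarith
  obtain ⟨φ, hφ, hfd⟩ := exists_subseq_fieldDist_tendsto hk hl hL₀ hf hT
  have hHφ := hH.comp hφ.tendsto_atTop
  have hcauchy := tendsto_klNorm_sub hk hl hL₀ hmin.2 (f := fun n => f (φ n)) (fun n => hf _)
    (fun n => (hb (φ n)).2) hHφ hfd
  obtain ⟨F, hFm, hlim, ψ, hψ, hae⟩ := exists_limit_of_klNorm_cauchy hk hl
    (f := fun n => f (φ n)) (fun n => (hf _).confined) hcauchy
  have hlimψ := hlim.comp hψ.tendsto_atTop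
  obtain ⟨hF, hFM⟩ := confined_of_tendsto (f := fun n => f (φ (ψ n))) (fun n => hf _)
    (fun n => hT _) (fun n => (hb _).2) hFm hae
  have hle := energyCasimir_le_of_tendsto hk hl hL₀ (f := fun n => f (φ (ψ n)))
    (fun n => hf _) hF hFM (fun n => hT _) hlimψ hae (hHφ.comp hψ.tendsto_atTop)
  -- no mass is lost in the limit, as completing the limit would lower the energy below its infimum
  have hmass : ∫ z, F z = M := by
    refine le_antisymm hFM (not_lt.1 fun hlt => ?_)
    obtain ⟨G, hG, hlt'⟩ := exists_admissible_lt hk hkl hL₀ hMc hF hlt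
    exact absurd (hmin.2 G hG) (not_le.2 (hlt'.trans_le hle))
  have hFa : Admissible k l L₀ M F := hmass ▸ hF.admissible hk hl
  have heq := huniq F ⟨hFa, fun g hg => hle.trans (hmin.2 g hg)⟩
  refine ⟨φ, hφ, hlim.congr fun n => klNorm_congr ?_⟩
  filter_upwards [heq] with z hz
  rw [hz]

/-- Stability of the minimizer within the class of admissible states. -/
theorem exists_delta_klNorm_lt (hk : 0 < k) (hkl : k ≤ l) (hL₀ : 0 < L₀) (hMc : 0 < Mc)
    {f₀ : Space × Space → ℝ} (hmin : IsMinimizer k l L₀ Mc M f₀)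
    (huniq : ∀ g, IsMinimizer k l L₀ Mc M g → g =ᵐ[volume] f₀) {ε : ℝ} (hε : 0 < ε) :
    ∃ δ : ℝ, 0 < δ ∧ ∀ g, Admissible k l L₀ M g →
      energyCasimir k l L₀ Mc g < energyCasimir k l L₀ Mc f₀ + δ →
      klNorm k l L₀ (fun z => g z - f₀ z) < ENNReal.ofReal ε := by
  by_contra! hcon
  choose f hf hlt hge using fun n : ℕ => hcon (1 / ((n : ℝ) + 1)) (by positivity)
  have hH : Tendsto (fun n => energyCasimir k l L₀ Mc (f n)) atTop
      (𝓝 (energyCasimir k l L₀ Mc f₀)) := by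
    have h1 := tendsto_one_div_add_atTop_nhds_zero_nat (𝕜 := ℝ)
    have h2 := h1.const_add (energyCasimir k l L₀ Mc f₀)
    rw [add_zero] at h2
    exact tendsto_of_tendsto_of_tendsto_of_le_of_le tendsto_const_nhds h2
      (fun n => hmin.2 _ (hf n)) (fun n => (hlt n).le)
  obtain ⟨φ, -, hφ⟩ := exists_subseq_tendsto_minimizer hk hkl hL₀ hMc hmin huniq hf hH
  obtain ⟨n, hn⟩ := (hφ.eventually (gt_mem_nhds (ENNReal.ofReal_pos.2 hε))).exists
  exact absurd hn (not_lt.2 (hge (φ n)))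

end

/-! ### Integrated transport identities -/

lemma integral_fderiv_apply_eq_zero {E : Type*} [NormedAddCommGroup E] [NormedSpace ℝ E]
    [FiniteDimensional ℝ E] [MeasurableSpace E] [BorelSpace E] {μ : Measure E} [μ.IsAddHaarMeasure]
    {u : E → ℝ} (hu : ContDiff ℝ 1 u) (hc : HasCompactSupport u) (v : E) :
    ∫ x, fderiv ℝ u x v ∂μ = 0 := by
  have hd : Integrable (fun x => fderiv ℝ u x v) μ :=
    ((hu.continuous_fderiv one_ne_zero).clm_apply continuous_const).integrable_of_hasCompactSupport
      (hc.fderiv_apply (𝕜 := ℝ) v)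
  have hui : Integrable u μ := hu.continuous.integrable_of_hasCompactSupport hc
  have := integral_mul_fderiv_eq_neg_fderiv_mul_of_integrable (μ := μ) (f := fun _ => (1:ℝ)) (g := u)
    (v := v) (by simp) (by simpa using hd) (by simpa using hui)
    (fun x _ => differentiableAt_const _) (fun x _ => hu.differentiable one_ne_zero x)
  simpa using this

/-- A time dependent phase-space function which is continuously differentiable up to `t = 0` and
compactly supported, locally uniformly in time. -/
structure Evolution (h : ℝ → Space × Space → ℝ) : Prop where
  contDiff : ContDiffOn ℝ 1 (fun p : ℝ × (Space × Space) => h p.1 p.2) (Ici 0 ×ˢ univ)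
  support : ∀ T : ℝ, ∃ R : ℝ, ∀ t ∈ Icc 0 T, ∀ x v : Space,
    R ≤ ‖x‖ ∨ R ≤ ‖v‖ → h t (x, v) = 0

lemma IsSolution.evolution {Mc : ℝ} {f : ℝ → Space × Space → ℝ} {U : ℝ → Space → ℝ}
    (h : IsSolution Mc f U) : Evolution f := ⟨h.contDiff, h.support⟩

/-- The derivative of `h` along `(1, v, a(x))`. -/
def transportDeriv (a : Space → Space) (h : ℝ → Space × Space → ℝ) (t : ℝ) (z : Space × Space) : ℝ :=
  fderiv ℝ (fun p : ℝ × (Space × Space) => h p.1 p.2) (t, z) (1, (z.2, a z.1))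

/-- The closed set `{|x| ≤ R, |v| ≤ R}`. -/
def phaseBox (R : ℝ) : Set (Space × Space) :=
  Metric.closedBall (0 : Space) R ×ˢ Metric.closedBall (0 : Space) R

lemma isCompact_phaseBox (R : ℝ) : IsCompact (phaseBox R) :=
  (isCompact_closedBall _ _).prod (isCompact_closedBall _ _)

lemma measurableSet_phaseBox (R : ℝ) : MeasurableSet (phaseBox R) :=
  (isCompact_phaseBox R).isClosed.measurableSet

lemma volume_phaseBox_lt_top (R : ℝ) : volume (phaseBox R) < ∞ :=
  (isCompact_phaseBox R).measure_lt_top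

lemma notMem_phaseBox {R : ℝ} {z : Space × Space} (h : z ∉ phaseBox R) :
    R < ‖z.1‖ ∨ R < ‖z.2‖ := by
  by_contra! hcon
  exact h ⟨by simpa using hcon.1, by simpa using hcon.2⟩

namespace Evolution

variable {h : ℝ → Space × Space → ℝ}

lemma eq_zero_of_notMem {R : ℝ} {t : ℝ}
    (hR : ∀ x v : Space, R ≤ ‖x‖ ∨ R ≤ ‖v‖ → h t (x, v) = 0) {z : Space × Space}
    (hz : z ∉ phaseBox R) : h t z = 0 :=
  hR z.1 z.2 ((notMem_phaseBox hz).imp le_of_lt le_of_lt)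

lemma contDiff_slice (hh : Evolution h) {t : ℝ} (ht : 0 ≤ t) : ContDiff ℝ 1 (h t) := by
  rw [← contDiffOn_univ]
  exact hh.contDiff.comp (f := fun z : Space × Space => (t, z)) (by fun_prop)
    (fun z _ => ⟨ht, mem_univ _⟩)

lemma hasCompactSupport (hh : Evolution h) {t : ℝ} (ht : 0 ≤ t) : HasCompactSupport (h t) := by
  obtain ⟨R, hR⟩ := hh.support t
  exact HasCompactSupport.intro (isCompact_phaseBox R) fun z hz =>
    eq_zero_of_notMem (hR t ⟨ht, le_rfl⟩) hz

lemma integrable (hh : Evolution h) {t : ℝ} (ht : 0 ≤ t) : Integrable (h t) :=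
  (hh.contDiff_slice ht).continuous.integrable_of_hasCompactSupport (hh.hasCompactSupport ht)

lemma contDiffAt (hh : Evolution h) {t : ℝ} (ht : 0 < t) (z : Space × Space) :
    ContDiffAt ℝ 1 (fun p : ℝ × (Space × Space) => h p.1 p.2) (t, z) :=
  hh.contDiff.contDiffAt (prod_mem_nhds (Ici_mem_nhds ht) univ_mem)

lemma hasFDerivAt (hh : Evolution h) {t : ℝ} (ht : 0 < t) (z : Space × Space) :
    HasFDerivAt (fun p : ℝ × (Space × Space) => h p.1 p.2)
      (fderiv ℝ (fun p : ℝ × (Space × Space) => h p.1 p.2) (t, z)) (t, z) :=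
  ((hh.contDiffAt ht z).differentiableAt one_ne_zero).hasFDerivAt

lemma fderiv_slice (hh : Evolution h) {t : ℝ} (ht : 0 < t) (z w : Space × Space) :
    fderiv ℝ (h t) z w = fderiv ℝ (fun p : ℝ × (Space × Space) => h p.1 p.2) (t, z) (0, w) := by
  have h1 := (hh.hasFDerivAt ht z).comp z ((hasFDerivAt_const t z).prodMk (hasFDerivAt_id z))
  have h2 : HasFDerivAt (h t) _ z := h1
  rw [h2.fderiv]
  simp

lemma hasDerivAt_time (hh : Evolution h) {t : ℝ} (ht : 0 < t) (z : Space × Space) :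
    HasDerivAt (fun s => h s z)
      (fderiv ℝ (fun p : ℝ × (Space × Space) => h p.1 p.2) (t, z) (1, 0)) t := by
  have h1 := (hh.hasFDerivAt ht z).comp_hasDerivAt t
    ((hasDerivAt_id t).prodMk (hasDerivAt_const t z))
  exact h1

lemma continuousOn_time (hh : Evolution h) (z : Space × Space) :
    ContinuousOn (fun s => h s z) (Ici 0) :=
  hh.contDiff.continuousOn.comp (f := fun s : ℝ => (s, z)) (by fun_prop)
    (fun s hs => ⟨hs, mem_univ _⟩)

/-- A common bound for the derivative, and a common support box, on a bounded time interval. -/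
lemma exists_bound (hh : Evolution h) (T : ℝ) : ∃ R C : ℝ, 0 < R ∧ 0 ≤ C ∧
    (∀ t ∈ Icc 0 T, ∀ z, z ∉ phaseBox R → h t z = 0) ∧
    (∀ t ∈ Ioo 0 T, ∀ z, z ∉ phaseBox R →
      fderiv ℝ (fun p : ℝ × (Space × Space) => h p.1 p.2) (t, z) = 0) ∧
    (∀ t ∈ Ioo 0 T, ∀ z, ‖fderiv ℝ (fun p : ℝ × (Space × Space) => h p.1 p.2) (t, z)‖ ≤ C) ∧
    ∀ t ∈ Icc 0 T, ∀ z, |h t z| ≤ C := by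
  obtain ⟨R₀, hR₀⟩ := hh.support T
  set R := max R₀ 1 with hR
  have hR1 : R₀ ≤ R := le_max_left _ _
  have hz0 : ∀ t ∈ Icc 0 T, ∀ z, z ∉ phaseBox R → h t z = 0 := fun t ht z hz =>
    hR₀ t ht z.1 z.2 ((notMem_phaseBox hz).imp (fun h => hR1.trans h.le) (fun h => hR1.trans h.le))
  have hd0 : ∀ t ∈ Ioo 0 T, ∀ z, z ∉ phaseBox R →
      fderiv ℝ (fun p : ℝ × (Space × Space) => h p.1 p.2) (t, z) = 0 := by
    intro t ht z hz
    have : (fun p : ℝ × (Space × Space) => h p.1 p.2) =ᶠ[𝓝 (t, z)] fun _ => 0 := by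
      have hmem : Ioo 0 T ×ˢ (phaseBox R)ᶜ ∈ 𝓝 (t, z) :=
        prod_mem_nhds (Ioo_mem_nhds ht.1 ht.2) ((isCompact_phaseBox R).isClosed.isOpen_compl.mem_nhds hz)
      filter_upwards [hmem] with p hp
      exact hz0 p.1 ⟨hp.1.1.le, hp.1.2.le⟩ p.2 hp.2
    rw [this.fderiv_eq]
    simp
  have hcpt : IsCompact (Icc 0 T ×ˢ phaseBox R) := isCompact_Icc.prod (isCompact_phaseBox R)
  have hsub : Icc 0 T ×ˢ phaseBox R ⊆ Ici 0 ×ˢ univ := prod_mono Icc_subset_Ici_self (subset_univ _)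
  have hu : UniqueDiffOn ℝ (Ici (0:ℝ) ×ˢ (univ : Set (Space × Space))) :=
    (uniqueDiffOn_Ici 0).prod uniqueDiffOn_univ
  have hcont := (hh.contDiff.continuousOn_fderivWithin hu le_rfl).mono hsub
  obtain ⟨C₁, hC₁⟩ := hcpt.exists_bound_of_continuousOn hcont
  obtain ⟨C₂, hC₂⟩ := hcpt.exists_bound_of_continuousOn (hh.contDiff.continuousOn.mono hsub)
  refine ⟨R, max (max C₁ C₂) 0, by positivity, le_max_right _ _, hz0, hd0, fun t ht z => ?_,
    fun t ht z => ?_⟩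
  · by_cases hz : z ∈ phaseBox R
    · have h1 := hC₁ (t, z) ⟨⟨ht.1.le, ht.2.le⟩, hz⟩
      rw [fderivWithin_of_mem_nhds (prod_mem_nhds (Ici_mem_nhds ht.1) univ_mem)] at h1
      exact h1.trans ((le_max_left _ _).trans (le_max_left _ _))
    · rw [hd0 t ht z hz, norm_zero]
      exact le_max_right _ _
  · by_cases hz : z ∈ phaseBox R
    · exact (hC₂ (t, z) ⟨ht, hz⟩).trans ((le_max_right _ _).trans (le_max_left _ _))
    · rw [hz0 t ht z hz, abs_zero]
      exact le_max_right _ _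

/-- Lipschitz continuity in time, uniformly in phase space. -/
lemma exists_lipschitz (hh : Evolution h) (T : ℝ) : ∃ R C : ℝ, 0 < R ∧ 0 ≤ C ∧
    ∀ s ∈ Icc 0 T, ∀ t ∈ Icc 0 T, ∀ z,
      |h t z - h s z| ≤ (phaseBox R).indicator (fun _ => C * |t - s|) z := by
  obtain ⟨R, C, hR, hC, h0, -, hd, -⟩ := hh.exists_bound T
  refine ⟨R, C, hR, hC, ?_⟩
  have key : ∀ s t, 0 ≤ s → s ≤ t → t ≤ T → ∀ z,
      |h t z - h s z| ≤ (phaseBox R).indicator (fun _ => C * |t - s|) z := by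
    intro s t hs hst htT z
    by_cases hz : z ∈ phaseBox R
    · rw [indicator_of_mem hz]
      rcases hst.eq_or_lt with rfl | hlt
      · simp
      obtain ⟨c, hc, hceq⟩ := exists_hasDerivAt_eq_slope (fun s => h s z) _ hlt
        ((hh.continuousOn_time z).mono (fun x hx => hs.trans hx.1))
        (fun x hx => hh.hasDerivAt_time (hs.trans_lt hx.1) z)
      rw [eq_div_iff (by linarith)] at hceq
      rw [← hceq, abs_mul]
      gcongr
      have h1 := hd c ⟨hs.trans_lt hc.1, hc.2.trans_le htT⟩ z
      have h2 := ContinuousLinearMap.le_opNorm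
        (fderiv ℝ (fun p : ℝ × (Space × Space) => h p.1 p.2) (c, z)) (1, 0)
      rw [Real.norm_eq_abs] at h2
      refine h2.trans ?_
      have h3 : ‖((1 : ℝ), (0 : Space × Space))‖ = 1 := by simp [Prod.norm_def]
      rw [h3, mul_one]
      exact h1
    · rw [indicator_of_notMem hz, h0 t ⟨hs.trans hst, htT⟩ z hz, h0 s ⟨hs, hst.trans htT⟩ z hz]
      simp
  intro s hs t ht z
  rcases le_total s t with hst | hst
  · exact key s t hs.1 hst ht.2 z
  · rw [abs_sub_comm, abs_sub_comm t s]
    exact key t s ht.1 hst hs.2 z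

lemma continuousOn_integral (hh : Evolution h) : ContinuousOn (fun t => ∫ z, h t z) (Ici 0) := by
  intro t ht
  obtain ⟨R, C, -, hC, hL⟩ := hh.exists_lipschitz (t + 1)
  rw [ContinuousWithinAt, tendsto_iff_dist_tendsto_zero]
  have hlim : Tendsto (fun s => (volume (phaseBox R)).toReal * (C * |s - t|)) (𝓝[Ici 0] t) (𝓝 0) := by
    have : Continuous fun s => (volume (phaseBox R)).toReal * (C * |s - t|) := by fun_prop
    have h1 := this.tendsto t
    simp only [sub_self, abs_zero, mul_zero] at h1
    exact h1.mono_left nhdsWithin_le_nhds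
  refine squeeze_zero' (Eventually.of_forall fun _ => dist_nonneg) ?_ hlim
  have hev : ∀ᶠ s in 𝓝[Ici 0] t, s < t + 1 :=
    (eventually_lt_nhds (by linarith)).filter_mono nhdsWithin_le_nhds
  filter_upwards [hev, self_mem_nhdsWithin] with s hs hs0
  have ht0 : 0 ≤ t := ht
  have hi : Integrable ((phaseBox R).indicator fun _ => C * |s - t|) :=
    (integrable_indicator_iff (measurableSet_phaseBox R)).2
      (integrableOn_const (volume_phaseBox_lt_top R).ne)
  rw [Real.dist_eq, ← integral_sub (hh.integrable hs0) (hh.integrable ht)]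
  calc |∫ z, (h s z - h t z)| ≤ ∫ z, |h s z - h t z| := abs_integral_le_integral_abs
    _ ≤ ∫ z, (phaseBox R).indicator (fun _ => C * |s - t|) z :=
        integral_mono ((hh.integrable hs0).sub (hh.integrable ht)).abs hi
          (hL t ⟨ht0, by linarith⟩ s ⟨hs0, hs.le⟩)
    _ = _ := by
        rw [integral_indicator (measurableSet_phaseBox R), setIntegral_const, Measure.real,
          smul_eq_mul]

lemma hasDerivAt_integral (hh : Evolution h) {t : ℝ} (ht : 0 < t) :
    Integrable (fun z => fderiv ℝ (fun p : ℝ × (Space × Space) => h p.1 p.2) (t, z) (1, 0)) ∧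
    HasDerivAt (fun t => ∫ z, h t z)
      (∫ z, fderiv ℝ (fun p : ℝ × (Space × Space) => h p.1 p.2) (t, z) (1, 0)) t := by
  obtain ⟨R, C, hR, hC, h0, hd0, hd, -⟩ := hh.exists_bound (t + 1)
  have hcont : ∀ s, 0 < s → Continuous fun z =>
      fderiv ℝ (fun p : ℝ × (Space × Space) => h p.1 p.2) (s, z) (1, 0) := by
    intro s hs
    rw [continuous_iff_continuousAt]
    intro z
    have h1 : ContinuousAt (fderiv ℝ (fun p : ℝ × (Space × Space) => h p.1 p.2)) (s, z) :=
      (hh.contDiffAt hs z).continuousAt_fderiv one_ne_zero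
    have h2 : ContinuousAt (fun z : Space × Space => (s, z)) z := by fun_prop
    exact (ContinuousAt.comp (f := fun z : Space × Space => (s, z)) h1 h2).clm_apply
      continuousAt_const
  have hi : Integrable ((phaseBox R).indicator fun _ => C) :=
    (integrable_indicator_iff (measurableSet_phaseBox R)).2
      (integrableOn_const (volume_phaseBox_lt_top R).ne)
  refine hasDerivAt_integral_of_dominated_loc_of_deriv_le
    (F' := fun s z => fderiv ℝ (fun p : ℝ × (Space × Space) => h p.1 p.2) (s, z) (1, 0))
    (bound := (phaseBox R).indicator fun _ => C) (s := Ioo 0 (t + 1))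
    (Ioo_mem_nhds ht (by linarith)) ?_ (hh.integrable ht.le) (hcont t ht).aestronglyMeasurable
    (ae_of_all _ fun z s hs => ?_) hi (ae_of_all _ fun z s hs => hh.hasDerivAt_time hs.1 z)
  · filter_upwards [Ioi_mem_nhds ht] with s hs
    exact (hh.integrable (le_of_lt hs)).aestronglyMeasurable
  · by_cases hz : z ∈ phaseBox R
    · rw [indicator_of_mem hz]
      refine (ContinuousLinearMap.le_opNorm _ _).trans ?_
      have h3 : ‖((1 : ℝ), (0 : Space × Space))‖ = 1 := by simp [Prod.norm_def]
      rw [h3, mul_one]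
      exact hd s hs z
    · rw [indicator_of_notMem hz, hd0 s hs z hz]
      simp

end Evolution

/-- The vector field `(v, a(x))` is divergence free. -/
lemma integral_fderiv_phase_eq_zero {u : Space × Space → ℝ} (hu : ContDiff ℝ 1 u)
    (hc : HasCompactSupport u) {a : Space → Space} (ha : ContinuousOn a {0}ᶜ) {η : ℝ} (hη : 0 < η)
    (h0 : ∀ x v : Space, ‖x‖ ≤ η → u (x, v) = 0) :
    Integrable (fun z : Space × Space => fderiv ℝ u z (z.2, a z.1)) ∧
    ∫ z : Space × Space, fderiv ℝ u z (z.2, a z.1) = 0 := by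
  have hfd := hu.continuous_fderiv one_ne_zero
  have hcs : HasCompactSupport (fderiv ℝ u) := hc.fderiv (𝕜 := ℝ)
  have hcont1 : Continuous fun z : Space × Space => fderiv ℝ u z (z.2, 0) :=
    hfd.clm_apply (by fun_prop)
  have hcont2 : Continuous fun z : Space × Space => fderiv ℝ u z (0, a z.1) := by
    rw [continuous_iff_continuousAt]
    intro z
    rcases lt_or_ge ‖z.1‖ η with hz | hz
    · have hev : ∀ᶠ y : Space × Space in 𝓝 z, ‖y.1‖ < η :=
        (isOpen_lt (by fun_prop) (by fun_prop) : IsOpen {y : Space × Space | ‖y.1‖ < η}).mem_nhds hz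
      have : (fun z : Space × Space => fderiv ℝ u z (0, a z.1)) =ᶠ[𝓝 z] fun _ => 0 := by
        filter_upwards [hev.eventually_nhds] with y hy
        have h1 : u =ᶠ[𝓝 y] fun _ => 0 := by
          filter_upwards [hy] with w hw using h0 w.1 w.2 hw.le
        rw [h1.fderiv_eq]
        simp
      exact continuousAt_const.congr this.symm
    · have hne : z.1 ≠ 0 := norm_pos_iff.1 (hη.trans_le hz)
      have h1 : ContinuousAt a z.1 := ha.continuousAt (isOpen_compl_singleton.mem_nhds hne)
      have h2 : ContinuousAt (fun z : Space × Space => a z.1) z :=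
        ContinuousAt.comp (f := fun z : Space × Space => z.1) h1 continuousAt_fst
      exact hfd.continuousAt.clm_apply (continuousAt_const.prodMk h2)
  have hcs1 : HasCompactSupport fun z : Space × Space => fderiv ℝ u z (z.2, 0) :=
    hcs.mono' (fun z hz => subset_tsupport _ (by
      intro h; apply hz; simp [h]))
  have hcs2 : HasCompactSupport fun z : Space × Space => fderiv ℝ u z (0, a z.1) :=
    hcs.mono' (fun z hz => subset_tsupport _ (by
      intro h; apply hz; simp [h]))
  have i1 := hcont1.integrable_of_hasCompactSupport hcs1 (μ := volume)
  have i2 := hcont2.integrable_of_hasCompactSupport hcs2 (μ := volume)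
  have hsplit : ∀ z : Space × Space, fderiv ℝ u z (z.2, a z.1)
      = fderiv ℝ u z (z.2, 0) + fderiv ℝ u z (0, a z.1) := fun z => by
    rw [← map_add]; simp
  have hudiff := hu.differentiable one_ne_zero
  refine ⟨by simp only [hsplit]; exact i1.add i2, ?_⟩
  simp only [hsplit]
  rw [integral_add i1 i2]
  have e1 : ∫ z : Space × Space, fderiv ℝ u z (z.2, 0) = 0 := by
    rw [Measure.volume_eq_prod, integral_prod_symm _ i1]
    refine integral_eq_zero_of_ae (ae_of_all _ fun v => ?_)
    have hsl : ContDiff ℝ 1 fun x : Space => u (x, v) := hu.comp (by fun_prop)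
    have hslc : HasCompactSupport fun x : Space => u (x, v) :=
      HasCompactSupport.intro (hc.image continuous_fst) fun x hx => by
        by_contra hne
        exact hx ⟨(x, v), subset_tsupport _ hne, rfl⟩
    have := integral_fderiv_apply_eq_zero (μ := volume) hsl hslc v
    simp only [Pi.zero_apply]
    rw [← this]
    refine integral_congr_ae (ae_of_all _ fun x => ?_)
    have h2 : HasFDerivAt (fun x : Space => (x, v)) ((ContinuousLinearMap.id ℝ Space).prod 0) x :=
      (hasFDerivAt_id x).prodMk (hasFDerivAt_const v x)
    have h1 : HasFDerivAt (fun x : Space => u (x, v)) _ x := (hudiff (x, v)).hasFDerivAt.comp x h2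
    simp only [h1.fderiv]
    simp
  have e2 : ∫ z : Space × Space, fderiv ℝ u z (0, a z.1) = 0 := by
    rw [Measure.volume_eq_prod, integral_prod _ i2]
    refine integral_eq_zero_of_ae (ae_of_all _ fun x => ?_)
    have hsl : ContDiff ℝ 1 fun v : Space => u (x, v) := hu.comp (by fun_prop)
    have hslc : HasCompactSupport fun v : Space => u (x, v) :=
      HasCompactSupport.intro (hc.image continuous_snd) fun v hv => by
        by_contra hne
        exact hv ⟨(x, v), subset_tsupport _ hne, rfl⟩
    have := integral_fderiv_apply_eq_zero (μ := volume) hsl hslc (a x)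
    simp only [Pi.zero_apply]
    rw [← this]
    refine integral_congr_ae (ae_of_all _ fun v => ?_)
    have h2 : HasFDerivAt (fun v : Space => (x, v))
        ((0 : Space →L[ℝ] Space).prod (ContinuousLinearMap.id ℝ Space)) v :=
      (hasFDerivAt_const x v).prodMk (hasFDerivAt_id v)
    have h1 : HasFDerivAt (fun v : Space => u (x, v)) _ v := (hudiff (x, v)).hasFDerivAt.comp v h2
    simp only [h1.fderiv]
    simp
  rw [e1, e2, add_zero]

/-- The time derivative of `∬ h` is the integral of the derivative of `h` along the
transport field. -/
lemma Evolution.hasDerivAt_integral_transport {h : ℝ → Space × Space → ℝ} (hh : Evolution h)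
    {a : Space → Space} (ha : ContinuousOn a {0}ᶜ) {η : ℝ} (hη : 0 < η) {t : ℝ} (ht : 0 < t)
    (h0 : ∀ x v : Space, ‖x‖ ≤ η → h t (x, v) = 0) :
    Integrable (transportDeriv a h t) ∧
    HasDerivAt (fun t => ∫ z, h t z) (∫ z, transportDeriv a h t z) t := by
  obtain ⟨i1, d1⟩ := hh.hasDerivAt_integral ht
  obtain ⟨i2, e2⟩ := integral_fderiv_phase_eq_zero (hh.contDiff_slice ht.le)
    (hh.hasCompactSupport ht.le) ha hη h0
  have hsplit : ∀ z, transportDeriv a h t z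
      = fderiv ℝ (fun p : ℝ × (Space × Space) => h p.1 p.2) (t, z) (1, 0)
        + fderiv ℝ (h t) z (z.2, a z.1) := fun z => by
    rw [hh.fderiv_slice ht, transportDeriv, ← map_add]; simp
  have hfun : transportDeriv a h t = fun z =>
      fderiv ℝ (fun p : ℝ × (Space × Space) => h p.1 p.2) (t, z) (1, 0)
        + fderiv ℝ (h t) z (z.2, a z.1) := funext hsplit
  rw [hfun]
  refine ⟨i1.add i2, ?_⟩
  rw [integral_add i1 i2, e2, add_zero]
  exact d1

/-! ### An estimate for the Poisson equation -/

/-- The standard basis vectors of `ℝ³`. -/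
def stdVec (i : Fin 3) : Space := EuclideanSpace.single i 1

/-- The partial derivative `∂ᵢ W`. -/
def partialD (i : Fin 3) (W : Space → ℝ) (x : Space) : ℝ := fderiv ℝ W x (stdVec i)

lemma gradient_apply (W : Space → ℝ) (x : Space) (i : Fin 3) :
    (gradient W x) i = partialD i W x := by
  have h : inner ℝ (gradient W x) (stdVec i) = fderiv ℝ W x (stdVec i) := by
    rw [gradient, InnerProductSpace.toDual_symm_apply]
  rw [partialD, ← h, stdVec, EuclideanSpace.inner_single_right]
  simp

lemma norm_gradient_sq (W : Space → ℝ) (x : Space) :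
    ‖gradient W x‖ ^ 2 = ∑ i, partialD i W x ^ 2 := by
  rw [EuclideanSpace.norm_sq_eq]
  simp [gradient_apply]

lemma contDiff_partialD {W : Space → ℝ} (hW : ContDiff ℝ 2 W) (i : Fin 3) :
    ContDiff ℝ 1 (partialD i W) :=
  (hW.fderiv_right (m := 1) (by norm_num)).clm_apply contDiff_const

lemma continuous_partialD {u : Space → ℝ} (hu : ContDiff ℝ 1 u) (i : Fin 3) :
    Continuous (partialD i u) :=
  (hu.continuous_fderiv one_ne_zero).clm_apply continuous_const

lemma laplacian_eq_sum_partialD {W : Space → ℝ} (hW : ContDiff ℝ 2 W) (x : Space) :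
    Laplacian.laplacian W x = ∑ i, partialD i (partialD i W) x := by
  rw [InnerProductSpace.laplacian_eq_iteratedFDeriv_orthonormalBasis W
    (EuclideanSpace.basisFun (Fin 3) ℝ)]
  refine Finset.sum_congr rfl fun i _ => ?_
  rw [iteratedFDeriv_two_apply]
  have hd : DifferentiableAt ℝ (fderiv ℝ W) x :=
    (hW.fderiv_right (m := 1) (by norm_num)).differentiable one_ne_zero x
  have h1 : HasFDerivAt (partialD i W) _ x :=
    hd.hasFDerivAt.clm_apply (hasFDerivAt_const (stdVec i) x)
  rw [partialD, h1.fderiv]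
  simp [stdVec]

lemma partialD_mul {u w : Space → ℝ} (hu : ContDiff ℝ 1 u) (hw : ContDiff ℝ 1 w) (i : Fin 3)
    (x : Space) :
    partialD i (fun y => u y * w y) x = u x * partialD i w x + partialD i u x * w x := by
  have : HasFDerivAt (fun y => u y * w y) _ x :=
    (hu.differentiable one_ne_zero x).hasFDerivAt.mul (hw.differentiable one_ne_zero x).hasFDerivAt
  simp only [partialD]
  rw [this.fderiv]
  simp
  ring

lemma partialD_comp {φ φ' : ℝ → ℝ} (hφ : ∀ s, HasDerivAt φ (φ' s) s) {u : Space → ℝ}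
    (hu : ContDiff ℝ 1 u) (i : Fin 3) (x : Space) :
    partialD i (fun y => φ (u y)) x = φ' (u x) * partialD i u x := by
  have := (hφ (u x)).comp_hasFDerivAt x (hu.differentiable one_ne_zero x).hasFDerivAt
  simp only [partialD]
  have h2 : HasFDerivAt (fun y => φ (u y)) _ x := this
  rw [h2.fderiv]
  simp

/-- The divergence theorem for compactly supported vector fields. -/
lemma integral_div_eq_zero {Y : Fin 3 → Space → ℝ} (hY : ∀ i, ContDiff ℝ 1 (Y i))
    (hc : ∀ i, HasCompactSupport (Y i)) :
    Integrable (fun x => ∑ i, partialD i (Y i) x) ∧ ∫ x, ∑ i, partialD i (Y i) x = 0 := by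
  have hi : ∀ i, Integrable (partialD i (Y i)) := fun i =>
    (continuous_partialD (hY i) i).integrable_of_hasCompactSupport
      ((hc i).fderiv_apply (𝕜 := ℝ) (stdVec i))
  refine ⟨integrable_finsetSum _ fun i _ => hi i, ?_⟩
  rw [integral_finsetSum _ fun i _ => hi i]
  exact Finset.sum_eq_zero fun i _ => integral_fderiv_apply_eq_zero (hY i) (hc i) _

/-- A continuous truncation of the constant `1` which vanishes on `[-η, η]`. -/
def truncDeriv (η s : ℝ) : ℝ := 1 - η ^ 2 / max (s ^ 2) (η ^ 2)

/-- A continuously differentiable truncation of the identity which vanishes on `[-η, η]`. -/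
def trunc (η s : ℝ) : ℝ := ∫ τ in (0:ℝ)..s, truncDeriv η τ

section trunc

variable {η : ℝ}

lemma continuous_truncDeriv (hη : 0 < η) : Continuous (truncDeriv η) := by
  unfold truncDeriv
  refine continuous_const.sub (continuous_const.div (by fun_prop) fun s => ?_)
  have : 0 < max (s ^ 2) (η ^ 2) := lt_max_of_lt_right (by positivity)
  exact this.ne'

lemma truncDeriv_mem (hη : 0 < η) (s : ℝ) : 0 ≤ truncDeriv η s ∧ truncDeriv η s ≤ 1 := by
  unfold truncDeriv
  have h : 0 < max (s ^ 2) (η ^ 2) := lt_max_of_lt_right (by positivity)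
  constructor
  · rw [sub_nonneg, div_le_one h]
    exact le_max_right _ _
  · have : 0 ≤ η ^ 2 / max (s ^ 2) (η ^ 2) := by positivity
    linarith

lemma hasDerivAt_trunc (hη : 0 < η) (s : ℝ) : HasDerivAt (trunc η) (truncDeriv η s) s :=
  intervalIntegral.integral_hasDerivAt_right ((continuous_truncDeriv hη).intervalIntegrable _ _)
    ((continuous_truncDeriv hη).stronglyMeasurableAtFilter _ _) (continuous_truncDeriv hη).continuousAt

lemma contDiff_trunc (hη : 0 < η) : ContDiff ℝ 1 (trunc η) := by
  rw [contDiff_one_iff_deriv]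
  refine ⟨fun s => (hasDerivAt_trunc hη s).differentiableAt, ?_⟩
  have : deriv (trunc η) = truncDeriv η := funext fun s => (hasDerivAt_trunc hη s).deriv
  rw [this]
  exact continuous_truncDeriv hη

lemma trunc_eq_zero {s : ℝ} (hη : 0 < η) (hs : |s| ≤ η) : trunc η s = 0 := by
  have h : EqOn (truncDeriv η) (fun _ => 0) (uIcc 0 s) := by
    intro τ hτ
    have h1 : |τ| ≤ |s| := by
      rcases le_total 0 s with h0 | h0
      · rw [uIcc_of_le h0] at hτ
        rw [abs_of_nonneg hτ.1, abs_of_nonneg h0]; exact hτ.2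
      · rw [uIcc_of_ge h0] at hτ
        rw [abs_of_nonpos hτ.2, abs_of_nonpos h0]; linarith [hτ.1]
    have h2 : τ ^ 2 ≤ η ^ 2 := by
      rw [← sq_abs τ]
      have := h1.trans hs
      gcongr
    simp only [truncDeriv]
    rw [max_eq_right h2, div_self (by positivity), sub_self]
  rw [trunc, intervalIntegral.integral_congr h]
  simp

/-- Truncation changes the argument by at most `2 η`. -/
lemma abs_sub_trunc_le (hη : 0 < η) (s : ℝ) : |s - trunc η s| ≤ 2 * η := by
  have hpos : ∀ s, 0 ≤ s → |s - trunc η s| ≤ 2 * η := by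
    intro s hs
    rcases le_or_gt s η with h | h
    · rw [trunc_eq_zero hη (by rwa [abs_of_nonneg hs]), sub_zero, abs_of_nonneg hs]
      linarith
    · -- for `s ≥ η` the truncation is `s + η² / s - 2 η`
      have h1 : trunc η s = trunc η η + ∫ τ in η..s, truncDeriv η τ := by
        rw [trunc, trunc, intervalIntegral.integral_add_adjacent_intervals]
        · exact (continuous_truncDeriv hη).intervalIntegrable _ _
        · exact (continuous_truncDeriv hη).intervalIntegrable _ _
      have h2 : ∫ τ in η..s, truncDeriv η τ = (s + η ^ 2 / s) - (η + η ^ 2 / η) := by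
        refine intervalIntegral.integral_eq_sub_of_hasDerivAt (f := fun τ => τ + η ^ 2 / τ)
          (fun τ hτ => ?_) ((continuous_truncDeriv hη).intervalIntegrable _ _)
        rw [uIcc_of_le h.le] at hτ
        have hτ0 : 0 < τ := hη.trans_le hτ.1
        have h3 : truncDeriv η τ = 1 + (0 * τ - η ^ 2 * 1) / τ ^ 2 := by
          rw [truncDeriv, max_eq_left (by gcongr; exact hτ.1)]
          ring
        rw [h3]
        exact (hasDerivAt_id τ).add ((hasDerivAt_const τ (η ^ 2)).div (hasDerivAt_id τ) hτ0.ne')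
      rw [h1, trunc_eq_zero hη (by rw [abs_of_pos hη]), h2, zero_add]
      have h4 : η ^ 2 / η = η := by field_simp
      have h5 : 0 ≤ η ^ 2 / s := by positivity
      have h6 : η ^ 2 / s ≤ η := by
        rw [div_le_iff₀ (hη.trans h)]
        nlinarith
      rw [h4, abs_le]
      constructor <;> linarith
  have hodd : trunc η (-s) = -trunc η s := by
    have he : ∀ τ, truncDeriv η (-τ) = truncDeriv η τ := fun τ => by simp [truncDeriv]
    have h1 := intervalIntegral.integral_comp_neg (a := 0) (b := s) (truncDeriv η)
    simp only [he, neg_zero] at h1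
    rw [trunc, trunc, h1, intervalIntegral.integral_symm]
  rcases le_total 0 s with hs | hs
  · exact hpos s hs
  · have := hpos (-s) (by linarith)
    rw [hodd] at this
    rw [← abs_neg]
    convert this using 2
    ring

end trunc

/-- A Hardy inequality with a regular weight. -/
lemma integral_hardy {u : Space → ℝ} (hu : ContDiff ℝ 1 u) (hc : HasCompactSupport u) :
    Integrable (fun x => u x ^ 2 / (1 + ‖x‖ ^ 2)) ∧
    Integrable (fun x => ∑ i, partialD i u x ^ 2) ∧
    ∫ x, u x ^ 2 / (1 + ‖x‖ ^ 2) ≤ 4 * ∫ x, ∑ i, partialD i u x ^ 2 := by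
  have hden : ∀ x : Space, 1 + ‖x‖ ^ 2 ≠ 0 := fun x => by positivity
  -- the vector field `u² x / (1 + |x|²)`
  let b : Fin 3 → Space → ℝ := fun i x => x i / (1 + ‖x‖ ^ 2)
  have hcoord : ∀ i, ContDiff ℝ 1 fun x : Space => x i := fun i =>
    (EuclideanSpace.proj i : Space →L[ℝ] ℝ).contDiff
  have hinv : ContDiff ℝ 1 fun x : Space => (1 + ‖x‖ ^ 2)⁻¹ :=
    (contDiff_const.add (contDiff_norm_sq ℝ)).inv hden
  have hb : ∀ i, ContDiff ℝ 1 (b i) := fun i => by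
    simp only [b, div_eq_mul_inv]
    exact (hcoord i).mul hinv
  have hbd : ∀ i x, partialD i (b i) x
      = 1 / (1 + ‖x‖ ^ 2) - 2 * x i ^ 2 / (1 + ‖x‖ ^ 2) ^ 2 := by
    intro i x
    simp only [b, div_eq_mul_inv]
    rw [partialD_mul (hcoord i) hinv]
    have h1 : partialD i (fun y : Space => y i) x = 1 := by
      have : HasFDerivAt (fun y : Space => y i) (EuclideanSpace.proj i : Space →L[ℝ] ℝ) x :=
        (EuclideanSpace.proj i : Space →L[ℝ] ℝ).hasFDerivAt
      simp only [partialD]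
      rw [this.fderiv]
      simp [stdVec]
    have h2 : partialD i (fun y : Space => (1 + ‖y‖ ^ 2)⁻¹) x
        = -(2 * x i) / (1 + ‖x‖ ^ 2) ^ 2 := by
      have h3 : HasFDerivAt (fun y : Space => 1 + ‖y‖ ^ 2) (2 • innerSL ℝ x) x :=
        (hasStrictFDerivAt_norm_sq x).hasFDerivAt.const_add 1
      have h4 := (hasDerivAt_inv (hden x)).comp_hasFDerivAt x h3
      have h5 : HasFDerivAt (fun y : Space => (1 + ‖y‖ ^ 2)⁻¹) _ x := h4
      simp only [partialD]
      rw [h5.fderiv]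
      simp [stdVec, EuclideanSpace.inner_single_right]
      field_simp
    rw [h1, h2]
    field_simp
    ring
  have hY : ∀ i, ContDiff ℝ 1 fun x => (u x * u x) * b i x := fun i => (hu.mul hu).mul (hb i)
  have hYc : ∀ i, HasCompactSupport fun x => (u x * u x) * b i x := fun i =>
    (hc.mul_right (f' := u)).mul_right
  obtain ⟨idiv, ediv⟩ := integral_div_eq_zero hY hYc
  have i1 : Integrable (fun x => u x ^ 2 / (1 + ‖x‖ ^ 2)) := by
    refine Continuous.integrable_of_hasCompactSupport ((hu.continuous.pow 2).div (by fun_prop) hden) ?_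
    exact hc.mono' fun x hx => subset_tsupport _ (by intro h; apply hx; simp [h])
  have i2 : Integrable (fun x => ∑ i, partialD i u x ^ 2) := by
    refine integrable_finsetSum _ fun i _ => ?_
    refine Continuous.integrable_of_hasCompactSupport ((continuous_partialD hu i).pow 2) ?_
    exact (hc.fderiv_apply (𝕜 := ℝ) (stdVec i)).mono' fun x hx => subset_tsupport _ (by
      intro h; apply hx
      have : partialD i u x = 0 := h
      simp [this])
  refine ⟨i1, i2, ?_⟩
  have hpt : ∀ x, 1 / 2 * (u x ^ 2 / (1 + ‖x‖ ^ 2)) - 2 * ∑ i, partialD i u x ^ 2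
      ≤ ∑ i, partialD i (fun x => (u x * u x) * b i x) x := by
    intro x
    have hsum : ∀ i, partialD i (fun x => (u x * u x) * b i x) x
        = u x ^ 2 * (1 / (1 + ‖x‖ ^ 2) - 2 * x i ^ 2 / (1 + ‖x‖ ^ 2) ^ 2)
          + 2 * u x * partialD i u x * (x i / (1 + ‖x‖ ^ 2)) := by
      intro i
      rw [partialD_mul (hu.mul hu) (hb i), partialD_mul hu hu, hbd]
      ring
    have hn : ‖x‖ ^ 2 = x 0 ^ 2 + x 1 ^ 2 + x 2 ^ 2 := by
      rw [EuclideanSpace.norm_sq_eq, Fin.sum_univ_three]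
      simp
    have hterm : ∀ i, -(2 * partialD i u x ^ 2) - 1 / 2 * (u x ^ 2 * (x i ^ 2 / (1 + ‖x‖ ^ 2) ^ 2))
        ≤ 2 * u x * partialD i u x * (x i / (1 + ‖x‖ ^ 2)) := by
      intro i
      have h := sq_nonneg (2 * partialD i u x + u x * (x i / (1 + ‖x‖ ^ 2)))
      have e : u x ^ 2 * (x i ^ 2 / (1 + ‖x‖ ^ 2) ^ 2) = (u x * (x i / (1 + ‖x‖ ^ 2))) ^ 2 := by
        rw [mul_pow, div_pow]
      rw [e]
      nlinarith
    simp only [hsum, Fin.sum_univ_three]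
    have h0 := hterm 0
    have h1 := hterm 1
    have h2 := hterm 2
    set q := (1 + ‖x‖ ^ 2)⁻¹ with hq
    have hq0 : 0 < q := by positivity
    have hqn : q * ‖x‖ ^ 2 = 1 - q := by
      rw [hq]; field_simp; ring
    have e1 : (u x ^ 2 * (1 / (1 + ‖x‖ ^ 2) - 2 * x 0 ^ 2 / (1 + ‖x‖ ^ 2) ^ 2))
        + (u x ^ 2 * (1 / (1 + ‖x‖ ^ 2) - 2 * x 1 ^ 2 / (1 + ‖x‖ ^ 2) ^ 2))
        + (u x ^ 2 * (1 / (1 + ‖x‖ ^ 2) - 2 * x 2 ^ 2 / (1 + ‖x‖ ^ 2) ^ 2))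
        = u x ^ 2 * (q + 2 * q ^ 2) := by
      have : 3 * q - 2 * (q * ‖x‖ ^ 2) * q = q + 2 * q ^ 2 := by rw [hqn]; ring
      simp only [div_eq_mul_inv, ← inv_pow, ← hq]
      rw [← this, hn]
      ring
    have e2 : 1 / 2 * (u x ^ 2 * (x 0 ^ 2 / (1 + ‖x‖ ^ 2) ^ 2))
        + 1 / 2 * (u x ^ 2 * (x 1 ^ 2 / (1 + ‖x‖ ^ 2) ^ 2))
        + 1 / 2 * (u x ^ 2 * (x 2 ^ 2 / (1 + ‖x‖ ^ 2) ^ 2)) = 1 / 2 * (u x ^ 2 * (q - q ^ 2)) := by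
      have : (q * ‖x‖ ^ 2) * q = q - q ^ 2 := by rw [hqn]; ring
      simp only [div_eq_mul_inv, ← inv_pow, ← hq]
      rw [← this, hn]
      ring
    have e3 : u x ^ 2 / (1 + ‖x‖ ^ 2) = u x ^ 2 * q := by rw [hq]; rfl
    have e4 : 0 ≤ u x ^ 2 * q ^ 2 := by positivity
    rw [e3]
    nlinarith
  have hint := integral_mono ((i1.const_mul (1 / 2)).sub (i2.const_mul 2)) idiv hpt
  have h3 : ∫ x, (1 / 2 * (u x ^ 2 / (1 + ‖x‖ ^ 2)) - 2 * ∑ i, partialD i u x ^ 2)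
      = 1 / 2 * (∫ x, u x ^ 2 / (1 + ‖x‖ ^ 2)) - 2 * ∫ x, ∑ i, partialD i u x ^ 2 := by
    rw [integral_sub (i1.const_mul _) (i2.const_mul _), integral_const_mul, integral_const_mul]
  rw [ediv] at hint
  have h4 := h3.symm.trans_le hint
  linarith

/-- A decaying solution of `ΔW = σ` is controlled in a weighted `L²`-norm by a source supported
in a ball. The truncation of `W` at height `η` has compact support and is an admissible test
function. -/
lemma integral_trunc_sq_le {W σ : Space → ℝ} (hW : ContDiff ℝ 2 W)
    (hlim : Tendsto W (cocompact Space) (𝓝 0)) (hσ : Continuous σ)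
    (hΔ : ∀ x, Laplacian.laplacian W x = σ x) {R : ℝ} (hR : ∀ x, R ≤ ‖x‖ → σ x = 0)
    {η : ℝ} (hη : 0 < η) :
    Integrable (fun x => trunc η (W x) ^ 2 / (1 + ‖x‖ ^ 2)) ∧
    ∫ x, trunc η (W x) ^ 2 / (1 + ‖x‖ ^ 2) ≤ 16 * (1 + R ^ 2) * ∫ x, σ x ^ 2 := by
  have hW1 : ContDiff ℝ 1 W := hW.of_le (by norm_num)
  set u : Space → ℝ := fun x => trunc η (W x) with hu_def
  have hu : ContDiff ℝ 1 u := (contDiff_trunc hη).comp hW1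
  have huc : HasCompactSupport u := by
    have hev : ∀ᶠ x in cocompact Space, |W x| ≤ η := by
      have := hlim.abs
      rw [abs_zero] at this
      exact this.eventually_le_const hη
    obtain ⟨K, hK, hKs⟩ := mem_cocompact.1 hev
    exact HasCompactSupport.intro hK fun x hx => trunc_eq_zero hη (hKs hx)
  have hσc : HasCompactSupport σ := HasCompactSupport.intro (isCompact_closedBall (0 : Space) R)
    fun x hx => hR x (by simpa using le_of_lt (by simpa using hx))
  obtain ⟨i1, i2, hhardy⟩ := integral_hardy hu huc
  obtain ⟨i3, e3⟩ := integral_div_eq_zero (Y := fun i x => u x * partialD i W x)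
    (fun i => hu.mul (contDiff_partialD hW i)) (fun i => huc.mul_right)
  have i4 : Integrable fun x => u x * σ x :=
    (hu.continuous.mul hσ).integrable_of_hasCompactSupport huc.mul_right
  have i5 : Integrable fun x => σ x ^ 2 := by
    refine (hσ.pow 2).integrable_of_hasCompactSupport ?_
    exact hσc.mono' fun x hx => subset_tsupport _ (by intro h; apply hx; simp [h])
  have hpt : ∀ x, ∑ i, partialD i u x ^ 2
      ≤ (∑ i, partialD i (fun x => u x * partialD i W x) x) - u x * σ x := by
    intro x
    have h1 : ∀ i, partialD i (fun x => u x * partialD i W x) x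
        = u x * partialD i (partialD i W) x + truncDeriv η (W x) * partialD i W x ^ 2 := by
      intro i
      rw [partialD_mul hu (contDiff_partialD hW i),
        partialD_comp (hasDerivAt_trunc hη) hW1]
      ring
    have h2 : ∀ i, partialD i u x ^ 2 = truncDeriv η (W x) ^ 2 * partialD i W x ^ 2 := by
      intro i
      rw [hu_def, partialD_comp (hasDerivAt_trunc hη) hW1]
      ring
    simp only [h1, h2]
    rw [Finset.sum_add_distrib, ← Finset.mul_sum, ← Finset.mul_sum, ← Finset.mul_sum,
      ← laplacian_eq_sum_partialD hW, hΔ]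
    have h3 := truncDeriv_mem hη (W x)
    have h4 : 0 ≤ ∑ i, partialD i W x ^ 2 := by positivity
    nlinarith [mul_nonneg h3.1 (sub_nonneg.2 h3.2)]
  have hpt2 : ∀ x, -(u x * σ x) ≤ 1 / 8 * (u x ^ 2 / (1 + ‖x‖ ^ 2)) + 2 * (1 + R ^ 2) * σ x ^ 2 := by
    intro x
    have hq : 0 < 1 + ‖x‖ ^ 2 := by positivity
    rcases le_or_gt R ‖x‖ with h | h
    · rw [hR x h]
      have : 0 ≤ u x ^ 2 / (1 + ‖x‖ ^ 2) := by positivity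
      simp
      positivity
    · have h1 : ‖x‖ ^ 2 ≤ R ^ 2 := by gcongr
      have h2 : 2 * (1 + ‖x‖ ^ 2) * σ x ^ 2 ≤ 2 * (1 + R ^ 2) * σ x ^ 2 := by gcongr
      refine le_trans ?_ (add_le_add_right h2 _)
      have h3 : 1 / 8 * (u x ^ 2 / (1 + ‖x‖ ^ 2)) + 2 * (1 + ‖x‖ ^ 2) * σ x ^ 2 - -(u x * σ x)
          = (u x + 4 * (1 + ‖x‖ ^ 2) * σ x) ^ 2 / (8 * (1 + ‖x‖ ^ 2)) := by
        field_simp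
        ring
      have h4 : 0 ≤ (u x + 4 * (1 + ‖x‖ ^ 2) * σ x) ^ 2 / (8 * (1 + ‖x‖ ^ 2)) := by positivity
      linarith
  have h1 : ∫ x, ∑ i, partialD i u x ^ 2 ≤ -∫ x, u x * σ x := by
    have := integral_mono i2 (i3.sub i4) hpt
    have h2 : ∫ x, ((∑ i, partialD i (fun x => u x * partialD i W x) x) - u x * σ x)
        = (∫ x, ∑ i, partialD i (fun x => u x * partialD i W x) x) - ∫ x, u x * σ x :=
      integral_sub i3 i4
    have h3 := this.trans_eq h2
    rw [e3] at h3
    linarith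
  have h2 : -∫ x, u x * σ x ≤ 1 / 8 * (∫ x, u x ^ 2 / (1 + ‖x‖ ^ 2))
      + 2 * (1 + R ^ 2) * ∫ x, σ x ^ 2 := by
    rw [← integral_neg, ← integral_const_mul, ← integral_const_mul,
      ← integral_add (i1.const_mul _) (i5.const_mul _)]
    exact integral_mono i4.neg ((i1.const_mul _).add (i5.const_mul _)) hpt2
  refine ⟨i1, ?_⟩
  linarith

lemma integral_sq_closedBall_le {W σ : Space → ℝ} (hW : ContDiff ℝ 2 W)
    (hlim : Tendsto W (cocompact Space) (𝓝 0)) (hσ : Continuous σ)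
    (hΔ : ∀ x, Laplacian.laplacian W x = σ x) {R : ℝ} (hR : ∀ x, R ≤ ‖x‖ → σ x = 0) (r : ℝ) :
    ∫ x in Metric.closedBall 0 r, W x ^ 2
      ≤ 32 * (1 + r ^ 2) * (1 + R ^ 2) * ∫ x, σ x ^ 2 := by
  set B := Metric.closedBall (0 : Space) r with hB
  have hBm : MeasurableSet B := measurableSet_closedBall
  have hBf : volume B ≠ ∞ := (isCompact_closedBall (0 : Space) r).measure_lt_top.ne
  have hWi : IntegrableOn (fun x => W x ^ 2) B :=
    (hW.continuous.pow 2).continuousOn.integrableOn_compact (isCompact_closedBall _ _)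
  have key : ∀ η : ℝ, 0 < η → ∫ x in B, W x ^ 2
      ≤ 32 * (1 + r ^ 2) * (1 + R ^ 2) * (∫ x, σ x ^ 2) + 8 * η ^ 2 * (volume B).toReal := by
    intro η hη
    obtain ⟨i1, h1⟩ := integral_trunc_sq_le hW hlim hσ hΔ hR hη
    have hpt : ∀ x ∈ B, W x ^ 2
        ≤ 2 * (1 + r ^ 2) * (trunc η (W x) ^ 2 / (1 + ‖x‖ ^ 2)) + 8 * η ^ 2 := by
      intro x hx
      have hxr : ‖x‖ ≤ r := by simpa [hB] using hx
      have h2 := abs_sub_trunc_le hη (W x)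
      have h3 : (W x - trunc η (W x)) ^ 2 ≤ (2 * η) ^ 2 := by
        rw [← sq_abs]; gcongr
      have h4 : trunc η (W x) ^ 2 ≤ (1 + r ^ 2) * (trunc η (W x) ^ 2 / (1 + ‖x‖ ^ 2)) := by
        rw [mul_div_assoc', le_div_iff₀ (by positivity), mul_comm]
        gcongr
      nlinarith [sq_nonneg (W x - 2 * trunc η (W x))]
    have ic : IntegrableOn (fun _ : Space => 8 * η ^ 2) B := integrableOn_const hBf
    have h2 := setIntegral_mono_on hWi
      ((i1.integrableOn.const_mul (2 * (1 + r ^ 2))).add ic) hBm hpt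
    have h3 : ∫ x in B, (2 * (1 + r ^ 2) * (trunc η (W x) ^ 2 / (1 + ‖x‖ ^ 2)) + 8 * η ^ 2)
        = 2 * (1 + r ^ 2) * (∫ x in B, trunc η (W x) ^ 2 / (1 + ‖x‖ ^ 2))
          + (volume B).toReal * (8 * η ^ 2) := by
      rw [integral_add (i1.integrableOn.const_mul _) ic, integral_const_mul, setIntegral_const,
        Measure.real, smul_eq_mul]
    have h4 : ∫ x in B, trunc η (W x) ^ 2 / (1 + ‖x‖ ^ 2)
        ≤ ∫ x, trunc η (W x) ^ 2 / (1 + ‖x‖ ^ 2) :=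
      setIntegral_le_integral i1 (ae_of_all _ fun x => by positivity)
    have h5 := h2.trans_eq h3
    have h6 : 2 * (1 + r ^ 2) * (∫ x in B, trunc η (W x) ^ 2 / (1 + ‖x‖ ^ 2))
        ≤ 2 * (1 + r ^ 2) * (16 * (1 + R ^ 2) * ∫ x, σ x ^ 2) := by
      gcongr
      exact h4.trans h1
    linarith
  have hcont : Tendsto (fun η : ℝ => 32 * (1 + r ^ 2) * (1 + R ^ 2) * (∫ x, σ x ^ 2)
      + 8 * η ^ 2 * (volume B).toReal) (𝓝[>] 0)
      (𝓝 (32 * (1 + r ^ 2) * (1 + R ^ 2) * ∫ x, σ x ^ 2)) := by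
    have : Continuous fun η : ℝ => 32 * (1 + r ^ 2) * (1 + R ^ 2) * (∫ x, σ x ^ 2)
      + 8 * η ^ 2 * (volume B).toReal := by fun_prop
    have h := this.tendsto 0
    simp only [ne_eq, OfNat.ofNat_ne_zero, not_false_eq_true, zero_pow, mul_zero, zero_mul,
      add_zero] at h
    exact h.mono_left nhdsWithin_le_nhds
  exact ge_of_tendsto hcont (by filter_upwards [self_mem_nhdsWithin] with η hη using key η hη)

/-- The gradient of a decaying solution of `ΔW = σ` is locally bounded in `L²` by its source
(a Caccioppoli inequality). -/
lemma exists_gradient_bound {R : ℝ} (hR0 : 0 < R) : ∃ C : ℝ, 0 ≤ C ∧ ∀ W σ : Space → ℝ,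
    ContDiff ℝ 2 W → Tendsto W (cocompact Space) (𝓝 0) → Continuous σ →
    (∀ x, Laplacian.laplacian W x = σ x) → (∀ x, R ≤ ‖x‖ → σ x = 0) →
    ∫ x in Metric.closedBall 0 R, ‖gradient W x‖ ^ 2 ≤ C * ∫ x, σ x ^ 2 := by
  let χ : ContDiffBump (0 : Space) := ⟨R, R + 1, hR0, by linarith⟩
  have hχ : ContDiff ℝ 1 χ := χ.contDiff
  have hχc : HasCompactSupport χ := χ.hasCompactSupport
  have hK : ∃ K : ℝ, ∀ i x, |partialD i χ x| ≤ K := by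
    have h : ∀ i, ∃ K : ℝ, ∀ x, ‖partialD i χ x‖ ≤ K := fun i =>
      (hχc.fderiv_apply (𝕜 := ℝ) (stdVec i)).exists_bound_of_continuous
        (continuous_partialD hχ i)
    choose K hK using h
    refine ⟨max (max (K 0) (K 1)) (K 2), fun i x => (hK i x).trans ?_⟩
    fin_cases i <;> simp
  obtain ⟨K, hK⟩ := hK
  have hχ0 : ∀ x, x ∉ Metric.closedBall (0 : Space) (R + 1) → χ x = 0 := fun x hx =>
    χ.zero_of_le_dist (by
      show R + 1 ≤ dist x 0
      have : R + 1 < dist x 0 := by simpa using hx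
      exact this.le)
  refine ⟨(1 + 12 * K ^ 2) * (32 * (1 + (R + 1) ^ 2) * (1 + R ^ 2)) + 1, by positivity, ?_⟩
  intro W σ hW hlim hσ hΔ hσ0
  have hW1 : ContDiff ℝ 1 W := hW.of_le (by norm_num)
  have hWb := integral_sq_closedBall_le hW hlim hσ hΔ hσ0 (R + 1)
  set B := Metric.closedBall (0 : Space) (R + 1) with hB
  have hWi : IntegrableOn (fun x => W x ^ 2) B :=
    (hW.continuous.pow 2).continuousOn.integrableOn_compact (isCompact_closedBall _ _)
  have i5 : Integrable fun x => σ x ^ 2 := by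
    refine (hσ.pow 2).integrable_of_hasCompactSupport
      (HasCompactSupport.intro (isCompact_closedBall (0 : Space) R) fun x hx => ?_)
    show σ x ^ 2 = 0
    rw [hσ0 x (by simpa using le_of_lt (by simpa using hx))]
    simp
  have hYc : ∀ i, ContDiff ℝ 1 fun x => (χ x * χ x) * (W x * partialD i W x) := fun i =>
    (hχ.mul hχ).mul (hW1.mul (contDiff_partialD hW i))
  obtain ⟨i3, e3⟩ := integral_div_eq_zero hYc (fun i => (hχc.mul_right (f' := χ)).mul_right)
  have hgc : Continuous fun x => χ x ^ 2 * ∑ i, partialD i W x ^ 2 :=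
    (hχ.continuous.pow 2).mul (continuous_finsetSum _ fun i _ =>
      (continuous_partialD hW1 i).pow 2)
  have i6 : Integrable fun x => χ x ^ 2 * ∑ i, partialD i W x ^ 2 :=
    hgc.integrable_of_hasCompactSupport
      (HasCompactSupport.intro (isCompact_closedBall (0 : Space) (R + 1)) fun x hx => by
        rw [hχ0 x hx]; simp)
  have i7 : Integrable (B.indicator fun x => W x ^ 2) :=
    (integrable_indicator_iff measurableSet_closedBall).2 hWi
  have hpt : ∀ x, 1 / 2 * (χ x ^ 2 * ∑ i, partialD i W x ^ 2)
      ≤ (∑ i, partialD i (fun x => (χ x * χ x) * (W x * partialD i W x)) x)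
        + ((1 / 2 + 6 * K ^ 2) * B.indicator (fun x => W x ^ 2) x + 1 / 2 * σ x ^ 2) := by
    intro x
    have h1 : ∀ i, partialD i (fun x => (χ x * χ x) * (W x * partialD i W x)) x
        = χ x ^ 2 * W x * partialD i (partialD i W) x + (χ x ^ 2 * partialD i W x ^ 2
          + 2 * χ x * W x * partialD i χ x * partialD i W x) := by
      intro i
      rw [partialD_mul (hχ.mul hχ) (hW1.mul (contDiff_partialD hW i)), partialD_mul hχ hχ,
        partialD_mul hW1 (contDiff_partialD hW i)]
      ring
    simp only [h1]
    rw [Finset.sum_add_distrib, ← Finset.mul_sum, ← laplacian_eq_sum_partialD hW, hΔ]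
    by_cases hx : x ∈ B
    · rw [indicator_of_mem hx]
      have h2 : ∀ i, 1 / 2 * (χ x ^ 2 * partialD i W x ^ 2) - 2 * K ^ 2 * W x ^ 2
          ≤ χ x ^ 2 * partialD i W x ^ 2 + 2 * χ x * W x * partialD i χ x * partialD i W x := by
        intro i
        have h3 : partialD i χ x ^ 2 ≤ K ^ 2 := by
          rw [← sq_abs]; gcongr; exact hK i x
        have h4 : W x ^ 2 * partialD i χ x ^ 2 ≤ W x ^ 2 * K ^ 2 := by gcongr
        nlinarith [sq_nonneg (χ x * partialD i W x + 2 * (W x * partialD i χ x))]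
      have h5 : |χ x ^ 2 * W x * σ x| ≤ 1 / 2 * W x ^ 2 + 1 / 2 * σ x ^ 2 := by
        rw [mul_assoc, abs_mul]
        have h6 : |χ x ^ 2| ≤ 1 := by
          rw [abs_of_nonneg (by positivity)]
          exact pow_le_one₀ χ.nonneg χ.le_one
        have h7 : |W x * σ x| ≤ 1 / 2 * W x ^ 2 + 1 / 2 * σ x ^ 2 := by
          rw [abs_le]
          constructor <;> nlinarith [sq_nonneg (W x + σ x), sq_nonneg (W x - σ x)]
        calc _ ≤ 1 * |W x * σ x| := by gcongr
          _ ≤ _ := by rwa [one_mul]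
      have h6 := neg_le_of_abs_le h5
      simp only [Fin.sum_univ_three]
      have := h2 0
      have := h2 1
      have := h2 2
      linarith
    · rw [indicator_of_notMem hx, hχ0 x hx]
      simp
      positivity
  have hint := integral_mono (i6.const_mul (1 / 2))
    (i3.add ((i7.const_mul (1 / 2 + 6 * K ^ 2)).add (i5.const_mul (1 / 2)))) hpt
  have e4 : ∫ x, ((∑ i, partialD i (fun x => (χ x * χ x) * (W x * partialD i W x)) x)
        + ((1 / 2 + 6 * K ^ 2) * B.indicator (fun x => W x ^ 2) x + 1 / 2 * σ x ^ 2))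
      = 0 + ((1 / 2 + 6 * K ^ 2) * (∫ x in B, W x ^ 2) + 1 / 2 * ∫ x, σ x ^ 2) := by
    rw [integral_add i3 ((i7.const_mul _).fun_add (i5.const_mul _)), e3,
      integral_add (i7.const_mul _) (i5.const_mul _), integral_const_mul, integral_const_mul,
      integral_indicator measurableSet_closedBall]
  have h5 := hint.trans_eq e4
  rw [integral_const_mul] at h5
  have h6 : ∫ x in Metric.closedBall 0 R, ‖gradient W x‖ ^ 2
      ≤ ∫ x, χ x ^ 2 * ∑ i, partialD i W x ^ 2 := by
    have h7 : ∀ x ∈ Metric.closedBall (0 : Space) R,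
        ‖gradient W x‖ ^ 2 = χ x ^ 2 * ∑ i, partialD i W x ^ 2 := by
      intro x hx
      rw [norm_gradient_sq, χ.one_of_mem_closedBall hx]
      simp
    rw [setIntegral_congr_fun measurableSet_closedBall h7]
    exact setIntegral_le_integral i6 (ae_of_all _ fun x => by positivity)
  have h8 : (1 / 2 + 6 * K ^ 2) * (∫ x in B, W x ^ 2)
      ≤ (1 / 2 + 6 * K ^ 2) * (32 * (1 + (R + 1) ^ 2) * (1 + R ^ 2) * ∫ x, σ x ^ 2) := by gcongr
  linarith

/-! ### Transport derivatives and cut-offs near the origin -/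

namespace Evolution

variable {h g : ℝ → Space × Space → ℝ} {t : ℝ} {z : Space × Space} {a : Space → Space}

lemma sub (hh : Evolution h) (hg : Evolution g) : Evolution fun t z => h t z - g t z := by
  refine ⟨hh.contDiff.sub hg.contDiff, fun T => ?_⟩
  obtain ⟨R, hR⟩ := hh.support T
  obtain ⟨R', hR'⟩ := hg.support T
  refine ⟨max R R', fun t ht x v hxv => ?_⟩
  rw [hR t ht x v (hxv.imp (le_max_left _ _).trans (le_max_left _ _).trans),
    hR' t ht x v (hxv.imp (le_max_right _ _).trans (le_max_right _ _).trans), sub_zero]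

lemma mul_static (hh : Evolution h) {φ : Space × Space → ℝ} (hφ : ContDiff ℝ 1 φ) :
    Evolution fun t z => h t z * φ z := by
  refine ⟨hh.contDiff.mul (hφ.comp (g := φ) (f := fun p : ℝ × (Space × Space) => p.2)
    contDiff_snd).contDiffOn, fun T => ?_⟩
  obtain ⟨R, hR⟩ := hh.support T
  exact ⟨R, fun t ht x v hxv => by rw [hR t ht x v hxv, zero_mul]⟩

lemma comp_left (hh : Evolution h) {G : ℝ → ℝ} (hG : ContDiff ℝ 1 G) (hG0 : G 0 = 0) :
    Evolution fun t z => G (h t z) := by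
  refine ⟨hG.comp_contDiffOn hh.contDiff, fun T => ?_⟩
  obtain ⟨R, hR⟩ := hh.support T
  exact ⟨R, fun t ht x v hxv => by rw [hR t ht x v hxv, hG0]⟩

lemma transportDeriv_sub (hh : Evolution h) (hg : Evolution g) (ht : 0 < t) :
    transportDeriv a (fun t z => h t z - g t z) t z
      = transportDeriv a h t z - transportDeriv a g t z := by
  have h1 : HasFDerivAt (fun p : ℝ × (Space × Space) => h p.1 p.2 - g p.1 p.2) _ (t, z) :=
    (hh.hasFDerivAt ht z).sub (hg.hasFDerivAt ht z)
  rw [transportDeriv, h1.fderiv]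
  rfl

lemma transportDeriv_mul_static (hh : Evolution h) (ht : 0 < t) {φ : Space × Space → ℝ}
    (hφ : DifferentiableAt ℝ φ z) :
    transportDeriv a (fun t z => h t z * φ z) t z
      = transportDeriv a h t z * φ z + h t z * fderiv ℝ φ z (z.2, a z.1) := by
  have h2 : HasFDerivAt (fun p : ℝ × (Space × Space) => φ p.2)
      ((fderiv ℝ φ z).comp (ContinuousLinearMap.snd ℝ ℝ (Space × Space))) (t, z) :=
    HasFDerivAt.comp (g := φ) (f := fun p : ℝ × (Space × Space) => p.2) (t, z)
      hφ.hasFDerivAt hasFDerivAt_snd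
  have h1 : HasFDerivAt (fun p : ℝ × (Space × Space) => h p.1 p.2 * φ p.2) _ (t, z) :=
    (hh.hasFDerivAt ht z).mul h2
  rw [transportDeriv, h1.fderiv]
  simp [transportDeriv]
  ring

lemma transportDeriv_comp_left (hh : Evolution h) (ht : 0 < t) {G : ℝ → ℝ}
    (hG : ContDiff ℝ 1 G) :
    transportDeriv a (fun t z => G (h t z)) t z = deriv G (h t z) * transportDeriv a h t z := by
  have h2 : HasDerivAt G (deriv G (h t z)) (h t z) :=
    (hG.differentiable one_ne_zero _).hasDerivAt
  have h1 : HasFDerivAt (fun p : ℝ × (Space × Space) => G (h p.1 p.2)) _ (t, z) :=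
    HasDerivAt.comp_hasFDerivAt (t, z) (h₂ := G) (f := fun p : ℝ × (Space × Space) => h p.1 p.2)
      h2 (hh.hasFDerivAt ht z)
  rw [transportDeriv, h1.fderiv]
  simp [transportDeriv]

/-- Dependence of the transport derivative on the acceleration field. -/
lemma transportDeriv_sub_field (hh : Evolution h) (ht : 0 < t) (b : Space → Space) :
    transportDeriv a h t z = transportDeriv b h t z
      + fderiv ℝ (h t) z (0, a z.1 - b z.1) := by
  rw [hh.fderiv_slice ht, transportDeriv, transportDeriv, ← map_add]
  simp

end Evolution

/-- A smooth function which vanishes for `|x| ≤ η` and equals `1` for `|x| ≥ 2 η`. -/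
def cutoff (η : ℝ) (x : Space) : ℝ := Real.smoothTransition (‖η⁻¹ • x‖ ^ 2 - 1)

lemma contDiff_cutoff (η : ℝ) : ContDiff ℝ 1 (cutoff η) :=
  Real.smoothTransition.contDiff.comp
    (((contDiff_norm_sq ℝ).comp (contDiff_const_smul _)).sub contDiff_const)

lemma cutoff_nonneg (η : ℝ) (x : Space) : 0 ≤ cutoff η x := Real.smoothTransition.nonneg _

lemma cutoff_le_one (η : ℝ) (x : Space) : cutoff η x ≤ 1 := Real.smoothTransition.le_one _

lemma cutoff_eq_zero {η : ℝ} (hη : 0 < η) {x : Space} (hx : ‖x‖ ≤ η) : cutoff η x = 0 := by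
  refine Real.smoothTransition.zero_of_nonpos ?_
  rw [norm_smul, norm_inv, Real.norm_of_nonneg hη.le, sub_nonpos]
  refine pow_le_one₀ (by positivity) ?_
  rwa [inv_mul_le_iff₀ hη, mul_one]

lemma cutoff_eq_one {η : ℝ} (hη : 0 < η) {x : Space} (hx : 3 / 2 * η ≤ ‖x‖) : cutoff η x = 1 := by
  refine Real.smoothTransition.one_of_one_le ?_
  rw [norm_smul, norm_inv, Real.norm_of_nonneg hη.le]
  have : 3 / 2 ≤ η⁻¹ * ‖x‖ := by rwa [le_inv_mul_iff₀ hη, mul_comm]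
  nlinarith

lemma exists_cutoff_bound : ∃ K : ℝ, 0 ≤ K ∧ ∀ η : ℝ, 0 < η → ∀ x : Space,
    ‖fderiv ℝ (cutoff η) x‖ ≤ K / η ∧ (2 * η ≤ ‖x‖ → fderiv ℝ (cutoff η) x = 0) := by
  have hzero : ∀ η : ℝ, 0 < η → ∀ x : Space, 2 * η ≤ ‖x‖ → fderiv ℝ (cutoff η) x = 0 := by
    intro η hη x hx
    have hmem : {y : Space | 3 / 2 * η < ‖y‖} ∈ 𝓝 x :=
      (isOpen_lt continuous_const continuous_norm).mem_nhds
        (lt_of_lt_of_le (by linarith) hx)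
    have : cutoff η =ᶠ[𝓝 x] fun _ => 1 := by
      filter_upwards [hmem] with y hy using cutoff_eq_one hη (le_of_lt hy)
    rw [this.fderiv_eq]
    simp
  have hc : HasCompactSupport (fderiv ℝ (cutoff 1)) :=
    HasCompactSupport.intro (isCompact_closedBall (0 : Space) 2) fun x hx =>
      hzero 1 one_pos x (by
        have : 2 < ‖x‖ := by simpa using hx
        linarith)
  obtain ⟨K, hK⟩ := hc.exists_bound_of_continuous ((contDiff_cutoff 1).continuous_fderiv one_ne_zero)
  refine ⟨K, (norm_nonneg _).trans (hK 0), fun η hη x => ⟨?_, hzero η hη x⟩⟩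
  have hscale : cutoff η = fun x => cutoff 1 (η⁻¹ • x) := by
    funext x; simp [cutoff]
  have h1 : HasFDerivAt (fun x : Space => cutoff 1 (η⁻¹ • x))
      ((fderiv ℝ (cutoff 1) (η⁻¹ • x)).comp (η⁻¹ • ContinuousLinearMap.id ℝ Space)) x :=
    HasFDerivAt.comp (g := cutoff 1) (f := fun x : Space => η⁻¹ • x) x
      ((contDiff_cutoff 1).differentiable one_ne_zero _).hasFDerivAt
      ((hasFDerivAt_id x).const_smul η⁻¹)
  rw [hscale, h1.fderiv, ContinuousLinearMap.comp_smul, ContinuousLinearMap.comp_id, norm_smul,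
    norm_inv, Real.norm_of_nonneg hη.le, div_eq_inv_mul]
  gcongr
  exact hK _

lemma volume_ball_prod_le {r R : ℝ} (hr : 0 ≤ r) :
    (volume (Metric.closedBall (0 : Space) r ×ˢ Metric.closedBall (0 : Space) R)).toReal
      = r ^ 3 * ((volume (Metric.ball (0 : Space) 1)).toReal
        * (volume (Metric.closedBall (0 : Space) R)).toReal) := by
  rw [Measure.volume_eq_prod, Measure.prod_prod, ENNReal.toReal_mul,
    Measure.addHaar_closedBall volume (0 : Space) hr, ENNReal.toReal_mul,
    ENNReal.toReal_ofReal (by positivity)]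
  simp
  ring

/-- A nonnegative quantity which vanishes initially, and whose transport derivative away from
the origin is controlled by its integral, vanishes identically. The singular set `x = 0` is
removed by cut-offs, whose contribution to the time derivative is `O(η²)`. -/
lemma Evolution.eq_zero_of_transportDeriv_le {h : ℝ → Space × Space → ℝ} (hh : Evolution h)
    (hnonneg : ∀ t, 0 ≤ t → ∀ z, 0 ≤ h t z) (hinit : ∀ z, h 0 z = 0)
    {a : ℝ → Space → Space} (ha : ∀ t, 0 < t → ContinuousOn (a t) {0}ᶜ) {T C : ℝ}
    (hC : 0 ≤ C)
    (hle : ∀ t ∈ Ioo 0 T, ∀ η : ℝ, 0 < η →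
      ∫ z, transportDeriv (a t) h t z * cutoff η z.1 ≤ C * ∫ z, h t z) :
    ∀ t ∈ Icc 0 T, ∀ z, h t z = 0 := by
  obtain ⟨R, C₁, hR, hC₁, h0, -, -, hb⟩ := hh.exists_bound T
  obtain ⟨K, hK, hKb⟩ := exists_cutoff_bound
  set V := (volume (Metric.ball (0 : Space) 1)).toReal
        * (volume (Metric.closedBall (0 : Space) R)).toReal with hV
  have hV0 : 0 ≤ V := by positivity
  set S : ℝ → Set (Space × Space) := fun η =>
    Metric.closedBall (0 : Space) (2 * η) ×ˢ Metric.closedBall (0 : Space) R with hS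
  have hSm : ∀ η, MeasurableSet (S η) := fun η =>
    measurableSet_closedBall.prod measurableSet_closedBall
  have hSv : ∀ η, volume (S η) < ∞ := fun η =>
    ((isCompact_closedBall _ _).prod (isCompact_closedBall _ _)).measure_lt_top
  have hSvol : ∀ η, 0 < η → ∀ c : ℝ, ∫ z, (S η).indicator (fun _ => c) z = 8 * η ^ 3 * V * c := by
    intro η hη c
    rw [integral_indicator (hSm η), setIntegral_const, Measure.real, smul_eq_mul,
      volume_ball_prod_le (by positivity)]
    ring
  have hSi : ∀ η, ∀ c : ℝ, Integrable ((S η).indicator fun _ => c) := fun η c =>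
    (integrable_indicator_iff (hSm η)).2 (integrableOn_const (hSv η).ne)
  -- the phase space point `z = (x, v)` contributes to cut-off errors only if `|x| ≤ 2 η`
  have hφ : ∀ η, ContDiff ℝ 1 fun z : Space × Space => cutoff η z.1 := fun η =>
    (contDiff_cutoff η).comp contDiff_fst
  have hφd : ∀ η (z w : Space × Space), fderiv ℝ (fun z : Space × Space => cutoff η z.1) z w
      = fderiv ℝ (cutoff η) z.1 w.1 := by
    intro η z w
    have h1 : HasFDerivAt (fun z : Space × Space => cutoff η z.1) _ z :=
      HasFDerivAt.comp (g := cutoff η) (f := fun z : Space × Space => z.1) z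
        ((contDiff_cutoff η).differentiable one_ne_zero _).hasFDerivAt hasFDerivAt_fst
    rw [h1.fderiv]
    rfl
  set y : ℝ → ℝ → ℝ := fun η t => ∫ z, h t z * cutoff η z.1 with hy
  have hev : ∀ η, Evolution fun t z => h t z * cutoff η z.1 := fun η => hh.mul_static (hφ η)
  -- the cut-off changes the integral by `O(η³)`
  have hdiff : ∀ η, 0 < η → ∀ t ∈ Icc 0 T, ∫ z, h t z ≤ y η t + 8 * η ^ 3 * V * C₁ := by
    intro η hη t ht
    rw [hy, ← hSvol η hη, ← integral_add ((hev η).integrable ht.1) (hSi η _)]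
    refine integral_mono (hh.integrable ht.1) (((hev η).integrable ht.1).add (hSi η _)) fun z => ?_
    beta_reduce
    by_cases hz : z ∈ S η
    · rw [indicator_of_mem hz]
      have h1 := (abs_le.1 (hb t ht z)).2
      have h2 : 0 ≤ h t z * cutoff η z.1 := mul_nonneg (hnonneg t ht.1 z) (cutoff_nonneg _ _)
      linarith
    · rw [indicator_of_notMem hz, add_zero]
      by_cases hzR : z ∈ phaseBox R
      · have h1 : 2 * η < ‖z.1‖ := by
          by_contra! hcon
          exact hz ⟨by simpa using hcon, hzR.2⟩
        rw [cutoff_eq_one hη (by linarith), mul_one]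
      · rw [h0 t ht z hzR, zero_mul]
  have hderiv : ∀ η, 0 < η → ∀ t ∈ Ioo 0 T, ∃ y', HasDerivAt (y η) y' t ∧
      y' ≤ C * (y η t + 8 * η ^ 3 * V * C₁) + 8 * η ^ 2 * V * (C₁ * K * R) := by
    intro η hη t ht
    have ht' : t ∈ Icc 0 T := ⟨ht.1.le, ht.2.le⟩
    obtain ⟨i1, d1⟩ := (hev η).hasDerivAt_integral_transport (ha t ht.1) hη ht.1
      (fun x v hx => by simp [cutoff_eq_zero hη hx])
    refine ⟨_, d1, ?_⟩
    have hsplit : ∀ z, transportDeriv (a t) (fun t z => h t z * cutoff η z.1) t z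
        = transportDeriv (a t) h t z * cutoff η z.1
          + h t z * fderiv ℝ (cutoff η) z.1 z.2 := by
      intro z
      rw [hh.transportDeriv_mul_static ht.1 (φ := fun z => cutoff η z.1)
        ((hφ η).differentiable one_ne_zero z), hφd]
    have i2 : Integrable fun z : Space × Space => h t z * fderiv ℝ (cutoff η) z.1 z.2 := by
      refine Continuous.integrable_of_hasCompactSupport ?_ (hh.hasCompactSupport ht.1.le).mul_right
      refine (hh.contDiff_slice ht.1.le).continuous.mul ?_
      exact (((contDiff_cutoff η).continuous_fderiv one_ne_zero).comp continuous_fst).clm_apply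
        continuous_snd
    have i3 : Integrable fun z => transportDeriv (a t) h t z * cutoff η z.1 := by
      have := i1.sub i2
      refine this.congr (ae_of_all _ fun z => ?_)
      simp [hsplit]
    have e1 : ∫ z, transportDeriv (a t) (fun t z => h t z * cutoff η z.1) t z
        = (∫ z, transportDeriv (a t) h t z * cutoff η z.1)
          + ∫ z : Space × Space, h t z * fderiv ℝ (cutoff η) z.1 z.2 := by
      simp only [hsplit]
      exact integral_add i3 i2
    rw [e1]
    have h1 : ∫ z : Space × Space, h t z * fderiv ℝ (cutoff η) z.1 z.2
        ≤ ∫ z, (S η).indicator (fun _ => C₁ * (K / η * R)) z := by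
      refine integral_mono i2 (hSi η _) fun z => ?_
      show h t z * fderiv ℝ (cutoff η) z.1 z.2 ≤ _
      by_cases hz : z ∈ S η
      · rw [indicator_of_mem hz]
        have hzv : ‖z.2‖ ≤ R := by simpa using hz.2
        have h2 : |fderiv ℝ (cutoff η) z.1 z.2| ≤ K / η * R := by
          have h3 := (fderiv ℝ (cutoff η) z.1).le_opNorm z.2
          refine h3.trans ?_
          have h4 := (hKb η hη z.1).1
          gcongr
        calc _ ≤ |h t z * fderiv ℝ (cutoff η) z.1 z.2| := le_abs_self _
          _ = |h t z| * |fderiv ℝ (cutoff η) z.1 z.2| := abs_mul _ _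
          _ ≤ _ := by
            have := hb t ht' z
            gcongr
      · rw [indicator_of_notMem hz]
        by_cases hzR : z ∈ phaseBox R
        · have h1 : 2 * η < ‖z.1‖ := by
            by_contra! hcon
            exact hz ⟨by simpa using hcon, hzR.2⟩
          rw [(hKb η hη z.1).2 h1.le]
          simp
        · rw [h0 t ht' z hzR, zero_mul]
    rw [hSvol η hη] at h1
    have h2 : 8 * η ^ 3 * V * (C₁ * (K / η * R)) = 8 * η ^ 2 * V * (C₁ * K * R) := by
      field_simp
    have h3 := hle t ht η hη
    have h4 := mul_le_mul_of_nonneg_left (hdiff η hη t ht') hC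
    linarith
  -- Gronwall's inequality
  have hgron : ∀ η, 0 < η → ∀ t ∈ Icc 0 T, y η t
      ≤ Real.exp (C * t) * ((C * (8 * η ^ 3 * V * C₁) + 8 * η ^ 2 * V * (C₁ * K * R)) * t) := by
    intro η hη t ht
    set c := C * (8 * η ^ 3 * V * C₁) + 8 * η ^ 2 * V * (C₁ * K * R) with hc
    have hc0 : 0 ≤ c := by positivity
    have hanti : AntitoneOn (fun s => Real.exp (-(C * s)) * y η s - c * s) (Icc 0 T) := by
      have hdd : ∀ s ∈ Ioo 0 T, ∃ d, HasDerivAt (fun s => Real.exp (-(C * s)) * y η s - c * s) d s ∧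
          d ≤ 0 := by
        intro s hs
        obtain ⟨y', hy', hle'⟩ := hderiv η hη s hs
        have h1 : HasDerivAt (fun s => Real.exp (-(C * s))) (Real.exp (-(C * s)) * (-(C * 1))) s :=
          (((hasDerivAt_id s).const_mul C).neg).exp
        refine ⟨_, (h1.mul hy').sub ((hasDerivAt_id s).const_mul c), ?_⟩
        have h2 : Real.exp (-(C * s)) ≤ 1 := Real.exp_le_one_iff.2 (by nlinarith [hs.1])
        have h3 := Real.exp_pos (-(C * s))
        have h4 : Real.exp (-(C * s)) * (y' - C * y η s) ≤ Real.exp (-(C * s)) * c := by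
          gcongr
          rw [hc]
          linarith
        nlinarith
      refine antitoneOn_of_deriv_nonpos (convex_Icc 0 T) ?_ ?_ ?_
      · refine ContinuousOn.sub (ContinuousOn.mul (by fun_prop) ?_) (by fun_prop)
        exact (hev η).continuousOn_integral.mono fun s hs => hs.1
      · rw [interior_Icc]
        intro s hs
        obtain ⟨d, hd, -⟩ := hdd s hs
        exact hd.differentiableAt.differentiableWithinAt
      · rw [interior_Icc]
        intro s hs
        obtain ⟨d, hd, hd0⟩ := hdd s hs
        rw [hd.deriv]
        exact hd0
    have h1 := hanti ⟨le_rfl, ht.1.trans ht.2⟩ ht ht.1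
    have h2 : y η 0 = 0 := by simp [hy, hinit]
    simp only [h2, mul_zero, neg_zero, sub_zero] at h1
    have h3 : Real.exp (-(C * t)) * y η t ≤ c * t := by linarith
    calc y η t = Real.exp (C * t) * (Real.exp (-(C * t)) * y η t) := by
          rw [← mul_assoc, ← Real.exp_add]; simp
      _ ≤ _ := by gcongr
  intro t ht
  have hle0 : ∫ z, h t z ≤ 0 := by
    have hcont : Continuous fun η : ℝ => Real.exp (C * t) *
        ((C * (8 * η ^ 3 * V * C₁) + 8 * η ^ 2 * V * (C₁ * K * R)) * t) + 8 * η ^ 3 * V * C₁ := by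
      fun_prop
    have hlim := (hcont.tendsto 0).mono_left (nhdsWithin_le_nhds (s := Ioi 0))
    simp only [ne_eq, OfNat.ofNat_ne_zero, not_false_eq_true, zero_pow, mul_zero, zero_mul,
      add_zero] at hlim
    refine ge_of_tendsto hlim ?_
    filter_upwards [self_mem_nhdsWithin] with η hη
    have h1 := hdiff η hη t ht
    have h2 := hgron η hη t ht
    linarith
  have hz := (integral_eq_zero_iff_of_nonneg (hnonneg t ht.1) (hh.integrable ht.1)).1
    (le_antisymm hle0 (integral_nonneg (hnonneg t ht.1)))
  have := (Continuous.ae_eq_iff_eq volume (hh.contDiff_slice ht.1).continuous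
    continuous_const).1 (hz : h t =ᵐ[volume] fun _ => (0 : ℝ))
  exact fun z => congrFun this z

/-! ### Uniqueness for the Vlasov-Poisson system -/

lemma inner_gradient_right (W : Space → ℝ) (x w : Space) :
    inner ℝ (gradient W x) w = fderiv ℝ W x w := by
  rw [gradient, InnerProductSpace.toDual_symm_apply]

/-- The acceleration of a particle at `x` in the potential `U - Mc / |x|`. -/
def accel (Mc : ℝ) (U : Space → ℝ) (x : Space) : Space := -gradient (fun y => U y - Mc / ‖y‖) x

lemma contDiffAt_sub_div_norm (Mc : ℝ) {U : Space → ℝ} (hU : ContDiff ℝ 2 U) {x : Space}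
    (hx : x ≠ 0) : ContDiffAt ℝ 2 (fun y => U y - Mc / ‖y‖) x :=
  hU.contDiffAt.sub (contDiffAt_const.div (contDiffAt_norm ℝ hx) (norm_ne_zero_iff.2 hx))

lemma continuousOn_accel (Mc : ℝ) {U : Space → ℝ} (hU : ContDiff ℝ 2 U) :
    ContinuousOn (accel Mc U) {0}ᶜ := by
  intro x hx
  refine ContinuousAt.continuousWithinAt (ContinuousAt.neg ?_)
  have h1 : ContinuousAt (fderiv ℝ (fun y => U y - Mc / ‖y‖)) x :=
    (contDiffAt_sub_div_norm Mc hU hx).continuousAt_fderiv two_ne_zero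
  exact (InnerProductSpace.toDual ℝ Space).symm.continuous.continuousAt.comp h1

lemma accel_sub (Mc : ℝ) {U V : Space → ℝ} (hU : ContDiff ℝ 2 U) (hV : ContDiff ℝ 2 V) {x : Space}
    (hx : x ≠ 0) : accel Mc U x - accel Mc V x = -gradient (fun y => U y - V y) x := by
  have h1 := ((contDiffAt_sub_div_norm Mc hU hx).differentiableAt two_ne_zero).hasGradientAt
  have h2 := ((contDiffAt_sub_div_norm Mc hV hx).differentiableAt two_ne_zero).hasGradientAt
  have h3 : HasGradientAt (fun y => U y - V y) (gradient (fun y => U y - Mc / ‖y‖) x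
      - gradient (fun y => V y - Mc / ‖y‖) x) x := by
    rw [hasGradientAt_iff_hasFDerivAt] at h1 h2 ⊢
    rw [map_sub]
    refine (h1.sub h2).congr_of_eventuallyEq (Eventually.of_forall fun y => ?_)
    simp
  rw [h3.gradient, accel, accel]
  abel

/-- The Vlasov equation: a solution is constant along the transport field. -/
lemma IsSolution.transportDeriv_eq_zero {Mc : ℝ} {f : ℝ → Space × Space → ℝ} {U : ℝ → Space → ℝ}
    (h : IsSolution Mc f U) {t : ℝ} (ht : 0 < t) {z : Space × Space} (hz : z.1 ≠ 0) :
    transportDeriv (accel Mc (U t)) f t z = 0 := by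
  obtain ⟨x, v⟩ := z
  have hh := h.evolution
  have hv := h.vlasov t ht x v hz
  have hd := (hh.contDiff_slice ht.le).differentiable one_ne_zero (x, v)
  have hx1 : HasFDerivAt (fun y : Space => (y, v)) ((ContinuousLinearMap.id ℝ Space).prod 0) x :=
    (hasFDerivAt_id x).prodMk (hasFDerivAt_const v x)
  have hx2 : HasFDerivAt (fun y : Space => f t (y, v)) _ x := hd.hasFDerivAt.comp x hx1
  have hv1 : HasFDerivAt (fun w : Space => (x, w))
      ((0 : Space →L[ℝ] Space).prod (ContinuousLinearMap.id ℝ Space)) v :=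
    (hasFDerivAt_const x v).prodMk (hasFDerivAt_id v)
  have hv2 : HasFDerivAt (fun w : Space => f t (x, w)) _ v := hd.hasFDerivAt.comp v hv1
  rw [(hh.hasDerivAt_time ht (x, v)).deriv, real_inner_comm, inner_gradient_right, hx2.fderiv,
    real_inner_comm, inner_gradient_right, hv2.fderiv] at hv
  have hsplit : ((1 : ℝ), (v, accel Mc (U t) x))
      = (1, 0) + ((0, (v, 0)) - (0, (0, gradient (fun y => U t y - Mc / ‖y‖) x))) := by
    simp [accel]
  rw [transportDeriv]
  simp only
  rw [hsplit, map_add, map_sub, ← hh.fderiv_slice ht, ← hh.fderiv_slice ht]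
  simp at hv ⊢
  linarith

section density

variable {h : ℝ → Space × Space → ℝ} {t : ℝ}

lemma setIntegral_eq_density {u : Space × Space → ℝ} {R : ℝ}
    (h0 : ∀ z, z ∉ phaseBox R → u z = 0) (x : Space) :
    ∫ v in Metric.closedBall 0 R, u (x, v) = density u x :=
  setIntegral_eq_integral_of_forall_compl_eq_zero fun _ hv => h0 _ fun h => hv h.2

lemma density_eq_zero_of_notMem {u : Space × Space → ℝ} {R : ℝ}
    (h0 : ∀ z, z ∉ phaseBox R → u z = 0) {x : Space} (hx : R < ‖x‖) : density u x = 0 := by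
  have : ∀ v, u (x, v) = 0 := fun v => h0 _ fun h => by
    have : ‖x‖ ≤ R := by simpa using h.1
    linarith
  simp [density, this]

lemma continuous_density {u : Space × Space → ℝ} (hu : Continuous u) {R : ℝ}
    (h0 : ∀ z, z ∉ phaseBox R → u z = 0) : Continuous (density u) := by
  have h1 := continuous_parametric_integral_of_continuous (μ := (volume : Measure Space))
    (f := fun x v : Space => u (x, v)) (by simpa [Function.uncurry_def] using hu)
    (isCompact_closedBall (0 : Space) R)
  simpa only [setIntegral_eq_density h0] using h1

lemma sq_density_le {u : Space × Space → ℝ} (hu : Continuous u) {R : ℝ} (hR : 0 < R)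
    (h0 : ∀ z, z ∉ phaseBox R → u z = 0) (x : Space) :
    density u x ^ 2
      ≤ (volume (Metric.closedBall (0 : Space) R)).toReal * density (fun z => u z ^ 2) x := by
  have h0' : ∀ z, z ∉ phaseBox R → u z ^ 2 = 0 := fun z hz => by rw [h0 z hz]; simp
  rw [← setIntegral_eq_density h0, ← setIntegral_eq_density h0']
  set B := Metric.closedBall (0 : Space) R with hB
  set b := (volume B).toReal with hb
  have hBt : volume B ≠ ∞ := (isCompact_closedBall (0 : Space) R).measure_lt_top.ne
  have hb0 : 0 < b := ENNReal.toReal_pos (Metric.measure_closedBall_pos volume _ hR).ne' hBt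
  have i1 : IntegrableOn (fun v => u (x, v)) B :=
    (hu.comp (by fun_prop)).continuousOn.integrableOn_compact (isCompact_closedBall _ _)
  have i2 : IntegrableOn (fun v => u (x, v) ^ 2) B :=
    ((hu.comp (by fun_prop)).pow 2).continuousOn.integrableOn_compact (isCompact_closedBall _ _)
  set m := (∫ v in B, u (x, v)) / b with hm
  have hmb : ∫ v in B, u (x, v) = m * b := by rw [hm]; field_simp
  have ic : IntegrableOn (fun _ : Space => m ^ 2) B := integrableOn_const hBt
  have h1 : 0 ≤ ∫ v in B, (u (x, v) ^ 2 - 2 * m * u (x, v) + m ^ 2) :=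
    integral_nonneg fun v => by
      show 0 ≤ u (x, v) ^ 2 - 2 * m * u (x, v) + m ^ 2
      nlinarith [sq_nonneg (u (x, v) - m)]
  have h2 : ∫ v in B, (u (x, v) ^ 2 - 2 * m * u (x, v) + m ^ 2)
      = (∫ v in B, u (x, v) ^ 2) - 2 * m * (m * b) + b * m ^ 2 := by
    rw [integral_add (integrable_fun_sub i2 (i1.const_mul _)) ic,
      integral_sub i2 (i1.const_mul _), integral_const_mul, hmb, setIntegral_const, Measure.real,
      smul_eq_mul]
  rw [h2] at h1
  rw [hmb]
  nlinarith

end density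

/-- Two classical solutions with the same initial distribution function coincide. -/
lemma IsSolution.eq_of_init_eq {Mc : ℝ} {f g : ℝ → Space × Space → ℝ} {U V : ℝ → Space → ℝ}
    (hf : IsSolution Mc f U) (hg : IsSolution Mc g V) (hinit : f 0 = g 0) {t : ℝ} (ht : 0 ≤ t) :
    f t = g t := by
  have hw : Evolution fun t z => f t z - g t z := hf.evolution.sub hg.evolution
  set w : ℝ → Space × Space → ℝ := fun t z => f t z - g t z with hw_def
  have hsq : ContDiff ℝ 1 fun s : ℝ => s ^ 2 := by fun_prop
  have hw2 : Evolution fun t z => w t z ^ 2 := hw.comp_left (G := fun s => s ^ 2) hsq (by simp)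
  obtain ⟨R₁, C₁, hR₁, hC₁, -, hgd0, hgd, -⟩ := hg.evolution.exists_bound (t + 1)
  obtain ⟨R₂, -, -, -, hw0, -, -, -⟩ := hw.exists_bound (t + 1)
  set R := max R₁ R₂ + 1 with hR
  have hRR₁ : R₁ ≤ R := (le_max_left _ _).trans (by linarith)
  have hRR₂ : R₂ < R := (le_max_right R₁ R₂).trans_lt (by linarith)
  have hR0 : 0 < R := hR₁.trans_le hRR₁
  have hbox : ∀ {r : ℝ}, r ≤ R → ∀ z, z ∉ phaseBox R → z ∉ phaseBox r := fun hr z hz hz' =>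
    hz ⟨Metric.closedBall_subset_closedBall hr hz'.1, Metric.closedBall_subset_closedBall hr hz'.2⟩
  obtain ⟨C₂, hC₂, hgrad⟩ := exists_gradient_bound hR0
  set b := (volume (Metric.closedBall (0 : Space) R)).toReal with hb
  have hb0 : 0 ≤ b := ENNReal.toReal_nonneg
  have key := hw2.eq_zero_of_transportDeriv_le (fun t _ z => sq_nonneg _)
    (fun z => by simp [hw_def, hinit]) (a := fun t => accel Mc (U t))
    (fun t ht => continuousOn_accel Mc (hf.contDiff_pot t ht.le))
    (T := t + 1) (C := C₁ + C₁ * (b * (C₂ * ((4 * Real.pi) ^ 2 * b)))) (by positivity) ?_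
  · funext z
    have := key t ⟨ht, by linarith⟩ z
    exact sub_eq_zero.1 (pow_eq_zero_iff two_ne_zero |>.1 this)
  intro s hs η hη
  have hs0 := hs.1
  have hs' : s ∈ Icc 0 (t + 1) := ⟨hs.1.le, hs.2.le⟩
  have hws : Continuous (w s) := (hw.contDiff_slice hs0.le).continuous
  have hws0 : ∀ z, z ∉ phaseBox R → w s z = 0 := fun z hz =>
    hw0 s hs' z (hbox hRR₂.le z hz)
  have hi2 : Integrable fun z => w s z ^ 2 := hw2.integrable hs0.le
  set W : Space → ℝ := fun x => U s x - V s x with hW_def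
  have hUc := hf.contDiff_pot s hs0.le
  have hVc := hg.contDiff_pot s hs0.le
  have hWc : ContDiff ℝ 2 W := hUc.sub hVc
  -- the field difference is controlled by the difference of the distribution functions
  have hfield : ∫ x in Metric.closedBall 0 R, ‖gradient W x‖ ^ 2
      ≤ C₂ * ((4 * Real.pi) ^ 2 * b) * ∫ z, w s z ^ 2 := by
    have hdens : ∀ x, density (w s) x = density (f s) x - density (g s) x := by
      intro x
      have hslice : ∀ {h : ℝ → Space × Space → ℝ}, Evolution h →
          Integrable fun v : Space => h s (x, v) := fun {h} hh => by
        obtain ⟨r, hr⟩ := hh.support s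
        refine Continuous.integrable_of_hasCompactSupport
          ((hh.contDiff_slice hs0.le).continuous.comp (by fun_prop))
          (HasCompactSupport.intro (isCompact_closedBall (0 : Space) r) fun v hv => ?_)
        exact hr s ⟨hs0.le, le_rfl⟩ x v (Or.inr (le_of_lt (by simpa using hv)))
      exact integral_sub (hslice hf.evolution) (hslice hg.evolution)
    have h1 := hgrad W (fun x => 4 * Real.pi * density (w s) x) hWc ?_
      (continuous_const.mul (continuous_density hws hws0)) ?_ ?_
    · have h2 : Integrable fun x => density (fun z => w s z ^ 2) x := hi2.integral_prod_left
      have hcd : Continuous (density (w s)) := continuous_density hws hws0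
      have h3 : Integrable fun x => density (w s) x ^ 2 := by
        refine (h2.const_mul b).mono' (hcd.pow 2).aestronglyMeasurable (ae_of_all _ fun x => ?_)
        rw [Real.norm_of_nonneg (sq_nonneg _)]
        exact sq_density_le hws hR0 hws0 x
      have h4 : ∫ x, density (w s) x ^ 2 ≤ b * ∫ z, w s z ^ 2 := by
        calc ∫ x, density (w s) x ^ 2 ≤ ∫ x, b * density (fun z => w s z ^ 2) x :=
              integral_mono h3 (h2.const_mul b) fun x => sq_density_le hws hR0 hws0 x
          _ = b * ∫ z, w s z ^ 2 := by
              rw [integral_const_mul]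
              congr 1
              exact (integral_prod _ hi2).symm
      have h5 : ∫ x, (4 * Real.pi * density (w s) x) ^ 2
          = (4 * Real.pi) ^ 2 * ∫ x, density (w s) x ^ 2 := by
        simp only [mul_pow _ (density (w s) _)]
        exact integral_const_mul _ _
      rw [h5] at h1
      refine h1.trans ?_
      rw [mul_assoc, mul_assoc]
      gcongr
    · have := (hf.pot_tendsto s hs0.le).sub (hg.pot_tendsto s hs0.le)
      rwa [sub_zero] at this
    · intro x
      have h2 : Laplacian.laplacian W x
          = Laplacian.laplacian (U s) x - Laplacian.laplacian (V s) x :=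
        hUc.contDiffAt.laplacian_sub hVc.contDiffAt
      rw [h2, hf.poisson s hs0.le, hg.poisson s hs0.le, hdens]
      ring
    · intro x hx
      have : density (w s) x = 0 := density_eq_zero_of_notMem (hw0 s hs') (hRR₂.trans_le hx)
      simp [this]
  have hpt : ∀ z, transportDeriv (accel Mc (U s)) (fun t z => w t z ^ 2) s z * cutoff η z.1
      ≤ C₁ * w s z ^ 2 + C₁ * (phaseBox R).indicator (fun z => ‖gradient W z.1‖ ^ 2) z := by
    intro z
    have hnn : 0 ≤ C₁ * w s z ^ 2
        + C₁ * (phaseBox R).indicator (fun z => ‖gradient W z.1‖ ^ 2) z :=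
      add_nonneg (by positivity)
        (mul_nonneg hC₁ (indicator_nonneg (fun z _ => sq_nonneg _) z))
    by_cases hz : z.1 = 0
    · rw [hz, cutoff_eq_zero hη (by simpa using hη.le), mul_zero]
      exact hnn
    have h1 : transportDeriv (accel Mc (U s)) w s z
        = fderiv ℝ (g s) z (0, gradient W z.1) := by
      rw [hf.evolution.transportDeriv_sub hg.evolution hs0, hf.transportDeriv_eq_zero hs0 hz,
        hg.evolution.transportDeriv_sub_field hs0 (accel Mc (V s)),
        hg.transportDeriv_eq_zero hs0 hz, accel_sub Mc hUc hVc hz, zero_add, zero_sub, ← map_neg]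
      simp [hW_def]
    have h2 : transportDeriv (accel Mc (U s)) (fun t z => w t z ^ 2) s z
        = 2 * w s z * fderiv ℝ (g s) z (0, gradient W z.1) := by
      rw [hw.transportDeriv_comp_left (G := fun s => s ^ 2) hs0 hsq, h1]
      simp
    have h3 : |fderiv ℝ (g s) z (0, gradient W z.1)|
        ≤ (phaseBox R).indicator (fun z => C₁ * ‖gradient W z.1‖) z := by
      rw [hg.evolution.fderiv_slice hs0]
      by_cases hzR : z ∈ phaseBox R
      · rw [indicator_of_mem hzR]
        refine ((fderiv ℝ (fun p : ℝ × (Space × Space) => g p.1 p.2) (s, z)).le_opNorm _).trans ?_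
        have h4 : ‖((0 : ℝ), ((0 : Space), gradient W z.1))‖ = ‖gradient W z.1‖ := by
          simp [Prod.norm_def]
        rw [h4]
        gcongr
        exact hgd s hs z
      · rw [indicator_of_notMem hzR, hgd0 s hs z (hbox hRR₁ z hzR)]
        simp
    have hc0 := cutoff_nonneg η z.1
    have hc1 := cutoff_le_one η z.1
    have h5 : |2 * w s z * fderiv ℝ (g s) z (0, gradient W z.1)|
        ≤ C₁ * w s z ^ 2 + C₁ * (phaseBox R).indicator (fun z => ‖gradient W z.1‖ ^ 2) z := by
      rw [abs_mul, abs_mul, abs_two]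
      by_cases hzR : z ∈ phaseBox R
      · rw [indicator_of_mem hzR] at h3 ⊢
        have h6 := mul_le_mul_of_nonneg_left h3 (abs_nonneg (w s z))
        rw [← sq_abs (w s z)]
        nlinarith [sq_nonneg (|w s z| - ‖gradient W z.1‖)]
      · rw [indicator_of_notMem hzR] at h3 ⊢
        have h6 : |fderiv ℝ (g s) z (0, gradient W z.1)| = 0 := le_antisymm h3 (abs_nonneg _)
        rw [h6, mul_zero, mul_zero, add_zero]
        positivity
    rw [h2]
    calc _ ≤ |2 * w s z * fderiv ℝ (g s) z (0, gradient W z.1)| * cutoff η z.1 := by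
          gcongr
          exact le_abs_self _
      _ ≤ |2 * w s z * fderiv ℝ (g s) z (0, gradient W z.1)| * 1 := by gcongr
      _ ≤ _ := by rwa [mul_one]
  have hgc : Continuous fun x => ‖gradient W x‖ ^ 2 := by
    simp only [norm_gradient_sq]
    exact continuous_finsetSum _ fun i _ =>
      (continuous_partialD (hWc.of_le (by norm_num)) i).pow 2
  have ibox : IntegrableOn (fun z : Space × Space => ‖gradient W z.1‖ ^ 2) (phaseBox R) :=
    (hgc.comp continuous_fst).continuousOn.integrableOn_compact (isCompact_phaseBox R)
  have ibox' : Integrable ((phaseBox R).indicator fun z => ‖gradient W z.1‖ ^ 2) :=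
    (integrable_indicator_iff (measurableSet_phaseBox R)).2 ibox
  have ebox : ∫ z, (phaseBox R).indicator (fun z => ‖gradient W z.1‖ ^ 2) z
      = b * ∫ x in Metric.closedBall 0 R, ‖gradient W x‖ ^ 2 := by
    rw [integral_indicator (measurableSet_phaseBox R), phaseBox, Measure.volume_eq_prod]
    have := setIntegral_prod_mul (μ := (volume : Measure Space)) (ν := (volume : Measure Space))
      (fun x => ‖gradient W x‖ ^ 2) (fun _ => (1 : ℝ)) (Metric.closedBall (0 : Space) R)
      (Metric.closedBall (0 : Space) R)
    simp only [mul_one] at this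
    rw [this, setIntegral_const, Measure.real, smul_eq_mul, mul_one, mul_comm]
  have hrhs : ∫ z, (C₁ * w s z ^ 2 + C₁ * (phaseBox R).indicator (fun z => ‖gradient W z.1‖ ^ 2) z)
      = C₁ * (∫ z, w s z ^ 2) + C₁ * (b * ∫ x in Metric.closedBall 0 R, ‖gradient W x‖ ^ 2) := by
    rw [integral_add (hi2.const_mul _) (ibox'.const_mul _), integral_const_mul,
      integral_const_mul, ebox]
  have hfinal : C₁ * (∫ z, w s z ^ 2) + C₁ * (b * ∫ x in Metric.closedBall 0 R, ‖gradient W x‖ ^ 2)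
      ≤ (C₁ + C₁ * (b * (C₂ * ((4 * Real.pi) ^ 2 * b)))) * ∫ z, w s z ^ 2 := by
    have : C₁ * (b * ∫ x in Metric.closedBall 0 R, ‖gradient W x‖ ^ 2)
        ≤ C₁ * (b * (C₂ * ((4 * Real.pi) ^ 2 * b) * ∫ z, w s z ^ 2)) := by gcongr
    linarith
  by_cases hint : Integrable fun z =>
      transportDeriv (accel Mc (U s)) (fun t z => w t z ^ 2) s z * cutoff η z.1
  · exact (integral_mono hint ((hi2.const_mul _).add (ibox'.const_mul _)) hpt).trans
      (hrhs.trans_le hfinal)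
  · rw [integral_undef hint]
    have : 0 ≤ ∫ z, w s z ^ 2 := integral_nonneg fun z => sq_nonneg _
    positivity

/-! ### Preservation of spherical symmetry -/

lemma fderiv_comp_isometry (W : Space → ℝ) (A : Space ≃ₗᵢ[ℝ] Space) (x w : Space) :
    fderiv ℝ (fun y => W (A y)) x w = fderiv ℝ W (A x) (A w) := by
  have := A.toContinuousLinearEquiv.comp_right_fderiv (f := W) (x := x)
  have h2 : fderiv ℝ (fun y => W (A y)) x = _ := this
  rw [h2]
  rfl

lemma gradient_comp_isometry (W : Space → ℝ) (A : Space ≃ₗᵢ[ℝ] Space) (x : Space) :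
    gradient (fun y => W (A y)) x = A.symm (gradient W (A x)) := by
  refine ext_inner_right ℝ fun w => ?_
  rw [inner_gradient_right, fderiv_comp_isometry, ← inner_gradient_right]
  conv_rhs => rw [← A.inner_map_map, A.apply_symm_apply]

lemma laplacian_comp_isometry {W : Space → ℝ} (hW : ContDiff ℝ 2 W) (A : Space ≃ₗᵢ[ℝ] Space)
    (x : Space) : Laplacian.laplacian (fun y => W (A y)) x = Laplacian.laplacian W (A x) := by
  rw [InnerProductSpace.laplacian_eq_iteratedFDeriv_orthonormalBasis (fun y => W (A y))
    (EuclideanSpace.basisFun (Fin 3) ℝ), InnerProductSpace.laplacian_eq_iteratedFDeriv_orthonormalBasis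
    W ((EuclideanSpace.basisFun (Fin 3) ℝ).map A)]
  refine Finset.sum_congr rfl fun i _ => ?_
  have h := ContinuousLinearMap.iteratedFDeriv_comp_right (A : Space →L[ℝ] Space) (f := W) hW x
    (i := 2) le_rfl
  have h2 : iteratedFDeriv ℝ 2 (fun y => W (A y)) x = _ := h
  rw [h2, ContinuousMultilinearMap.compContinuousLinearMap_apply]
  congr 1
  funext j
  fin_cases j <;> simp

lemma density_comp_isometry (u : Space × Space → ℝ) (A : Space ≃ₗᵢ[ℝ] Space) (x : Space) :
    density (fun z => u (A z.1, A z.2)) x = density u (A x) := by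
  simp only [density]
  exact A.measurePreserving.integral_comp A.toHomeomorph.measurableEmbedding
    (fun v => u (A x, v))

/-- The image of a solution under an element of `O(3)` is a solution. -/
lemma IsSolution.comp_isometry {Mc : ℝ} {f : ℝ → Space × Space → ℝ} {U : ℝ → Space → ℝ}
    (h : IsSolution Mc f U) (A : Space ≃ₗᵢ[ℝ] Space) :
    IsSolution Mc (fun t z => f t (A z.1, A z.2)) (fun t x => U t (A x)) where
  nonneg t ht z := h.nonneg t ht _
  contDiff := by
    refine h.contDiff.comp (f := fun p : ℝ × (Space × Space) => (p.1, (A p.2.1, A p.2.2))) ?_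
      fun p hp => ⟨hp.1, mem_univ _⟩
    have hA : ContDiff ℝ 1 A := A.contDiff
    exact (contDiff_fst.prodMk ((hA.comp (contDiff_fst.comp contDiff_snd)).prodMk
      (hA.comp (contDiff_snd.comp contDiff_snd)))).contDiffOn
  support T := by
    obtain ⟨R, hR⟩ := h.support T
    exact ⟨R, fun t ht x v hxv => hR t ht _ _ (by simpa using hxv)⟩
  contDiff_pot t ht := (h.contDiff_pot t ht).comp A.contDiff
  poisson t ht x := by
    rw [laplacian_comp_isometry (h.contDiff_pot t ht), h.poisson t ht, density_comp_isometry]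
  pot_tendsto t ht := (h.pot_tendsto t ht).comp A.toHomeomorph.isClosedEmbedding.tendsto_cocompact
  vlasov t ht x v hx := by
    have hx' : A x ≠ 0 := by simpa using hx
    have hv := h.vlasov t ht (A x) (A v) hx'
    have e1 : gradient (fun y => f t (A y, A v)) x
        = A.symm (gradient (fun y => f t (y, A v)) (A x)) :=
      gradient_comp_isometry (fun y => f t (y, A v)) A x
    have e2 : gradient (fun w => f t (A x, A w)) v
        = A.symm (gradient (fun w => f t (A x, w)) (A v)) :=
      gradient_comp_isometry (fun w => f t (A x, w)) A v
    have e3 : gradient (fun y => U t (A y) - Mc / ‖y‖) x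
        = A.symm (gradient (fun y => U t y - Mc / ‖y‖) (A x)) := by
      rw [← gradient_comp_isometry (fun y => U t y - Mc / ‖y‖) A x]
      simp only [A.norm_map]
    simp only [e1, e2, e3]
    rw [A.symm.inner_map_map, ← A.inner_map_map, A.apply_symm_apply]
    exact hv

lemma exists_isometry_map_eq {x y : Space} (h : ‖x‖ = ‖y‖) :
    ∃ A : Space ≃ₗᵢ[ℝ] Space, A x = y :=
  ⟨(ℝ ∙ (x - y))ᗮ.reflection, Submodule.reflection_sub h⟩

/-- The gradient of a spherically symmetric function is parallel to `x`. -/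
lemma fderiv_eq_zero_of_symmetric {W : Space → ℝ} (hW : ∀ (A : Space ≃ₗᵢ[ℝ] Space) x, W (A x) = W x)
    {x w : Space} (hw : inner ℝ x w = 0) : fderiv ℝ W x w = 0 := by
  set A : Space ≃ₗᵢ[ℝ] Space := (ℝ ∙ w)ᗮ.reflection with hA
  have h1 : A x = x := by
    rw [hA, Submodule.reflection_eq_self_iff, Submodule.mem_orthogonal_singleton_iff_inner_left]
    exact hw
  have h2 : A w = -w := Submodule.reflection_orthogonalComplement_singleton_eq_neg w
  have h3 := fderiv_comp_isometry W A x w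
  have h4 : (fun y => W (A y)) = W := funext fun y => hW A y
  rw [h4, h1, h2, map_neg] at h3
  linarith

lemma eq_zero_of_laplacian_eq_zero {W : Space → ℝ} (hW : ContDiff ℝ 2 W)
    (hlim : Tendsto W (cocompact Space) (𝓝 0)) (hΔ : ∀ x, Laplacian.laplacian W x = 0) (x : Space) :
    W x = 0 := by
  by_contra hne
  have h1 := integral_sq_closedBall_le hW hlim (σ := fun _ => 0) continuous_const hΔ (R := 0)
    (fun _ _ => rfl) (‖x‖ + 1)
  simp only [ne_eq, OfNat.ofNat_ne_zero, not_false_eq_true, zero_pow, integral_zero, mul_zero] at h1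
  have hc : Continuous fun y => W y ^ 2 := hW.continuous.pow 2
  have hi : IntegrableOn (fun y => W y ^ 2) (Metric.closedBall 0 (‖x‖ + 1)) :=
    hc.continuousOn.integrableOn_compact (isCompact_closedBall _ _)
  have h2 : ∫ y in Metric.ball 0 (‖x‖ + 1), W y ^ 2 ≤ 0 :=
    (setIntegral_mono_set hi (ae_of_all _ fun y => sq_nonneg _)
      Metric.ball_subset_closedBall.eventuallyLE).trans h1
  have h3 := (setIntegral_eq_zero_iff_of_nonneg_ae (ae_of_all _ fun y => sq_nonneg (W y))
    (hi.mono_set Metric.ball_subset_closedBall)).1 (le_antisymm h2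
      (integral_nonneg fun y => sq_nonneg _))
  have h4 := Measure.eqOn_open_of_ae_eq (f := fun y => W y ^ 2) (g := fun _ => (0:ℝ)) h3
    Metric.isOpen_ball hc.continuousOn continuousOn_const
  have h5 : W x ^ 2 = 0 := h4 (by simp)
  exact hne (pow_eq_zero_iff two_ne_zero |>.1 h5)

lemma eq_of_ae_symmetric {u : Space × Space → ℝ} (hu : Continuous u) {A : Space ≃ₗᵢ[ℝ] Space}
    (h : ∀ᵐ z : Space × Space, u (A z.1, A z.2) = u z) (z : Space × Space) :
    u (A z.1, A z.2) = u z := by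
  have h1 : Continuous fun z : Space × Space => u (A z.1, A z.2) :=
    hu.comp ((A.continuous.comp continuous_fst).prodMk (A.continuous.comp continuous_snd))
  exact congrFun ((Continuous.ae_eq_iff_eq volume h1 hu).1 h) z

section symmetric

variable {Mc : ℝ} {f : ℝ → Space × Space → ℝ} {U : ℝ → Space → ℝ}

lemma IsSolution.symmetric (h : IsSolution Mc f U)
    (hinit : ∀ (A : Space ≃ₗᵢ[ℝ] Space) z, f 0 (A z.1, A z.2) = f 0 z) {t : ℝ} (ht : 0 ≤ t)
    (A : Space ≃ₗᵢ[ℝ] Space) (z : Space × Space) : f t (A z.1, A z.2) = f t z :=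
  congrFun ((h.comp_isometry A).eq_of_init_eq h (funext fun z => hinit A z) ht) z

lemma IsSolution.symmetric_pot (h : IsSolution Mc f U)
    (hinit : ∀ (A : Space ≃ₗᵢ[ℝ] Space) z, f 0 (A z.1, A z.2) = f 0 z) {t : ℝ} (ht : 0 ≤ t)
    (A : Space ≃ₗᵢ[ℝ] Space) (x : Space) : U t (A x) = U t x := by
  have hA := h.comp_isometry A
  refine sub_eq_zero.1 (eq_zero_of_laplacian_eq_zero (W := fun x => U t (A x) - U t x)
    ((hA.contDiff_pot t ht).sub (h.contDiff_pot t ht)) ?_ (fun x => ?_) x)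
  · have := (hA.pot_tendsto t ht).sub (h.pot_tendsto t ht)
    rwa [sub_zero] at this
  · have h2 : Laplacian.laplacian (fun x => U t (A x) - U t x) x
        = Laplacian.laplacian (fun x => U t (A x)) x - Laplacian.laplacian (U t) x :=
      (hA.contDiff_pot t ht).contDiffAt.laplacian_sub (h.contDiff_pot t ht).contDiffAt
    have h3 : (fun z : Space × Space => f t (A z.1, A z.2)) = f t :=
      funext fun z => h.symmetric hinit ht A z
    rw [h2, hA.poisson t ht, h.poisson t ht, h3, sub_self]

end symmetric

/-- In a spherically symmetric potential the angular momentum is conserved along the flow. -/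
lemma fderiv_angMomSq_eq_zero {Mc : ℝ} {U : Space → ℝ}
    (hU : ∀ (A : Space ≃ₗᵢ[ℝ] Space) x, U (A x) = U x) (z : Space × Space) :
    fderiv ℝ angMomSq z (z.2, accel Mc U z.1) = 0 := by
  obtain ⟨x, v⟩ := z
  set a := accel Mc U x with ha
  have h1 : inner ℝ a ((‖x‖ ^ 2) • v - (inner ℝ x v) • x) = 0 := by
    rw [ha, accel, inner_neg_left, inner_gradient_right, neg_eq_zero]
    refine fderiv_eq_zero_of_symmetric (fun A y => by rw [hU, A.norm_map]) ?_
    rw [inner_sub_right, inner_smul_right, inner_smul_right, real_inner_self_eq_norm_sq]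
    ring
  have d1 : HasFDerivAt (fun z : Space × Space => ‖z.1‖ ^ 2)
      ((2 • innerSL ℝ x).comp (ContinuousLinearMap.fst ℝ Space Space)) (x, v) :=
    HasFDerivAt.comp (g := fun y : Space => ‖y‖ ^ 2) (f := fun z : Space × Space => z.1) (x, v)
      (hasStrictFDerivAt_norm_sq x).hasFDerivAt hasFDerivAt_fst
  have d2 : HasFDerivAt (fun z : Space × Space => ‖z.2‖ ^ 2)
      ((2 • innerSL ℝ v).comp (ContinuousLinearMap.snd ℝ Space Space)) (x, v) :=
    HasFDerivAt.comp (g := fun y : Space => ‖y‖ ^ 2) (f := fun z : Space × Space => z.2) (x, v)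
      (hasStrictFDerivAt_norm_sq v).hasFDerivAt hasFDerivAt_snd
  have d3 : HasFDerivAt (fun z : Space × Space => (inner ℝ z.1 z.2 : ℝ)) _ (x, v) :=
    HasFDerivAt.inner ℝ (f := fun z : Space × Space => z.1) (g := fun z : Space × Space => z.2)
      hasFDerivAt_fst hasFDerivAt_snd
  have d4 : HasFDerivAt angMomSq _ (x, v) := (d1.mul d2).sub (d3.pow 2)
  rw [d4.fderiv]
  rw [inner_sub_right, inner_smul_right, inner_smul_right] at h1
  have h2 : inner ℝ v a = (inner ℝ a v : ℝ) := real_inner_comm _ _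
  have h3 : inner ℝ x a = (inner ℝ a x : ℝ) := real_inner_comm _ _
  simp [h2, h3]
  linear_combination 2 * h1

lemma contDiff_angMomSq : ContDiff ℝ 1 angMomSq := by
  unfold angMomSq
  exact (((contDiff_norm_sq ℝ).comp contDiff_fst).mul ((contDiff_norm_sq ℝ).comp contDiff_snd)).sub
    ((contDiff_fst.inner ℝ contDiff_snd).pow 2)

/-! ### The potential of a spherically symmetric solution -/

lemma contDiff_coord (i : Fin 3) : ContDiff ℝ 1 fun x : Space => x i :=
  (EuclideanSpace.proj i : Space →L[ℝ] ℝ).contDiff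

lemma partialD_coord (i j : Fin 3) (x : Space) :
    partialD i (fun y : Space => y j) x = if i = j then 1 else 0 := by
  have : HasFDerivAt (fun y : Space => y j) (EuclideanSpace.proj j : Space →L[ℝ] ℝ) x :=
    (EuclideanSpace.proj j : Space →L[ℝ] ℝ).hasFDerivAt
  rw [partialD, this.fderiv]
  simp [stdVec, eq_comm]

lemma norm_stdVec (i : Fin 3) : ‖stdVec i‖ = 1 := by simp [stdVec]

lemma inner_stdVec (x : Space) (i : Fin 3) : inner ℝ x (stdVec i) = x i := by
  simp [stdVec, EuclideanSpace.inner_single_right]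

/-- The second derivatives of a radial function in directions perpendicular to `x`. -/
lemma mul_partialD_partialD {U : Space → ℝ} (hU : ContDiff ℝ 2 U)
    (hsym : ∀ (A : Space ≃ₗᵢ[ℝ] Space) x, U (A x) = U x) {i : Fin 3} (hi : i ≠ 0) (r : ℝ) :
    r * partialD i (partialD i U) (r • stdVec 0) = partialD 0 U (r • stdVec 0) := by
  have hI : (fun x : Space => x 0 * partialD i U x - x i * partialD 0 U x) = fun _ => 0 := by
    funext x
    have h := fderiv_eq_zero_of_symmetric hsym (x := x) (w := x 0 • stdVec i - x i • stdVec 0) (by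
      rw [inner_sub_right, inner_smul_right, inner_smul_right, inner_stdVec, inner_stdVec]
      ring)
    rw [map_sub, map_smul, map_smul] at h
    exact h
  set x := r • stdVec 0 with hx
  have hx0 : x 0 = r := by simp [hx, stdVec]
  have hxi : x i = 0 := by simp [hx, stdVec, hi]
  have hd : ∀ {p q : Space → ℝ}, ContDiff ℝ 1 p → ContDiff ℝ 1 q →
      partialD i (fun x => p x - q x) x = partialD i p x - partialD i q x := by
    intro p q hp hq
    have : HasFDerivAt (fun x => p x - q x) _ x :=
      (hp.differentiable one_ne_zero x).hasFDerivAt.sub (hq.differentiable one_ne_zero x).hasFDerivAt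
    rw [partialD, this.fderiv]
    rfl
  have h := congrArg (fun F => partialD i F x) hI
  simp only at h
  rw [hd ((contDiff_coord 0).mul (contDiff_partialD hU i))
    ((contDiff_coord i).mul (contDiff_partialD hU 0)),
    partialD_mul (contDiff_coord 0) (contDiff_partialD hU i),
    partialD_mul (contDiff_coord i) (contDiff_partialD hU 0), partialD_coord, partialD_coord,
    hx0, hxi] at h
  simp [hi, partialD] at h
  simp only [partialD]
  linarith

lemma hasDerivAt_along_ray {W : Space → ℝ} (hW : ContDiff ℝ 1 W) (r : ℝ) :
    HasDerivAt (fun s : ℝ => W (s • stdVec 0)) (partialD 0 W (r • stdVec 0)) r := by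
  have h1 : HasDerivAt (fun s : ℝ => s • stdVec 0) (stdVec 0) r := by
    simpa using (hasDerivAt_id r).smul_const (stdVec 0)
  exact (hW.differentiable one_ne_zero (r • stdVec 0)).hasFDerivAt.comp_hasDerivAt r h1

/-- A spherically symmetric decaying solution of `ΔU = 4πρ` is the potential of `ρ`. Indeed
`(r² U')' = 4π r² ρ`, so that `r² U'` is the mass in the ball of radius `r`. -/
lemma pot_eq_of_laplacian {U ρ : Space → ℝ} (hU : ContDiff ℝ 2 U)
    (hsym : ∀ (A : Space ≃ₗᵢ[ℝ] Space) x, U (A x) = U x) (hρ : Continuous ρ)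
    (hρ0 : ∀ x, 0 ≤ ρ x) (hρsym : ∀ (A : Space ≃ₗᵢ[ℝ] Space) x, ρ (A x) = ρ x)
    (hΔ : ∀ x, Laplacian.laplacian U x = 4 * Real.pi * ρ x)
    (hlim : Tendsto U (cocompact Space) (𝓝 0)) {x : Space} (hx : x ≠ 0) : pot ρ x = U x := by
  have hU1 : ContDiff ℝ 1 U := hU.of_le (by norm_num)
  have hray : ∀ {W : Space → ℝ}, (∀ (A : Space ≃ₗᵢ[ℝ] Space) x, W (A x) = W x) →
      ∀ y, W y = W (‖y‖ • stdVec 0) := by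
    intro W hW y
    obtain ⟨A, hA⟩ := exists_isometry_map_eq (x := y) (y := ‖y‖ • stdVec 0)
      (by rw [norm_smul, norm_stdVec]; simp)
    rw [← hA, hW]
  have hrayc : Continuous fun s : ℝ => s • stdVec 0 := by fun_prop
  set u' : ℝ → ℝ := fun r => partialD 0 U (r • stdVec 0) with hu'
  -- the radial form of the Poisson equation
  have hQ : ∀ r, HasDerivAt (fun r => r ^ 2 * u' r)
      (4 * Real.pi * (r ^ 2 * ρ (r • stdVec 0))) r := by
    intro r
    have h1 := (hasDerivAt_pow 2 r).mul (hasDerivAt_along_ray (contDiff_partialD hU 0) r)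
    have h2 : HasDerivAt (fun r => r ^ 2 * u' r) _ r := h1
    convert h2 using 1
    have h3 := hΔ (r • stdVec 0)
    rw [laplacian_eq_sum_partialD hU, Fin.sum_univ_three] at h3
    have h4 := mul_partialD_partialD hU hsym (i := 1) (by decide) r
    have h5 := mul_partialD_partialD hU hsym (i := 2) (by decide) r
    push_cast
    linear_combination (-(r ^ 2)) * h3 + r * h4 + r * h5
  have hmass : ∀ r, 0 ≤ r → massIn ρ r = r ^ 2 * u' r := by
    intro r hr
    have h1 : massIn ρ r = ∫ x : Space, (fun s : ℝ => (Iic r).indicator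
        (fun s => ρ (s • stdVec 0)) s) ‖x‖ := by
      rw [massIn, ← integral_indicator measurableSet_closedBall]
      refine integral_congr_ae (ae_of_all _ fun y => ?_)
      simp only [indicator, mem_Iic, mem_closedBall_zero_iff]
      rw [← hray hρsym y]
    rw [h1, integral_radial]
    have h2 : ∀ s : ℝ, s ^ 2 * (Iic r).indicator (fun s => ρ (s • stdVec 0)) s
        = (Iic r).indicator (fun s => s ^ 2 * ρ (s • stdVec 0)) s := fun s => by
      by_cases hs : s ∈ Iic r <;> simp [hs]
    simp only [h2]
    rw [integral_indicator measurableSet_Iic, Measure.restrict_restrict measurableSet_Iic,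
      inter_comm, Ioi_inter_Iic, ← intervalIntegral.integral_of_le hr]
    have h3 := intervalIntegral.integral_eq_sub_of_hasDerivAt (a := 0) (b := r) (fun s _ => hQ s)
      ((continuous_const.mul ((continuous_pow 2).mul (hρ.comp hrayc))).intervalIntegrable _ _)
    rw [intervalIntegral.integral_const_mul] at h3
    rw [h3]
    ring
  have hm0 : ∀ r, 0 ≤ massIn ρ r := fun r => massIn_nonneg (ae_of_all _ hρ0) r
  have hpos : 0 < ‖x‖ := norm_pos_iff.2 hx
  have hd : ∀ s ∈ Ioi ‖x‖, HasDerivAt (fun s : ℝ => U (s • stdVec 0)) (massIn ρ s / s ^ 2) s := by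
    intro s hs
    have hs0 : 0 < s := hpos.trans hs
    rw [hmass s hs0.le, mul_div_cancel_left₀ _ (by positivity)]
    exact hasDerivAt_along_ray hU1 s
  have htend : Tendsto (fun s : ℝ => U (s • stdVec 0)) atTop (𝓝 0) := by
    refine hlim.comp ?_
    rw [← Metric.cobounded_eq_cocompact, ← tendsto_norm_atTop_iff_cobounded]
    have : (fun s : ℝ => ‖s • stdVec 0‖) = fun s => |s| := by
      funext s; rw [norm_smul, norm_stdVec, mul_one, Real.norm_eq_abs]
    rw [this]
    exact tendsto_abs_atTop_atTop
  have hint := integral_Ioi_of_hasDerivAt_of_nonneg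
    (hU.continuous.comp hrayc).continuousWithinAt hd
    (fun s _ => div_nonneg (hm0 s) (sq_nonneg s)) htend
  rw [pot, hint, hray hsym x]
  simp

/-! ### Conserved quantities -/

lemma eq_of_hasDerivAt_zero {φ : ℝ → ℝ} (hc : ContinuousOn φ (Ici 0))
    (hd : ∀ t, 0 < t → HasDerivAt φ 0 t) {t : ℝ} (ht : 0 ≤ t) : φ t = φ 0 := by
  rcases ht.eq_or_lt with rfl | h
  · rfl
  obtain ⟨c, -, hs⟩ := exists_hasDerivAt_eq_slope φ (fun _ => 0) h
    (hc.mono fun s hs => hs.1) (fun s hs => hd s hs.1)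
  rw [eq_div_iff (by linarith), zero_mul] at hs
  linarith

/-- The integral of a quantity which is constant along the transport field and supported away
from the origin is conserved. -/
lemma Evolution.integral_eq_init {h : ℝ → Space × Space → ℝ} (hh : Evolution h)
    {a : ℝ → Space → Space} (ha : ∀ t, 0 < t → ContinuousOn (a t) {0}ᶜ)
    (h0 : ∀ T, ∃ η : ℝ, 0 < η ∧ ∀ t ∈ Icc 0 T, ∀ x v : Space, ‖x‖ ≤ η → h t (x, v) = 0)
    (hD : ∀ t, 0 < t → ∀ z : Space × Space, z.1 ≠ 0 → transportDeriv (a t) h t z = 0)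
    {t : ℝ} (ht : 0 ≤ t) : ∫ z, h t z = ∫ z, h 0 z := by
  refine eq_of_hasDerivAt_zero (φ := fun t => ∫ z, h t z) hh.continuousOn_integral
    (fun s hs => ?_) ht
  obtain ⟨η, hη, hη0⟩ := h0 s
  have h1 := (hh.hasDerivAt_integral_transport (ha s hs) hη hs (hη0 s ⟨hs.le, le_rfl⟩)).2
  have h2 : ∫ z, transportDeriv (a s) h s z = 0 := by
    refine integral_eq_zero_of_ae ?_
    have : ∀ᵐ z : Space × Space, z.1 ≠ 0 := Measure.quasiMeasurePreserving_fst.ae ae_ne_zero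
    filter_upwards [this] with z hz using hD s hs z hz
  rwa [h2] at h1

section conservation

variable {k l Mc L₀ : ℝ} {f : ℝ → Space × Space → ℝ} {U : ℝ → Space → ℝ}

namespace IsSolution

/-- The set of small angular momenta stays empty. -/
lemma eq_zero_of_angMomSq_lt (h : IsSolution Mc f U)
    (hinit : ∀ (A : Space ≃ₗᵢ[ℝ] Space) z, f 0 (A z.1, A z.2) = f 0 z)
    (hvan : ∀ z, angMomSq z < L₀ → f 0 z = 0) {t : ℝ} (ht : 0 ≤ t) {z : Space × Space}
    (hz : angMomSq z < L₀) : f t z = 0 := by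
  set χ : Space × Space → ℝ := fun z => expNegInvGlue (L₀ - angMomSq z) with hχ
  have hχ1 : ContDiff ℝ 1 χ := expNegInvGlue.contDiff.comp (contDiff_const.sub contDiff_angMomSq)
  have hχd : ∀ t, 0 ≤ t → ∀ z, fderiv ℝ χ z (z.2, accel Mc (U t) z.1) = 0 := by
    intro t ht z
    have hg : HasDerivAt expNegInvGlue (deriv expNegInvGlue (L₀ - angMomSq z))
        (L₀ - angMomSq z) :=
      ((expNegInvGlue.contDiff (n := 1)).differentiable one_ne_zero _).hasDerivAt
    have h1 : HasFDerivAt χ _ z := HasDerivAt.comp_hasFDerivAt z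
      (f := fun z => L₀ - angMomSq z) hg
      ((contDiff_angMomSq.differentiable one_ne_zero z).hasFDerivAt.const_sub L₀)
    rw [h1.fderiv]
    simp [fderiv_angMomSq_eq_zero (fun A x => h.symmetric_pot hinit ht A x) z]
  have hev := h.evolution.mul_static hχ1
  have key := hev.eq_zero_of_transportDeriv_le
    (fun t ht z => mul_nonneg (h.nonneg t ht z) (expNegInvGlue.nonneg _)) (fun z => ?_)
    (a := fun t => accel Mc (U t))
    (fun t ht => continuousOn_accel Mc (h.contDiff_pot t ht.le)) (T := t) (C := 0) le_rfl ?_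
    t ⟨ht, le_rfl⟩ z
  · exact (mul_eq_zero.1 key).resolve_right (expNegInvGlue.pos_of_pos (sub_pos.2 hz)).ne'
  · rcases lt_or_ge (angMomSq z) L₀ with hL | hL
    · rw [hvan z hL, zero_mul]
    · rw [hχ]
      simp only
      rw [expNegInvGlue.zero_of_nonpos (by linarith), mul_zero]
  · intro s hs η hη
    rw [zero_mul]
    refine integral_nonpos fun z => ?_
    simp only [Pi.zero_apply]
    by_cases hz : z.1 = 0
    · rw [hz, cutoff_eq_zero hη (by simpa using hη.le), mul_zero]
    · rw [h.evolution.transportDeriv_mul_static hs.1 (hχ1.differentiable one_ne_zero z),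
        h.transportDeriv_eq_zero hs.1 hz, hχd s hs.1.le]
      simp

lemma eq_zero_of_angMomSq_le (h : IsSolution Mc f U) (hL₀ : 0 < L₀)
    (hinit : ∀ (A : Space ≃ₗᵢ[ℝ] Space) z, f 0 (A z.1, A z.2) = f 0 z)
    (hvan : ∀ z, angMomSq z < L₀ → f 0 z = 0) {t : ℝ} (ht : 0 ≤ t) {z : Space × Space}
    (hz : angMomSq z ≤ L₀) : f t z = 0 := by
  have hc : Continuous fun s : ℝ => f t (z.1, s • z.2) :=
    (h.evolution.contDiff_slice ht).continuous.comp (by fun_prop)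
  have h1 : Tendsto (fun s : ℝ => f t (z.1, s • z.2)) (𝓝[<] 1) (𝓝 (f t z)) := by
    have := hc.tendsto 1
    rw [one_smul] at this
    exact this.mono_left nhdsWithin_le_nhds
  refine tendsto_nhds_unique (h1.congr' ?_) tendsto_const_nhds
  filter_upwards [Ioo_mem_nhdsLT (show (0:ℝ) < 1 by norm_num)] with s hs
  refine h.eq_zero_of_angMomSq_lt hinit hvan ht ?_
  have h2 : angMomSq (z.1, s • z.2) = s ^ 2 * angMomSq z := by
    simp only [angMomSq, norm_smul, inner_smul_right, Real.norm_eq_abs, mul_pow, sq_abs]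
    ring
  rw [h2]
  have h3 : s ^ 2 < 1 := by nlinarith [hs.1, hs.2]
  calc s ^ 2 * angMomSq z ≤ s ^ 2 * L₀ := by gcongr
    _ < 1 * L₀ := by gcongr
    _ = L₀ := one_mul _

/-- Particles with angular momentum bounded below do not come close to the point mass. -/
lemma exists_eq_zero_near_origin (h : IsSolution Mc f U) (hL₀ : 0 < L₀)
    (hinit : ∀ (A : Space ≃ₗᵢ[ℝ] Space) z, f 0 (A z.1, A z.2) = f 0 z)
    (hvan : ∀ z, angMomSq z < L₀ → f 0 z = 0) (T : ℝ) :
    ∃ η : ℝ, 0 < η ∧ ∀ t ∈ Icc 0 T, ∀ x v : Space, ‖x‖ ≤ η → f t (x, v) = 0 := by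
  obtain ⟨R, C, hR, -, h0, -⟩ := h.evolution.exists_bound T
  refine ⟨√L₀ / R, by positivity, fun t ht x v hx => ?_⟩
  by_cases hz : (x, v) ∈ phaseBox R
  · refine h.eq_zero_of_angMomSq_le hL₀ hinit hvan ht.1 ((angMomSq_le _).trans ?_)
    have hv : ‖v‖ ≤ R := by simpa using hz.2
    calc ‖x‖ ^ 2 * ‖v‖ ^ 2 ≤ (√L₀ / R) ^ 2 * R ^ 2 := by gcongr
      _ = L₀ := by
        rw [div_pow, Real.sq_sqrt hL₀.le]
        field_simp
  · exact h0 t ht _ hz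

/-- Integrals `∬ G(f) φ(L)` are conserved. -/
lemma integral_comp_mul_eq (h : IsSolution Mc f U) (hL₀ : 0 < L₀)
    (hinit : ∀ (A : Space ≃ₗᵢ[ℝ] Space) z, f 0 (A z.1, A z.2) = f 0 z)
    (hvan : ∀ z, angMomSq z < L₀ → f 0 z = 0) {G φ : ℝ → ℝ} (hG : ContDiff ℝ 1 G)
    (hG0 : G 0 = 0) (hφ : ContDiff ℝ 1 φ) {t : ℝ} (ht : 0 ≤ t) :
    Integrable (fun z => G (f t z) * φ (angMomSq z)) ∧
    ∫ z, G (f t z) * φ (angMomSq z) = ∫ z, G (f 0 z) * φ (angMomSq z) := by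
  have hφL : ContDiff ℝ 1 fun z : Space × Space => φ (angMomSq z) := hφ.comp contDiff_angMomSq
  have hev := (h.evolution.comp_left hG hG0).mul_static hφL
  refine ⟨hev.integrable ht, hev.integral_eq_init (a := fun t => accel Mc (U t))
    (fun t ht => continuousOn_accel Mc (h.contDiff_pot t ht.le)) (fun T => ?_)
    (fun s hs z hz => ?_) ht⟩
  · obtain ⟨η, hη, h0⟩ := h.exists_eq_zero_near_origin hL₀ hinit hvan T
    exact ⟨η, hη, fun t ht x v hx => by rw [h0 t ht x v hx, hG0, zero_mul]⟩
  · have hd : fderiv ℝ (fun z : Space × Space => φ (angMomSq z)) z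
        (z.2, accel Mc (U s) z.1) = 0 := by
      have h1 : HasFDerivAt (fun z : Space × Space => φ (angMomSq z)) _ z :=
        HasDerivAt.comp_hasFDerivAt z (hφ.differentiable one_ne_zero _).hasDerivAt
          (contDiff_angMomSq.differentiable one_ne_zero z).hasFDerivAt
      rw [h1.fderiv]
      simp [fderiv_angMomSq_eq_zero (fun A x => h.symmetric_pot hinit hs.le A x) z]
    rw [(h.evolution.comp_left hG hG0).transportDeriv_mul_static hs
      (hφL.differentiable one_ne_zero z), h.evolution.transportDeriv_comp_left hs hG,
      h.transportDeriv_eq_zero hs hz, hd]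
    simp

lemma integral_eq (h : IsSolution Mc f U) (hL₀ : 0 < L₀)
    (hinit : ∀ (A : Space ≃ₗᵢ[ℝ] Space) z, f 0 (A z.1, A z.2) = f 0 z)
    (hvan : ∀ z, angMomSq z < L₀ → f 0 z = 0) {t : ℝ} (ht : 0 ≤ t) :
    ∫ z, f t z = ∫ z, f 0 z := by
  simpa using (h.integral_comp_mul_eq hL₀ hinit hvan contDiff_id rfl
    (φ := fun _ => 1) contDiff_const ht).2

/-- Conservation of the Casimir functional. The singular weight is the increasing limit of the
smooth weights `((L - L₀)² + 1 / (n + 1)²) ^ (-l / (2 k))`. -/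
lemma casimir_eq (h : IsSolution Mc f U) (hk : 0 < k) (hl : 0 < l) (hL₀ : 0 < L₀)
    (hinit : ∀ (A : Space ≃ₗᵢ[ℝ] Space) z, f 0 (A z.1, A z.2) = f 0 z)
    (hvan : ∀ z, angMomSq z < L₀ → f 0 z = 0) {t : ℝ} (ht : 0 ≤ t) :
    casimir k l L₀ (f t) = casimir k l L₀ (f 0) := by
  have hp : (0:ℝ) < 1 + 1 / k := by positivity
  have hp1 : (1:ℝ) ≤ 1 + 1 / k := by
    have : 0 ≤ 1 / k := by positivity
    linarith
  have hq : 0 < l / k := by positivity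
  set ε : ℕ → ℝ := fun n => 1 / ((n : ℝ) + 1) with hε
  have hε0 : ∀ n, 0 < ε n := fun n => by positivity
  set φ : ℕ → ℝ → ℝ := fun n s => ((s - L₀) ^ 2 + ε n ^ 2) ^ (-(l / k) / 2) with hφ
  have hbase : ∀ n s, 0 < (s - L₀) ^ 2 + ε n ^ 2 := fun n s => by
    have := hε0 n
    positivity
  have hφ1 : ∀ n, ContDiff ℝ 1 (φ n) := fun n =>
    ContDiff.rpow_const_of_ne (by fun_prop) fun s => (hbase n s).ne'
  have hφ0 : ∀ n s, 0 ≤ φ n s := fun n s => Real.rpow_nonneg (hbase n s).le _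
  have hG : ContDiff ℝ 1 fun s : ℝ => s ^ (1 + 1 / k) := by
    have := Real.contDiff_rpow_const_of_le (p := 1 + 1 / k) (n := 1) (by simpa using hp1)
    simpa using this
  have hcons := fun n => h.integral_comp_mul_eq hL₀ hinit hvan hG (Real.zero_rpow hp.ne') (hφ1 n) ht
  have hint0 := fun n => (h.integral_comp_mul_eq hL₀ hinit hvan hG (Real.zero_rpow hp.ne') (hφ1 n)
    le_rfl).1
  have hlim : ∀ s, 0 ≤ s → Tendsto (fun n => ∫⁻ z, ENNReal.ofReal
      (f s z ^ (1 + 1 / k) * φ n (angMomSq z))) atTop (𝓝 (casimir k l L₀ (f s))) := by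
    intro s hs
    have hf0 := h.nonneg s hs
    have hv : ∀ z, angMomSq z ≤ L₀ → f s z = 0 := fun z hz =>
      h.eq_zero_of_angMomSq_le hL₀ hinit hvan hs hz
    rw [casimir_eq_lintegral_ofReal hk (ae_of_all _ hv)]
    refine lintegral_tendsto_of_tendsto_of_monotone (fun n => ?_) (ae_of_all _ fun z => ?_)
      (ae_of_all _ fun z => ?_)
    · exact ((hG.comp (h.evolution.contDiff_slice hs)).continuous.mul
        ((hφ1 n).continuous.comp continuous_angMomSq)).aemeasurable.ennreal_ofReal
    · intro n m hnm
      refine ENNReal.ofReal_le_ofReal ?_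
      have h1 : φ n (angMomSq z) ≤ φ m (angMomSq z) := by
        refine Real.rpow_le_rpow_of_nonpos (hbase m _) ?_ (by linarith)
        have h2 : ε m ≤ ε n := by
          simp only [hε]
          gcongr
        have := (hε0 m).le
        gcongr
      have := Real.rpow_nonneg (hf0 z) (1 + 1 / k)
      gcongr
    · refine (ENNReal.continuous_ofReal.tendsto _).comp ?_
      rw [abs_of_nonneg (hf0 z)]
      rcases le_or_gt (angMomSq z) L₀ with hL | hL
      · rw [hv z hL, Real.zero_rpow hp.ne']
        simp
      · refine Tendsto.const_mul _ ?_
        have hpos : 0 < angMomSq z - L₀ := sub_pos.2 hL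
        have h1 : max (angMomSq z - L₀) 0 ^ (-(l / k))
            = ((angMomSq z - L₀) ^ 2 + 0 ^ 2) ^ (-(l / k) / 2) := by
          rw [max_eq_left hpos.le, zero_pow two_ne_zero, add_zero, ← Real.rpow_natCast,
            ← Real.rpow_mul hpos.le]
          congr 1
          push_cast
          ring
        rw [h1]
        have h2 : Tendsto ε atTop (𝓝 0) := tendsto_one_div_add_atTop_nhds_zero_nat
        refine ((tendsto_const_nhds.add (h2.pow 2))).rpow_const (Or.inl ?_)
        positivity
  refine tendsto_nhds_unique (hlim t ht) ((hlim 0 le_rfl).congr fun n => ?_)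
  rw [← ofReal_integral_eq_lintegral_ofReal (hint0 n) (ae_of_all _ fun z =>
      mul_nonneg (Real.rpow_nonneg (h.nonneg 0 le_rfl z) _) (hφ0 n _)),
    ← ofReal_integral_eq_lintegral_ofReal (hcons n).1 (ae_of_all _ fun z =>
      mul_nonneg (Real.rpow_nonneg (h.nonneg t ht z) _) (hφ0 n _)), (hcons n).2]

end IsSolution

end conservation

/-! ### Conservation of energy -/

lemma finiteEnergy_of_support {u : Space × Space → ℝ} (hu : Continuous u)
    (hc : HasCompactSupport u) {η : ℝ} (hη : 0 < η)
    (h0 : ∀ x v : Space, ‖x‖ ≤ η → u (x, v) = 0) : FiniteEnergy u where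
  integrable := hu.integrable_of_hasCompactSupport hc
  div_sq := by
    have hi := hu.integrable_of_hasCompactSupport hc (μ := volume)
    refine (hi.abs.const_mul (1 / η ^ 2)).mono' ?_ (ae_of_all _ fun z => ?_)
    · exact (hu.measurable.div (by fun_prop)).aestronglyMeasurable
    · rw [Real.norm_eq_abs, abs_div, abs_of_nonneg (sq_nonneg ‖z.1‖)]
      rcases le_or_gt ‖z.1‖ η with hz | hz
      · rw [show u z = 0 from h0 z.1 z.2 hz]
        simp
      · rw [div_eq_inv_mul, one_div]
        gcongr
  kin := by
    refine Continuous.integrable_of_hasCompactSupport (by fun_prop) ?_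
    exact hc.mul_left (f := fun z : Space × Space => ‖z.2‖ ^ 2)

namespace IsSolution

variable {k l Mc L₀ : ℝ} {f : ℝ → Space × Space → ℝ} {U : ℝ → Space → ℝ}

lemma finiteEnergy (h : IsSolution Mc f U) (hL₀ : 0 < L₀)
    (hinit : ∀ (A : Space ≃ₗᵢ[ℝ] Space) z, f 0 (A z.1, A z.2) = f 0 z)
    (hvan : ∀ z, angMomSq z < L₀ → f 0 z = 0) {t : ℝ} (ht : 0 ≤ t) : FiniteEnergy (f t) := by
  obtain ⟨η, hη, h0⟩ := h.exists_eq_zero_near_origin hL₀ hinit hvan t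
  exact finiteEnergy_of_support (h.evolution.contDiff_slice ht).continuous
    (h.evolution.hasCompactSupport ht) hη (h0 t ⟨ht, le_rfl⟩)

lemma pot_density (h : IsSolution Mc f U)
    (hinit : ∀ (A : Space ≃ₗᵢ[ℝ] Space) z, f 0 (A z.1, A z.2) = f 0 z) {t : ℝ} (ht : 0 ≤ t)
    {x : Space} (hx : x ≠ 0) : pot (density (f t)) x = U t x := by
  obtain ⟨R, -, -, -, h0, -⟩ := h.evolution.exists_bound t
  refine pot_eq_of_laplacian (h.contDiff_pot t ht) (fun A x => h.symmetric_pot hinit ht A x)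
    (continuous_density (h.evolution.contDiff_slice ht).continuous (h0 t ⟨ht, le_rfl⟩))
    (fun x => integral_nonneg fun v => h.nonneg t ht _) (fun A x => ?_) (h.poisson t ht)
    (h.pot_tendsto t ht) hx
  rw [← density_comp_isometry]
  congr 1
  exact funext fun z => h.symmetric hinit ht A z

/-- The field distance between two times is quadratic in the time difference. -/
lemma exists_fieldDist_le (h : IsSolution Mc f U) (hL₀ : 0 < L₀)
    (hinit : ∀ (A : Space ≃ₗᵢ[ℝ] Space) z, f 0 (A z.1, A z.2) = f 0 z)
    (hvan : ∀ z, angMomSq z < L₀ → f 0 z = 0) (T : ℝ) :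
    ∃ K : ℝ, ∀ s ∈ Icc 0 T, ∀ t ∈ Icc 0 T, fieldDist (f t) (f s) ≤ K * |t - s| ^ 2 := by
  obtain ⟨η, hη, h0⟩ := h.exists_eq_zero_near_origin hL₀ hinit hvan T
  obtain ⟨R, C, hR, hC, hLip⟩ := h.evolution.exists_lipschitz T
  set b := (volume (phaseBox R)).toReal with hb
  refine ⟨1 / 2 * (b * C) * (1 / η * (b * C)), fun s hs t ht => ?_⟩
  have et := h.finiteEnergy hL₀ hinit hvan ht.1
  have es := h.finiteEnergy hL₀ hinit hvan hs.1
  have hd := et.sub es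
  have hi : Integrable ((phaseBox R).indicator fun _ => C * |t - s|) :=
    (integrable_indicator_iff (measurableSet_phaseBox R)).2
      (integrableOn_const (volume_phaseBox_lt_top R).ne)
  have h1 : ∫ z, |f t z - f s z| ≤ b * C * |t - s| := by
    refine (integral_mono hd.integrable.abs hi (hLip s hs t ht)).trans_eq ?_
    rw [integral_indicator (measurableSet_phaseBox R), setIntegral_const, Measure.real, smul_eq_mul,
      mul_assoc]
  have h2 : ∫ z, |f t z - f s z| / ‖z.1‖ ≤ 1 / η * (b * C * |t - s|) := by
    have h3 : ∫ z, |f t z - f s z| / ‖z.1‖ ≤ ∫ z, 1 / η * |f t z - f s z| := by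
      refine integral_mono_of_nonneg (ae_of_all _ fun z => by positivity)
        (hd.integrable.abs.const_mul _) (ae_of_all _ fun z => ?_)
      simp only
      rcases le_or_gt ‖z.1‖ η with hz | hz
      · rw [show f t z = 0 from h0 t ht z.1 z.2 hz, show f s z = 0 from h0 s hs z.1 z.2 hz]
        simp
      · rw [div_eq_inv_mul, one_div]
        gcongr
    rw [integral_const_mul] at h3
    refine h3.trans ?_
    gcongr
  rw [et.fieldDist_eq es]
  refine hd.field_le.trans ?_
  calc 1 / 2 * (∫ z, |f t z - f s z|) * ∫ z, |f t z - f s z| / ‖z.1‖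
      ≤ 1 / 2 * (b * C * |t - s|) * (1 / η * (b * C * |t - s|)) := by
        gcongr
    _ = _ := by ring

/-- At each time, the difference of the energies at nearby times is, up to the field distance,
the difference of integrals whose time derivative vanishes. -/
lemma exists_energy_expansion (h : IsSolution Mc f U) (hL₀ : 0 < L₀)
    (hinit : ∀ (A : Space ≃ₗᵢ[ℝ] Space) z, f 0 (A z.1, A z.2) = f 0 z)
    (hvan : ∀ z, angMomSq z < L₀ → f 0 z = 0) {s : ℝ} (hs : 0 ≤ s) :
    ∃ Φ : ℝ → ℝ, ContinuousOn Φ (Ici 0) ∧ (0 < s → HasDerivAt Φ 0 s) ∧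
      ∀ t ∈ Icc 0 (s + 1), mechEnergy Mc (f t) - mechEnergy Mc (f s)
        = Φ t - Φ s - fieldDist (f t) (f s) := by
  obtain ⟨η, hη, h0⟩ := h.exists_eq_zero_near_origin hL₀ hinit hvan (s + 1)
  have hη2 : 0 < η / 2 := by positivity
  have hsI : s ∈ Icc 0 (s + 1) := ⟨hs, by linarith⟩
  set V : Space → ℝ := fun y => U s y - Mc / ‖y‖ with hV
  set e : Space × Space → ℝ := fun z => (1 / 2 * ‖z.2‖ ^ 2 + V z.1) * cutoff (η / 2) z.1 with he
  have hkin : ContDiff ℝ 1 fun z : Space × Space => 1 / 2 * ‖z.2‖ ^ 2 :=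
    contDiff_const.mul ((contDiff_norm_sq ℝ).comp contDiff_snd)
  have hVd : ∀ z : Space × Space, z.1 ≠ 0 →
      ContDiffAt ℝ 1 (fun z : Space × Space => 1 / 2 * ‖z.2‖ ^ 2 + V z.1) z := fun z hz =>
    hkin.contDiffAt.add (ContDiffAt.comp (g := V) (f := fun z : Space × Space => z.1) z
      ((contDiffAt_sub_div_norm Mc (h.contDiff_pot s hs) hz).of_le (by norm_num)) contDiffAt_fst)
  have he1 : ContDiff ℝ 1 e := by
    rw [contDiff_iff_contDiffAt]
    intro z
    by_cases hz : z.1 = 0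
    · have hmem : {y : Space × Space | ‖y.1‖ < η / 2} ∈ 𝓝 z :=
        (isOpen_lt (by fun_prop) (by fun_prop)).mem_nhds (by simpa [hz] using hη)
      refine (contDiffAt_const (c := (0:ℝ))).congr_of_eventuallyEq ?_
      filter_upwards [hmem] with y hy
      have hy' : ‖y.1‖ ≤ η / 2 := le_of_lt hy
      rw [he]
      simp only
      rw [cutoff_eq_zero hη2 hy', mul_zero]
    · exact (hVd z hz).mul ((contDiff_cutoff _).comp contDiff_fst).contDiffAt
  have hev := h.evolution.mul_static he1
  refine ⟨fun t => ∫ z, f t z * e z, hev.continuousOn_integral, fun hs0 => ?_, fun t ht => ?_⟩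
  · have h1 := (hev.hasDerivAt_integral_transport (continuousOn_accel Mc (h.contDiff_pot s hs))
      hη hs0 (fun x v hx => by rw [h0 s hsI x v hx, zero_mul])).2
    have h2 : ∀ z : Space × Space, z.1 ≠ 0 →
        transportDeriv (accel Mc (U s)) (fun t z => f t z * e z) s z = 0 := by
      intro z hz
      rw [h.evolution.transportDeriv_mul_static hs0 (he1.differentiable one_ne_zero z),
        h.transportDeriv_eq_zero hs0 hz, zero_mul, zero_add]
      rcases le_or_gt ‖z.1‖ η with hzη | hzη
      · rw [show f s z = 0 from h0 s hsI z.1 z.2 hzη, zero_mul]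
      -- the particle energy is constant along the transport field with the field frozen
      have hmem : {y : Space × Space | η < ‖y.1‖} ∈ 𝓝 z :=
        (isOpen_lt (by fun_prop) (by fun_prop)).mem_nhds hzη
      have heq : e =ᶠ[𝓝 z] fun z => 1 / 2 * ‖z.2‖ ^ 2 + V z.1 := by
        filter_upwards [hmem] with y hy
        have hy' : 3 / 2 * (η / 2) ≤ ‖y.1‖ := by
          have : η < ‖y.1‖ := hy
          linarith
        rw [he]
        simp only
        rw [cutoff_eq_one hη2 hy', mul_one]
      have d1 : HasFDerivAt (fun z : Space × Space => 1 / 2 * ‖z.2‖ ^ 2)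
          ((1 / 2 : ℝ) • (2 • innerSL ℝ z.2).comp (ContinuousLinearMap.snd ℝ Space Space)) z :=
        (HasFDerivAt.comp (g := fun y : Space => ‖y‖ ^ 2) (f := fun z : Space × Space => z.2) z
          (hasStrictFDerivAt_norm_sq z.2).hasFDerivAt hasFDerivAt_snd).const_mul (1 / 2)
      have d2 : HasFDerivAt (fun z : Space × Space => V z.1)
          ((fderiv ℝ V z.1).comp (ContinuousLinearMap.fst ℝ Space Space)) z :=
        HasFDerivAt.comp (g := V) (f := fun z : Space × Space => z.1) z
          ((contDiffAt_sub_div_norm Mc (h.contDiff_pot s hs) hz).differentiableAt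
            two_ne_zero).hasFDerivAt hasFDerivAt_fst
      have d3 : HasFDerivAt (fun z : Space × Space => 1 / 2 * ‖z.2‖ ^ 2 + V z.1) _ z := d1.add d2
      rw [heq.fderiv_eq, d3.fderiv]
      have h3 : inner ℝ z.2 (accel Mc (U s) z.1) = -fderiv ℝ V z.1 z.2 := by
        rw [accel, inner_neg_right, real_inner_comm, inner_gradient_right]
      simp [h3]
    have h3 : ∫ z, transportDeriv (accel Mc (U s)) (fun t z => f t z * e z) s z = 0 := by
      refine integral_eq_zero_of_ae ?_
      have : ∀ᵐ z : Space × Space, z.1 ≠ 0 := Measure.quasiMeasurePreserving_fst.ae ae_ne_zero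
      filter_upwards [this] with z hz using h2 z hz
    rwa [h3] at h1
  · rw [(h.finiteEnergy hL₀ hinit hvan ht.1).mechEnergy_sub Mc (h.finiteEnergy hL₀ hinit hvan hs),
      ← integral_sub (hev.integrable ht.1) (hev.integrable hs)]
    congr 1
    refine integral_congr_ae (ae_of_all _ fun z => ?_)
    simp only
    rcases le_or_gt ‖z.1‖ η with hz | hz
    · rw [show f t z = 0 from h0 t ht z.1 z.2 hz, show f s z = 0 from h0 s hsI z.1 z.2 hz]
      simp
    · have hz0 : z.1 ≠ 0 := norm_pos_iff.1 (hη.trans hz)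
      rw [particleEnergy, h.pot_density hinit hs hz0, he]
      simp only
      rw [cutoff_eq_one hη2 (by linarith), hV]
      ring

/-- Conservation of energy: the derivative at time `s` of the energy is that of the integral of `f t`
against the particle energy at time `s`, which vanishes. -/
lemma mechEnergy_eq (h : IsSolution Mc f U) (hL₀ : 0 < L₀)
    (hinit : ∀ (A : Space ≃ₗᵢ[ℝ] Space) z, f 0 (A z.1, A z.2) = f 0 z)
    (hvan : ∀ z, angMomSq z < L₀ → f 0 z = 0) {t : ℝ} (ht : 0 ≤ t) :
    mechEnergy Mc (f t) = mechEnergy Mc (f 0) := by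
  have hderiv : ∀ s, 0 < s → HasDerivAt (fun t => mechEnergy Mc (f t)) 0 s := by
    intro s hs
    obtain ⟨Φ, -, hΦ, hexp⟩ := h.exists_energy_expansion hL₀ hinit hvan hs.le
    obtain ⟨K, hK⟩ := h.exists_fieldDist_le hL₀ hinit hvan (s + 1)
    have hnear : Icc 0 (s + 1) ∈ 𝓝 s := Icc_mem_nhds hs (by linarith)
    have hD : HasDerivAt (fun t => fieldDist (f t) (f s)) 0 s := by
      have hO : (fun t => fieldDist (f t) (f s)) =O[𝓝 s] fun t => ‖t - s‖ ^ 2 := by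
        refine Asymptotics.IsBigO.of_bound K ?_
        filter_upwards [hnear] with t ht
        rw [Real.norm_of_nonneg (fieldDist_nonneg _ _), norm_pow, norm_norm, Real.norm_eq_abs]
        exact hK s ⟨hs.le, by linarith⟩ t ht
      simpa using (hO.hasFDerivAt (by norm_num)).hasDerivAt
    have h1 := (((hΦ hs).sub_const (Φ s)).sub hD).add_const (mechEnergy Mc (f s))
    rw [sub_zero] at h1
    refine h1.congr_of_eventuallyEq ?_
    filter_upwards [hnear] with t ht
    have := hexp t ht
    simp only [Pi.sub_apply]
    linarith
  refine eq_of_hasDerivAt_zero (φ := fun t => mechEnergy Mc (f t)) (fun s hs => ?_) hderiv ht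
  rcases (mem_Ici.1 hs).eq_or_lt with rfl | hs0
  · obtain ⟨Φ, hΦ, -, hexp⟩ := h.exists_energy_expansion hL₀ hinit hvan le_rfl
    obtain ⟨K, hK⟩ := h.exists_fieldDist_le hL₀ hinit hvan (0 + 1)
    have hnear : Icc (0:ℝ) (0 + 1) ∈ 𝓝[Ici 0] 0 := Icc_mem_nhdsGE (by norm_num)
    have hD : Tendsto (fun t => fieldDist (f t) (f 0)) (𝓝[Ici 0] 0) (𝓝 0) := by
      have hlim : Tendsto (fun t : ℝ => K * |t - 0| ^ 2) (𝓝[Ici 0] 0) (𝓝 0) := by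
        have : Continuous fun t : ℝ => K * |t - 0| ^ 2 := by fun_prop
        have h2 := this.tendsto 0
        simp only [sub_zero, abs_zero, ne_eq, OfNat.ofNat_ne_zero, not_false_eq_true, zero_pow,
          mul_zero] at h2 ⊢
        exact h2.mono_left nhdsWithin_le_nhds
      refine squeeze_zero' (Eventually.of_forall fun t => fieldDist_nonneg _ _) ?_ hlim
      filter_upwards [hnear] with t ht using hK 0 ⟨le_rfl, by norm_num⟩ t ht
    have h1 := (((hΦ 0 hs).sub_const (Φ 0)).sub hD).add_const (mechEnergy Mc (f 0))
    have h2 : Φ 0 - Φ 0 - 0 + mechEnergy Mc (f 0) = mechEnergy Mc (f 0) := by ring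
    rw [h2] at h1
    refine Tendsto.congr' ?_ h1
    filter_upwards [hnear] with t ht
    have := hexp t ht
    linarith
  · exact (hderiv s hs0).continuousAt.continuousWithinAt

/-- Admissibility and the value of the energy-Casimir functional persist in time. -/
lemma admissible_and_energyCasimir_eq {M : ℝ} (h : IsSolution Mc f U) (hk : 0 < k) (hl : 0 < l)
    (hL₀ : 0 < L₀) (h0 : Admissible k l L₀ M (f 0)) {t : ℝ} (ht : 0 ≤ t) :
    Admissible k l L₀ M (f t) ∧
      energyCasimir k l L₀ Mc (f t) = energyCasimir k l L₀ Mc (f 0) := by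
  have hc0 : Continuous (f 0) := (h.evolution.contDiff_slice le_rfl).continuous
  have hinit : ∀ (A : Space ≃ₗᵢ[ℝ] Space) z, f 0 (A z.1, A z.2) = f 0 z := fun A z =>
    eq_of_ae_symmetric hc0 (h0.symmetric A) z
  have hvan : ∀ z, angMomSq z < L₀ → f 0 z = 0 := by
    have hopen : IsOpen {z : Space × Space | angMomSq z < L₀} :=
      isOpen_lt continuous_angMomSq continuous_const
    have hae : f 0 =ᵐ[volume.restrict {z : Space × Space | angMomSq z < L₀}] fun _ => (0 : ℝ) := by
      rw [EventuallyEq, ae_restrict_iff' hopen.measurableSet]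
      exact h0.vanish
    exact fun z hz => Measure.eqOn_open_of_ae_eq hae hopen hc0.continuousOn continuousOn_const hz
  have hE := h.finiteEnergy hL₀ hinit hvan ht
  have hcas := h.casimir_eq hk hl hL₀ hinit hvan ht
  have hconf : Confined k l L₀ (f t) :=
    { integrable := hE.integrable
      nonneg := ae_of_all _ (h.nonneg t ht)
      symmetric := fun A => ae_of_all _ fun z => h.symmetric hinit ht A z
      kin_lt_top := by
        have hi : Integrable fun z => 1 / 2 * ‖z.2‖ ^ 2 * f t z := by
          simpa only [mul_assoc] using hE.kin.const_mul (1 / 2)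
        exact hi.lintegral_lt_top
      casimir_lt_top := by
        rw [hcas]
        exact h0.confined.casimir_lt_top }
  refine ⟨?_, ?_⟩
  · have := hconf.admissible hk hl
    rwa [h.integral_eq hL₀ hinit hvan ht, h0.mass] at this
  · rw [hconf.energyCasimir_eq, h0.confined.energyCasimir_eq, hcas,
      h.mechEnergy_eq hL₀ hinit hvan ht]

end IsSolution

end

end VlasovPoisson

open VlasovPoisson

theorem corollary6p2 (k l L₀ Mc M : ℝ) (hk : 0 < k) (hkl : k ≤ l) (hL₀ : 0 < L₀) (hMc : 0 < Mc)
    (hM : 0 < M) (f₀ : Space × Space → ℝ) (hmin : IsMinimizer k l L₀ Mc M f₀)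
    (huniq : ∀ g, IsMinimizer k l L₀ Mc M g → g =ᵐ[volume] f₀) (E₀ : ℝ) :
    ∀ ε : ℝ, 0 < ε → ∃ δ : ℝ, 0 < δ ∧
      ∀ (f : ℝ → Space × Space → ℝ) (U : ℝ → Space → ℝ), IsSolution Mc f U →
        ContDiff ℝ 1 (f 0) → HasCompactSupport (f 0) → Admissible k l L₀ M (f 0) →
        klNorm k l L₀ (f 0) = klNorm k l L₀ f₀ →
        dist₀ k l L₀ Mc E₀ (f 0) f₀ + fieldDist (f 0) f₀ < δ →
        ∀ t : ℝ, 0 ≤ t → klNorm k l L₀ (fun z => f t z - f₀ z) < ENNReal.ofReal ε := by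
  intro ε hε
  obtain ⟨δ, hδ, hstab⟩ := exists_delta_klNorm_lt hk hkl hL₀ hMc hmin huniq hε
  refine ⟨δ, hδ, fun f U hsol _ _ hadm _ hsmall t ht => ?_⟩
  have hl : 0 < l := hk.trans_le hkl
  obtain ⟨hadm_t, hcons⟩ := hsol.admissible_and_energyCasimir_eq hk hl hL₀ hadm ht
  refine hstab (f t) hadm_t ?_
  rw [dist₀_eq hk hl hL₀ E₀ hadm hmin.1] at hsmall
  have := fieldDist_nonneg (f 0) f₀
  linarith
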